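/- **Setting.** Let $(I,\mathcal T)$ be a countably infinite, locally finite tree with root $r$ in which every branch $[i,\infty)=\{j: i\preceq j\}$ is infinite, where $i\preceq j$ means that $i$ lies on the geodesic from $r$ to $j$; let $|i|$ be the distance of $i$ to $r$ and $S_i$ the set of successors of $i$. Let $w:\mathbb N\to(0,\infty)$ be strictly increasing, $w_{-1}=0$ and $\Delta_k=w_k-w_{k-1}$. Let $X$ be the minimal continuous-time Markov chain on $I\cup\{\partial_r\}$, absorbed at $\partial_r$, that jumps between a site $i\ne r$ and its predecessor, in both directions, at rate $\Delta_{|i|}^{-1}$, and from $r$ to $\partial_r$ at rate $w_0^{-1}$; let $\zeta$ be its lifetime (the minimum of the hitting time $T_{\partial_r}$ and the explosion time). Let $\partial_\infty$ be the boundary of the tree, identified with the set of geodesic rays $\xi=(\xi(n))_{n\ge0}$ from $r$, with the topology generated by the sets $\{\xi:\xi(|i|)=i\}$, $i\in I$. Almost surely $X_\zeta$ is $\partial_r$ or a point of $\partial_\infty$. Assume transience, $\mathbb P_r\{T_{\partial_r}<\infty\}<1$, and let $\mu=\mathbb P_r\{X_\zeta\in\cdot\mid X_\zeta\in\partial_\infty\}$.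 A point $\xi\in\partial_\infty$ is regular, $\xi\in\partial_\infty^{reg}$, if $\lim_{j\to\xi}\mathbb P_j\{T_{\partial_r}<\infty\}=0$, and accessible if $\mu(C^n(\xi))>0$ for all $n$, where $C^n(\xi)=\{\eta:\eta(n)=\xi(n)\}$. Let $\mathcal F_n$ be the $\sigma$-field generated by the sets $C^n(\xi)$, $\mathbb E_\mu(\cdot|\mathcal F_{-1})=0$, $\mathcal D=\bigcup_n L^2(\mathcal F_n,\mu)$, $G_n(\xi)=\sum_{k\ge n}\Delta_k\,\mu(C^k(\xi))$, $|\xi\wedge\eta|=\sup\{n:\xi(n)=\eta(n)\}$, $U_{\xi\eta}=w_{|\xi\wedge\eta|}$ for $\xi\neq\eta$, $U_{\xi\xi}=\lim_n w_n\in(0,\infty]$, and $Wf(\xi)=\int U_{\xi\eta}f(\eta)\,\mu(d\eta)$. For $t>0$ put $$p(t,\xi,\eta)=\sum_{n=0}^{|\xi\wedge\eta|}\frac{e^{-t/G_n(\xi)}-e^{-t/G_{n+1}(\xi)}}{\mu(C^n(\xi))}\in[0,\infty],\qquad P_tf(\xi)=\int p(t,\xi,\eta)f(\eta)\,\mu(d\eta).$$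 **Theorem.** 1. The kernel $p$ is measurable. On $\partial_\infty^{reg}$ it is symmetric and satisfies the Chapman–Kolmogorov equations $p(s+t,\xi,\eta)=\int p(s,\xi,z)\,p(t,z,\eta)\,\mu(dz)$. On $\partial_\infty^{reg}$ the function $G_0$ is a constant in $(0,\infty)$, and $p$ is sub-Markovian with total mass $\int p(t,\xi,\eta)\,\mu(d\eta)=e^{-t/G_0}$. 2. The kernel is Feller. If $f$ is bounded and continuous on $\partial_\infty^{reg}$, then so is $P_tf$, with $\sup|P_tf|\le\sup|f|$, and $P_tf\to f$ pointwise on $\partial_\infty^{reg}$ as $t\downarrow0$. If $f$ is the restriction to $\partial_\infty^{reg}$ of a continuous function on $\partial_\infty$, then so is $P_tf$, and $P_tf\to f$ uniformly on $\partial_\infty^{reg}$ as $t\downarrow0$. 3. The operators $P_t$ form a strongly continuous sub-Markov semigroup on $L^2(\mu)$, and for $f\in L^2(\mu)$, with convergence in $L^2(\mu)$, $$P_tf=\sum_{n\ge0}e^{-t/G_n}\bigl(\mathbb E_\mu(f|\mathcal F_n)-\mathbb E_\mu(f|\mathcal F_{n-1})\bigr).$$ 4. $W$ is a bounded injective operator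 on $L^2(\mu)$ whose image contains $\mathcal D$. The infinitesimal generator of $(P_t)$ on $L^2(\mu)$ extends $-W^{-1}$, in particular on $\mathcal D$. The potential is $W$, that is $\int_0^\infty P_tf\,dt=Wf$ for all $f\in L^2(\mu)$. 5. The Green kernel is $U$: $\int_0^\infty p(t,\xi,\eta)\,dt=U_{\xi\eta}$ for all $\xi,\eta\in\partial_\infty^{reg}$, and more generally for every accessible $\xi$ and every $\eta\in\partial_\infty$. -/

import Mathlib

open MeasureTheory ProbabilityTheory Filter Topology Set
open scoped ENNReal

/-- An infinite, locally finite tree with a root and without finite branches, together with a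
strictly positive and strictly increasing weight function `w` of the levels. The associated tree
matrix is `U i j = w |i ∧ j|`. -/
structure TreeMatrix (I : Type*) where
  graph : SimpleGraph I
  isTree : graph.IsTree
  locallyFinite : ∀ i, (graph.neighborSet i).Finite
  root : I
  branch_infinite :
    ∀ i, {j | graph.dist root i + graph.dist i j = graph.dist root j}.Infinite
  w : ℕ → ℝ
  w_pos : ∀ n, 0 < w n
  w_strictMono : StrictMono w

/-- The sites of the tree and the cemetery `∂_r` attached to the root. -/
inductive State (I : Type*) where
  | site (i : I) : State I
  | cemetery : State I

instance (I : Type*) : MeasurableSpace (State I) := ⊤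

instance (I : Type*) : DiscreteMeasurableSpace (State I) := ⟨fun _ => trivial⟩

noncomputable section

/-- A sub-Markov semigroup in `L²(m)`: a strongly continuous semigroup `(S_t)_{t ≥ 0}` of bounded
operators which maps `[0,1]`-valued functions to `[0,1]`-valued functions. -/
structure IsSubMarkovSemigroup {E : Type*} [MeasurableSpace E] (m : Measure E)
    (S : ℝ → Lp ℝ 2 m →L[ℝ] Lp ℝ 2 m) : Prop where
  zero : S 0 = ContinuousLinearMap.id ℝ (Lp ℝ 2 m)
  add : ∀ s t, 0 ≤ s → 0 ≤ t → S (s + t) = (S s).comp (S t)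
  continuousOn : ∀ f, ContinuousOn (fun t => S t f) (Ici 0)
  subMarkov : ∀ t, 0 ≤ t → ∀ f : Lp ℝ 2 m, (∀ᵐ x ∂m, 0 ≤ f x ∧ f x ≤ 1) →
    ∀ᵐ x ∂m, 0 ≤ S t f x ∧ S t f x ≤ 1

/-- `f` belongs to the domain of the infinitesimal generator of `S`, which maps it to `g`. -/
def IsGeneratorAt {E : Type*} [MeasurableSpace E] {m : Measure E}
    (S : ℝ → Lp ℝ 2 m →L[ℝ] Lp ℝ 2 m) (f g : Lp ℝ 2 m) : Prop :=
  Tendsto (fun t : ℝ => t⁻¹ • (S t f - f)) (𝓝[>] 0) (𝓝 g)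

/-- `e^{-t/g}` for `g ∈ [0,∞]`, with `e^{-t/0} = e^{-∞} = 0`. -/
def expDecay (t : ℝ) (g : ℝ≥0∞) : ℝ :=
  if g = 0 then 0 else Real.exp (-t / g.toReal)

namespace TreeMatrix

variable {I : Type*} (T : TreeMatrix I)

/-- The level `|i|` of a site. -/
def level (i : I) : ℕ := T.graph.dist T.root i

/-- `i ≼ j`: the site `i` lies on the geodesic from the root to `j`. -/
def Below (i j : I) : Prop :=
  T.graph.dist T.root i + T.graph.dist i j = T.graph.dist T.root j

/-- The successors of `i`. -/
def succs (i : I) : Set I := {j | T.graph.Adj i j ∧ T.level j = T.level i + 1}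

/-- `Δ_k(w) = w_k - w_{k-1}`, with `w_{-1} = 0`. -/
def incr : ℕ → ℝ
  | 0 => T.w 0
  | k + 1 => T.w (k + 1) - T.w k

open scoped Classical in
/-- The conservative `q`-matrix on the sites and the cemetery, for which the cemetery is absorbing.
-/
def qMatrix : State I → State I → ℝ
  | .site i, .site j =>
      if i = j then
        -((T.incr (T.level i))⁻¹ + (T.succs i).ncard * (T.incr (T.level i + 1))⁻¹)
      else if T.graph.Adj i j then (T.incr (max (T.level i) (T.level j)))⁻¹
      else 0
  | .site i, .cemetery => if i = T.root then (T.w 0)⁻¹ else 0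
  | .cemetery, _ => 0

open scoped Classical in
/-- The off-diagonal part of the row `x` of the `q`-matrix, as a measure. -/
def rowMeasure (x : State I) : Measure (State I) :=
  Measure.sum fun y => (if y = x then 0 else ENNReal.ofReal (T.qMatrix x y)) • Measure.dirac y

/-- The law of the state after the first jump from `x`: `y ≠ x` has probability proportional to
`qMatrix x y`. At the cemetery the chain stays put. -/
def jumpLaw : State I → Measure (State I)
  | .site i => (T.rowMeasure (.site i) univ)⁻¹ • T.rowMeasure (.site i)
  | .cemetery => Measure.dirac .cemetery

/-- The rate of the exponential holding time. At a site `i` it is `-qMatrix i i`. The cemetery is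
left only for itself, so that the rate of these fictitious jumps does not matter. -/
def holdRate : State I → ℝ
  | .site i => -T.qMatrix (.site i) (.site i)
  | .cemetery => 1

theorem incr_pos (k : ℕ) : 0 < T.incr k := by
  cases k with
  | zero => exact T.w_pos 0
  | succ k => exact sub_pos.2 (T.w_strictMono (Nat.lt_succ_self k))

theorem holdRate_pos (x : State I) : 0 < T.holdRate x := by
  cases x with
  | site i =>
    have h1 := inv_pos.2 (T.incr_pos (T.level i))
    have h2 := inv_pos.2 (T.incr_pos (T.level i + 1))
    simp only [holdRate, qMatrix, if_true, neg_neg]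
    positivity
  | cemetery => exact one_pos

theorem rowMeasure_univ_ne_top (i : I) : T.rowMeasure (.site i) univ ≠ ∞ := by
  classical
  rw [rowMeasure, Measure.sum_apply _ MeasurableSet.univ]
  have hfin : ((State.site '' T.graph.neighborSet i) ∪ {State.cemetery}).Finite :=
    ((T.locallyFinite i).image _).union (finite_singleton _)
  rw [tsum_eq_sum (s := hfin.toFinset)]
  · refine ENNReal.sum_ne_top.2 fun y _ => ?_
    split_ifs <;> simp
  · intro y hy
    cases y with
    | cemetery => simp at hy
    | site j =>
      have hj : ¬ T.graph.Adj i j := by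
        intro h
        exact hy (by simp [h])
      by_cases hij : i = j
      · subst hij; simp
      · simp [qMatrix, hij, hj]

theorem rowMeasure_univ_ne_zero (i : I) : T.rowMeasure (.site i) univ ≠ 0 := by
  classical
  obtain ⟨j, hj, hne⟩ : ∃ j, j ∈ {j | T.graph.dist T.root i + T.graph.dist i j
      = T.graph.dist T.root j} ∧ j ≠ i := (T.branch_infinite i).nontrivial.exists_ne i
  obtain ⟨k, hk⟩ : ∃ k, T.graph.Adj i k := by
    obtain ⟨p⟩ := T.isTree.connected.preconnected i j
    cases p with
    | nil => exact absurd rfl hne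
    | cons h _ => exact ⟨_, h⟩
  rw [rowMeasure, Measure.sum_apply _ MeasurableSet.univ]
  intro h0
  rw [ENNReal.tsum_eq_zero] at h0
  have h1 := h0 (.site k)
  have hki : State.site k ≠ State.site i := by
    intro h
    injection h with h
    exact hk.ne h.symm
  simp [hki, qMatrix, hk, hk.ne] at h1
  exact absurd (T.incr_pos _) (not_lt.2 h1)

instance (x : State I) : IsProbabilityMeasure (T.jumpLaw x) := by
  cases x with
  | site i =>
    refine ⟨?_⟩
    simp only [jumpLaw, Measure.smul_apply, smul_eq_mul]
    exact ENNReal.inv_mul_cancel (T.rowMeasure_univ_ne_zero i) (T.rowMeasure_univ_ne_top i)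
  | cemetery => exact Measure.dirac.isProbabilityMeasure

/-- The law of the holding time in a state. -/
def holdKernel : Kernel (State I) ℝ where
  toFun x := expMeasure (T.holdRate x)
  measurable' := measurable_from_top

instance : IsMarkovKernel T.holdKernel :=
  ⟨fun x => isProbabilityMeasure_expMeasure (T.holdRate_pos x)⟩

/-- From the state `x`: the law of the next state together with the holding time there. -/
def stepKernel : Kernel (State I) (State I × ℝ) where
  toFun x := T.jumpLaw x ⊗ₘ T.holdKernel
  measurable' := measurable_from_top

instance : IsMarkovKernel T.stepKernel :=
  ⟨fun x => inferInstanceAs (IsProbabilityMeasure (T.jumpLaw x ⊗ₘ T.holdKernel))⟩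

/-- The one-step transition given the past, which depends on the last state only. -/
def transition (n : ℕ) :
    Kernel (Π _ : Finset.Iic n, State I × ℝ) (State I × ℝ) :=
  T.stepKernel.comap (fun h => (h ⟨n, Finset.mem_Iic.2 le_rfl⟩).1)
    ((measurable_pi_apply _).fst)

instance (n : ℕ) : IsMarkovKernel (T.transition n) :=
  inferInstanceAs (IsMarkovKernel (T.stepKernel.comap _ _))

/-- The law `ℙ_i` of the sequence of visited states and holding times of the minimal
continuous-time Markov chain with `q`-matrix `qMatrix` that starts at the site `i`. -/
def law (i : I) : Measure (ℕ → State I × ℝ) :=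
  Kernel.trajMeasure (X := fun _ => State I × ℝ)
    (Measure.dirac (State.site i) ⊗ₘ T.holdKernel) T.transition

end TreeMatrix

/-- The time of the `n`-th jump. -/
def jumpTime {I : Type*} (ω : ℕ → State I × ℝ) (n : ℕ) : ℝ :=
  ∑ k ∈ Finset.range n, (ω k).2

/-- `X_t = x`: the chain is in the state `x` at time `t` (in particular `t` is less than the
explosion time). -/
def StateAt {I : Type*} (ω : ℕ → State I × ℝ) (t : ℝ) (x : State I) : Prop :=
  ∃ n, jumpTime ω n ≤ t ∧ t < jumpTime ω (n + 1) ∧ (ω n).1 = x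

/-- `T_{∂_r} < ∞`: the chain reaches the cemetery. -/
def HitsCemetery {I : Type*} (ω : ℕ → State I × ℝ) : Prop :=
  ∃ t, 0 ≤ t ∧ StateAt ω t .cemetery

namespace TreeMatrix

variable {I : Type*} (T : TreeMatrix I)

/-- The probability that the chain started at `i` reaches the cemetery. -/
def hitProb (i : I) : ℝ≥0∞ := T.law i {ω | HitsCemetery ω}

/-- The tree matrix is transient. -/
def Transient : Prop := T.hitProb T.root < 1

/-- The boundary of the tree, as the set of the geodesic rays that start at the root. -/
def Boundary : Type _ :=
  {ξ : ℕ → I // ξ 0 = T.root ∧ (∀ n, T.level (ξ n) = n) ∧ ∀ n, T.graph.Adj (ξ n) (ξ (n + 1))}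

variable {T}

/-- The site `ξ(n)` of level `n` on the geodesic from the root to `ξ`. -/
def Boundary.at (ξ : T.Boundary) (n : ℕ) : I := ξ.1 n

variable (T)

/-- `∂_∞(i)`, the set of the boundary points with `i` on their geodesic. -/
def shadow (i : I) : Set T.Boundary := {ξ | ∃ n, ξ.at n = i}

instance : TopologicalSpace T.Boundary := TopologicalSpace.generateFrom (range T.shadow)

instance : MeasurableSpace T.Boundary := borel _

instance : BorelSpace T.Boundary := ⟨rfl⟩

variable {T} in
/-- `X_ζ = ξ`: the chain does not reach the cemetery, and `X_t` converges to `ξ` as `t` increases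
to the lifetime: for every `n`, from some time before the lifetime on, it stays in the branch that
hangs from `ξ(n)`. -/
def ExitsAt (ω : ℕ → State I × ℝ) (ξ : T.Boundary) : Prop :=
  ¬ HitsCemetery ω ∧
    ∀ n, ∃ s, 0 ≤ s ∧ (∃ x, StateAt ω s x) ∧
      ∀ t, s ≤ t → ∀ x, StateAt ω t x → ∃ i, x = .site i ∧ T.Below (ξ.at n) i

open scoped Classical in
/-- The exit point `X_ζ`, a point of the boundary or else the cemetery, here the point of `Unit`. -/
def exitPoint (ω : ℕ → State I × ℝ) : T.Boundary ⊕ Unit :=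
  if h : ∃ ξ : T.Boundary, ExitsAt ω ξ then .inl h.choose else .inr ()

/-- The exit measure `ℙ_r(X_ζ ∈ · | X_ζ ∈ ∂_∞)`. -/
def exitMeasure : Measure T.Boundary :=
  (cond ((T.law T.root).map T.exitPoint) (range Sum.inl)).comap Sum.inl

variable {T}

/-- The filter on the sites of convergence `j → ξ` to a boundary point. -/
def Boundary.toward (ξ : T.Boundary) : Filter I :=
  ⨅ n, 𝓟 {j | T.Below (ξ.at n) j}

variable (T)

/-- The regular boundary points. -/
def regular : Set T.Boundary := {ξ | Tendsto T.hitProb ξ.toward (𝓝 0)}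

/-- `C^n(ξ)`, the boundary points whose geodesic contains `ξ(n)`. -/
def C (n : ℕ) (ξ : T.Boundary) : Set T.Boundary := {η | ξ.at n = η.at n}

/-- The accessible boundary points, that is, the closed support of the exit measure. -/
def accessible : Set T.Boundary := {ξ | ∀ n, 0 < T.exitMeasure (T.C n ξ)}

/-- The `σ`-field generated by the sets `C^n(ξ)`. -/
abbrev F (n : ℕ) : MeasurableSpace T.Boundary := MeasurableSpace.generateFrom (range (T.C n))

/-- `G_n(ξ) = ∑_{k ≥ n} Δ_k(w) μ(C^k(ξ))`. -/
def G (n : ℕ) (ξ : T.Boundary) : ℝ≥0∞ :=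
  ∑' k : ℕ, ENNReal.ofReal (T.incr (n + k)) * T.exitMeasure (T.C (n + k) ξ)

variable {T} in
/-- `|ξ ∧ η|`, which is infinite if `ξ = η`. -/
def meetLevel (ξ η : T.Boundary) : ℕ∞ := ⨆ n : {n : ℕ // ξ.at n = η.at n}, (n.1 : ℕ∞)

open scoped Classical in
/-- The extension of the tree matrix to the boundary; on the diagonal it is the (possibly infinite)
limit of `w`. -/
def U (ξ η : T.Boundary) : ℝ≥0∞ :=
  if ξ = η then ⨆ n, ENNReal.ofReal (T.w n) else ENNReal.ofReal (T.w (meetLevel ξ η).toNat)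

open scoped Classical in
/-- The kernel
`p(t,ξ,η) = ∑_{n=0}^{|ξ ∧ η|} (e^{-t/G_n(ξ)} - e^{-t/G_{n+1}(ξ)}) / μ(C^n(ξ)) ∈ [0,∞]`. -/
def p (t : ℝ) (ξ η : T.Boundary) : ℝ≥0∞ :=
  ∑' n : ℕ, if (n : ℕ∞) ≤ meetLevel ξ η then
    ENNReal.ofReal (expDecay t (T.G n ξ) - expDecay t (T.G (n + 1) ξ)) / T.exitMeasure (T.C n ξ)
  else 0

/-- `P_t f(ξ) = ∫ p(t,ξ,η) f(η) μ(dη)`. -/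
def P (t : ℝ) (f : T.Boundary → ℝ) (ξ : T.Boundary) : ℝ :=
  ∫ η, (T.p t ξ η).toReal * f η ∂T.exitMeasure

/-- `W f(ξ) = ∫ U_{ξη} f(η) μ(dη)`. -/
def W (f : T.Boundary → ℝ) (ξ : T.Boundary) : ℝ :=
  ∫ η, (T.U ξ η).toReal * f η ∂T.exitMeasure

/-- `E_μ(f | F_n) - E_μ(f | F_{n-1})`, where `E_μ(· | F_{-1}) = 0`. -/
def mgDiff (f : T.Boundary → ℝ) : ℕ → T.Boundary → ℝ
  | 0 => T.exitMeasure[f | T.F 0]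
  | n + 1 => T.exitMeasure[f | T.F (n + 1)] - T.exitMeasure[f | T.F n]

/-- The simple functions `⋃_n L²(F_n, μ)`. -/
def simple : Set (Lp ℝ 2 T.exitMeasure) :=
  {f | ∃ n, AEStronglyMeasurable[T.F n] f T.exitMeasure}

end TreeMatrix

end

/-! Let `hit` be the probability h of reaching the cemetery, with value 1 at the cemetery. It is
harmonic, and the exit measure μ is the flow of its gradient: Δ_{|j|} μ(∂_∞(j)) = α (h(pred j) -
h(j)) with α = w_0 / (1 - h(r)) (`Transient.incr_mul_exitMeasure_shadow`). Along a ray this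
telescopes to G_n(ξ) = α (h(ξ(n-1)) - lim h(ξ(m))), where ξ(-1) is the cemetery. At a regular point
the limit is 0, so G_n = α h(ξ(n-1)) is positive, decreases to 0, starts with G_0 = α and depends on
ξ(n-1) alone (`G_eq_gReg`).

The probabilistic input is martingale convergence. Off the event of absorption h tends to 0 along
the path (`ae_tendsto_hit`). As h is positive, every site is finally left, so the path converges to
a boundary point, visiting each site of its ray; hence μ-almost every point is regular
(`ae_mem_regular`). The probability of exiting in ∂_∞(j) is the value at the root of the bounded
harmonic function whose limit along unabsorbed paths is the indicator of staying finally in the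
branch of j, and which vanishes at the cemetery. It is assembled from h, cut off to the branch of j,
and a Green function with pole at the predecessor of j (`exists_green`, `law_real_eventuallyIn`).

The rest is the calculus of hierarchical kernels ∑_{n ≤ |ξ∧η|} A_n(ξ) whose tails from level M on
have mass e_M(ξ) (`IsCoeff`). Both p and U have this form, with e_M = exp(-t/G_M) and e_M = G_M. Two
such kernels compose by `lintegral_ker_mul_ker`, which gives Chapman–Kolmogorov. On E_μ(f|F_M)
summation by parts turns the kernel into multiplication of the martingale differences by e_n, which
gives the expansion. Since e^{-t/G_M} tends to 0 as M grows and to 1 as t decreases to 0, splitting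
the kernel at a level M gives the Feller properties. Integrating e^{-t/G_n} - e^{-t/G_{n+1}} over t
gives G_n - G_{n+1} = Δ_n μ(C^n), so the Green kernel is U.

In L²(μ) the Schur test makes p and U bounded operators with norms at most e^{-t/α} and α. The
potential of the semigroup is W by Tonelli, so the generator sends Wg to -g, and W is injective. It
preserves each finite-dimensional space L²(F_n), hence is onto there. -/

noncomputable section

set_option linter.unusedSectionVars false

namespace TreeMatrix

section

variable {I : Type*} (T : TreeMatrix I)

/-! ### Combinatorics of the tree -/

theorem level_root : T.level T.root = 0 := by simp [level]

theorem level_eq_zero_iff {i : I} : T.level i = 0 ↔ i = T.root := by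
  rw [level, T.isTree.connected.dist_eq_zero_iff, eq_comm]

theorem exists_parent {i : I} (hi : i ≠ T.root) :
    ∃ k, T.graph.Adj k i ∧ T.level i = T.level k + 1 := by
  obtain ⟨p, hp, hpl⟩ := T.isTree.connected.exists_path_of_dist T.root i
  have hnil : ¬ p.Nil := fun h => hi h.eq.symm
  refine ⟨p.penultimate, p.adj_penultimate hnil, ?_⟩
  have h1 : T.graph.dist T.root p.penultimate ≤ p.dropLast.length :=
    SimpleGraph.dist_le _
  have h2 : p.dropLast.length + 1 = p.length := by
    have := p.length_dropLast_add_one hnil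
    simpa using this
  rcases T.isTree.dist_eq_dist_add_one_of_adj T.root (p.adj_penultimate hnil) with h | h
  · simp only [level]; omega
  · exact h

/-- Geodesics from the root to u and to v, prolonged by the last edge, are both geodesics to i.
Paths in a tree are unique, so their penultimate sites agree. -/
theorem parent_unique {i u v : I} (hu : T.graph.Adj u i) (hul : T.level i = T.level u + 1)
    (hv : T.graph.Adj v i) (hvl : T.level i = T.level v + 1) : u = v := by
  obtain ⟨p, hp, hpl⟩ := T.isTree.connected.exists_path_of_dist T.root u
  obtain ⟨q, hq, hql⟩ := T.isTree.connected.exists_path_of_dist T.root v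
  have hp' : (p.concat hu).IsPath := by
    apply SimpleGraph.Walk.isPath_of_length_eq_dist
    rw [SimpleGraph.Walk.length_concat, hpl]
    exact hul.symm
  have hq' : (q.concat hv).IsPath := by
    apply SimpleGraph.Walk.isPath_of_length_eq_dist
    rw [SimpleGraph.Walk.length_concat, hql]
    exact hvl.symm
  have h := congrArg SimpleGraph.Walk.penultimate
    ((T.isTree.existsUnique_path T.root i).unique hp' hq')
  simpa using h

open scoped Classical in
/-- The predecessor of a site (the root is its own predecessor). -/
def par (i : I) : I :=
  if h : i = T.root then T.root else (T.exists_parent h).choose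

theorem par_adj {i : I} (hi : i ≠ T.root) : T.graph.Adj (T.par i) i := by
  rw [par, dif_neg hi]
  exact (T.exists_parent hi).choose_spec.1

theorem level_par {i : I} (hi : i ≠ T.root) : T.level i = T.level (T.par i) + 1 := by
  rw [par, dif_neg hi]
  exact (T.exists_parent hi).choose_spec.2

theorem par_ne {i : I} (hi : i ≠ T.root) : T.par i ≠ i := (T.par_adj hi).ne

theorem eq_par {i k : I} (h : T.graph.Adj k i) (hl : T.level i = T.level k + 1) :
    k = T.par i := by
  have hi : i ≠ T.root := by
    rintro rfl
    rw [level_root] at hl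
    omega
  exact T.parent_unique h hl (T.par_adj hi) (T.level_par hi)

theorem ne_root_of_level {i : I} {n : ℕ} (h : T.level i = n + 1) : i ≠ T.root := by
  rintro rfl
  rw [level_root] at h
  omega

theorem mem_succs_iff {i l : I} : l ∈ T.succs i ↔ l ≠ T.root ∧ T.par l = i := by
  constructor
  · rintro ⟨h, hl⟩
    exact ⟨T.ne_root_of_level hl, (T.eq_par h hl).symm⟩
  · rintro ⟨h, rfl⟩
    exact ⟨T.par_adj h, T.level_par h⟩

theorem adj_iff {i l : I} :
    T.graph.Adj i l ↔ (i ≠ T.root ∧ T.par i = l) ∨ (l ≠ T.root ∧ T.par l = i) := by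
  constructor
  · intro h
    rcases T.isTree.dist_eq_dist_add_one_of_adj T.root h with h' | h'
    · exact Or.inl ((T.mem_succs_iff (i := l) (l := i)).1 ⟨h.symm, h'⟩)
    · exact Or.inr ((T.mem_succs_iff (i := i) (l := l)).1 ⟨h, h'⟩)
  · rintro (⟨h, rfl⟩ | ⟨h, rfl⟩)
    · exact (T.par_adj h).symm
    · exact T.par_adj h

theorem below_refl (i : I) : T.Below i i := by simp [Below]

theorem Below.level_le {T : TreeMatrix I} {i j : I} (h : T.Below i j) :
    T.level i ≤ T.level j := by
  simp only [Below, level] at *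
  omega

theorem below_root_iff {i : I} : T.Below i T.root ↔ i = T.root := by
  constructor
  · intro h
    have := h.level_le
    rw [level_root] at this
    exact T.level_eq_zero_iff.1 (by omega)
  · rintro rfl
    exact T.below_refl _

/-- This one-step recursion replaces the metric definition of the order in all inductions along a
branch. -/
theorem below_iff {i j : I} (hj : j ≠ T.root) : T.Below i j ↔ i = j ∨ T.Below i (T.par j) := by
  have hl := T.level_par hj
  constructor
  · intro h
    by_cases hij : i = j
    · exact Or.inl hij
    right
    obtain ⟨p, hp, hpl⟩ := T.isTree.connected.exists_path_of_dist i j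
    have hnil : ¬ p.Nil := fun h => hij h.eq
    have h2 : p.dropLast.length + 1 = p.length := p.length_dropLast_add_one hnil
    have h1 : T.graph.dist i p.penultimate ≤ p.dropLast.length := SimpleGraph.dist_le _
    have htri := T.isTree.connected.dist_triangle (u := T.root) (v := i) (w := p.penultimate)
    have hadj := p.adj_penultimate hnil
    have hk : p.penultimate = T.par j := by
      apply T.eq_par hadj
      rcases T.isTree.dist_eq_dist_add_one_of_adj T.root hadj with h' | h'
      · simp only [Below] at h
        omega
      · exact h'
    rw [← hk] at hl ⊢
    simp only [Below, level] at *
    omega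
  · rintro (rfl | h)
    · exact T.below_refl _
    · have h1 := T.isTree.connected.dist_triangle (u := i) (v := T.par j) (w := j)
      rw [SimpleGraph.dist_eq_one_iff_adj.2 (T.par_adj hj)] at h1
      have h2 := T.isTree.connected.dist_triangle (u := T.root) (v := i) (w := j)
      simp only [Below, level] at *
      omega

/-- The ancestor of level `n` of a site (of level at least `n`). -/
def anc (n : ℕ) (j : I) : I := T.par^[T.level j - n] j

theorem anc_self (j : I) : T.anc (T.level j) j = j := by simp [anc]

theorem anc_par {n : ℕ} {j : I} (h : n < T.level j) : T.anc n (T.par j) = T.anc n j := by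
  have hj : j ≠ T.root := by
    rintro rfl
    rw [level_root] at h
    omega
  have hl := T.level_par hj
  rw [anc, anc, show T.level j - n = (T.level (T.par j) - n) + 1 by omega,
    Function.iterate_succ_apply]

theorem level_induction {motive : I → Prop} (root : motive T.root)
    (step : ∀ i, i ≠ T.root → motive (T.par i) → motive i) (i : I) : motive i := by
  induction hn : T.level i generalizing i with
  | zero => rwa [T.level_eq_zero_iff.1 hn]
  | succ n ih =>
    have hi := T.ne_root_of_level hn
    have := T.level_par hi
    exact step i hi (ih _ (by omega))

theorem below_iff_anc {i j : I} :
    T.Below i j ↔ T.level i ≤ T.level j ∧ T.anc (T.level i) j = i := by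
  induction j using T.level_induction with
  | root =>
    rw [below_root_iff, level_root]
    constructor
    · rintro rfl
      exact ⟨T.level_root.le, T.anc_self _⟩
    · rintro ⟨h, -⟩
      exact T.level_eq_zero_iff.1 (by omega)
  | step j hj ih =>
    rw [T.below_iff hj, ih]
    have hl := T.level_par hj
    constructor
    · rintro (rfl | ⟨h, h'⟩)
      · exact ⟨le_rfl, T.anc_self _⟩
      · exact ⟨by omega, by rwa [← T.anc_par (by omega)]⟩
    · rintro ⟨h, h'⟩
      rcases h.eq_or_lt with he | hlt
      · left
        rw [he, T.anc_self] at h'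
        exact h'.symm
      · right
        exact ⟨by omega, by rwa [T.anc_par hlt]⟩

theorem level_anc {n : ℕ} {j : I} (h : n ≤ T.level j) : T.level (T.anc n j) = n := by
  induction j using T.level_induction with
  | root =>
    rw [level_root] at h
    obtain rfl : n = 0 := by omega
    rw [← T.level_root, T.anc_self]
  | step j hj ih =>
    rcases h.eq_or_lt with he | hlt
    · rw [he, T.anc_self]
    · have hl := T.level_par hj
      rw [← T.anc_par hlt]
      exact ih (by omega)

theorem par_anc {n : ℕ} {j : I} (h : n + 1 ≤ T.level j) :
    T.par (T.anc (n + 1) j) = T.anc n j := by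
  rw [anc, anc, show T.level j - n = (T.level j - (n + 1)) + 1 by omega,
    Function.iterate_succ_apply']

theorem anc_below {n : ℕ} {j : I} (h : n ≤ T.level j) : T.Below (T.anc n j) j := by
  rw [below_iff_anc, T.level_anc h]
  exact ⟨h, rfl⟩

theorem anc_eq_of_adj {n : ℕ} {i l : I} (h : T.graph.Adj i l) (hi : n ≤ T.level i)
    (hl : n ≤ T.level l) : T.anc n i = T.anc n l := by
  rcases T.adj_iff.1 h with ⟨hr, rfl⟩ | ⟨hr, rfl⟩
  · rw [T.anc_par]
    have := T.level_par hr
    omega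
  · rw [T.anc_par]
    have := T.level_par hr
    omega

theorem Below.trans {T : TreeMatrix I} {i j k : I} (h : T.Below i j) (h' : T.Below j k) :
    T.Below i k := by
  have h1 := T.isTree.connected.dist_triangle (u := i) (v := j) (w := k)
  have h2 := T.isTree.connected.dist_triangle (u := T.root) (v := i) (w := k)
  simp only [Below] at *
  omega

theorem Below.eq_of_level {T : TreeMatrix I} {i i' j : I} (h : T.Below i j) (h' : T.Below i' j)
    (hl : T.level i = T.level i') : i = i' := by
  rw [below_iff_anc] at h h'
  rw [← h.2, ← h'.2, hl]

/-- Local finiteness enters here. The lemma is behind the compactness of the boundary, the finite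
dimension of L²(F_n) and the bounds that are uniform over a level. -/
theorem finite_level_le (n : ℕ) : {i | T.level i ≤ n}.Finite := by
  induction n with
  | zero =>
    refine (finite_singleton T.root).subset fun i hi => ?_
    exact T.level_eq_zero_iff.1 (Nat.le_zero.1 hi)
  | succ n ih =>
    refine ((ih.biUnion fun i _ => T.locallyFinite i).union (finite_singleton T.root)).subset ?_
    intro i hi
    by_cases hr : i = T.root
    · exact Or.inr hr
    · left
      have hl := T.level_par hr
      simp only [mem_ofPred_eq] at hi
      exact mem_biUnion (show T.par i ∈ {i | T.level i ≤ n} by simp; omega) (T.par_adj hr)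

/-! ### Boundary points -/

section Boundary

variable {T}

theorem Boundary.at_zero (ξ : T.Boundary) : ξ.at 0 = T.root := ξ.2.1

theorem Boundary.level_at (ξ : T.Boundary) (n : ℕ) : T.level (ξ.at n) = n := ξ.2.2.1 n

theorem Boundary.adj_at (ξ : T.Boundary) (n : ℕ) : T.graph.Adj (ξ.at n) (ξ.at (n + 1)) :=
  ξ.2.2.2 n

theorem Boundary.at_succ_ne_root (ξ : T.Boundary) (n : ℕ) : ξ.at (n + 1) ≠ T.root :=
  T.ne_root_of_level (ξ.level_at (n + 1))

theorem Boundary.par_at (ξ : T.Boundary) (n : ℕ) : T.par (ξ.at (n + 1)) = ξ.at n :=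
  (T.eq_par (ξ.adj_at n) (by rw [ξ.level_at, ξ.level_at])).symm

theorem Boundary.ext {ξ η : T.Boundary} (h : ∀ n, ξ.at n = η.at n) : ξ = η :=
  Subtype.ext (funext h)

theorem Boundary.below_at (ξ : T.Boundary) {n m : ℕ} (h : n ≤ m) : T.Below (ξ.at n) (ξ.at m) := by
  induction m, h using Nat.le_induction with
  | base => exact T.below_refl _
  | succ m _ ih =>
    rw [T.below_iff (ξ.at_succ_ne_root m), ξ.par_at]
    exact Or.inr ih

theorem Boundary.at_eq_of_le {ξ η : T.Boundary} {n m : ℕ} (h : n ≤ m) (he : ξ.at m = η.at m) :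
    ξ.at n = η.at n := by
  refine (ξ.below_at h).eq_of_level ?_ (by rw [ξ.level_at, η.level_at])
  rw [he]
  exact η.below_at h

theorem mem_shadow_iff {i : I} {ξ : T.Boundary} : ξ ∈ T.shadow i ↔ ξ.at (T.level i) = i := by
  constructor
  · rintro ⟨n, rfl⟩
    rw [ξ.level_at]
  · exact fun h => ⟨_, h⟩

theorem mem_C_iff {n : ℕ} {ξ η : T.Boundary} : η ∈ T.C n ξ ↔ ξ.at n = η.at n := Iff.rfl

theorem C_eq_shadow (n : ℕ) (ξ : T.Boundary) : T.C n ξ = T.shadow (ξ.at n) := by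
  ext η
  rw [mem_shadow_iff, ξ.level_at, mem_C_iff, eq_comm]

theorem mem_C_self (n : ℕ) (ξ : T.Boundary) : ξ ∈ T.C n ξ := rfl

theorem C_eq_C {n : ℕ} {ξ η : T.Boundary} (h : ξ.at n = η.at n) : T.C n ξ = T.C n η := by
  rw [C_eq_shadow, C_eq_shadow, h]

theorem C_anti {n m : ℕ} (h : n ≤ m) (ξ : T.Boundary) : T.C m ξ ⊆ T.C n ξ :=
  fun _ hη => Boundary.at_eq_of_le h hη

end Boundary

/-- A nearest neighbour path that visits every site finitely often converges to a boundary point. -/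
theorem exists_boundary_limit {y : ℕ → I} (hadj : ∀ k, T.graph.Adj (y k) (y (k + 1)))
    (hfin : ∀ i, ∀ᶠ k in atTop, y k ≠ i) :
    ∃ ξ : T.Boundary, ∀ n, ∀ᶠ k in atTop, T.Below (ξ.at n) (y k) := by
  have hlev : ∀ n, ∃ K, ∀ k, K ≤ k → n ≤ T.level (y k) := by
    intro n
    have := (eventually_all_finite (T.finite_level_le n)).2 fun i _ => hfin i
    obtain ⟨K, hK⟩ := eventually_atTop.1 this
    refine ⟨K, fun k hk => ?_⟩
    by_contra hlt
    exact hK k hk (y k) (by simp only [mem_ofPred_eq]; omega) rfl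
  choose K hK using hlev
  -- After time `K n` the path stays at levels at least n, and a step between such sites does not
  -- change the ancestor of level n.
  have hconst : ∀ n k, K n ≤ k → T.anc n (y k) = T.anc n (y (K n)) := by
    intro n k hk
    induction k, hk using Nat.le_induction with
    | base => rfl
    | succ k hk ih =>
      rw [← ih]
      exact (T.anc_eq_of_adj (hadj k) (hK n k hk) (hK n _ (by omega))).symm
  have hlvl : ∀ n, T.level (T.anc n (y (K n))) = n := fun n => T.level_anc (hK n _ le_rfl)
  refine ⟨⟨fun n => T.anc n (y (K n)), T.level_eq_zero_iff.1 (hlvl 0), hlvl, fun n => ?_⟩,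
    fun n => ?_⟩
  · have hk1 := hconst n (max (K n) (K (n + 1))) (le_max_left _ _)
    have hk2 := hconst (n + 1) (max (K n) (K (n + 1))) (le_max_right _ _)
    beta_reduce
    rw [← hk1, ← hk2, ← T.par_anc (hK _ _ (le_max_right _ _))]
    apply T.par_adj
    apply T.ne_root_of_level (n := n)
    exact T.level_anc (hK _ _ (le_max_right _ _))
  · filter_upwards [eventually_ge_atTop (K n)] with k hk
    have := T.anc_below (hK n k hk)
    rwa [hconst n k hk] at this

/-- A nearest neighbour path that starts at the root and enters the branch of `j` visits `j`. -/
theorem exists_visit {y : ℕ → I} (h0 : y 0 = T.root)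
    (hadj : ∀ k, T.graph.Adj (y k) (y (k + 1))) {j : I} {k : ℕ} (hk : T.Below j (y k)) :
    ∃ m, y m = j := by
  induction k with
  | zero =>
    rw [h0, below_root_iff] at hk
    exact ⟨0, by rw [h0, hk]⟩
  | succ k ih =>
    by_cases hb : T.Below j (y k)
    · exact ih hb
    -- A step to the predecessor cannot enter a branch from outside, and a step to a successor can
    -- enter it only at its first site.
    rcases T.adj_iff.1 (hadj k) with ⟨hr, hp⟩ | ⟨hr, hp⟩
    · exact absurd ((T.below_iff hr).2 (Or.inr (hp ▸ hk))) hb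
    · rcases (T.below_iff hr).1 hk with h | h
      · exact ⟨k + 1, h.symm⟩
      · exact absurd (hp ▸ h) hb

end

section

/-! ### The jump chain -/

instance {I : Type*} [Countable I] : Countable (State I) :=
  Function.Injective.countable (f := fun x : State I => match x with
    | .site i => some i
    | .cemetery => none) (by rintro (i | _) (j | _) h <;> simp_all)

variable {I : Type*} (T : TreeMatrix I)

instance (i : I) : IsProbabilityMeasure (T.law i) := by
  rw [law]
  infer_instance

theorem map_law_zero (i : I) :
    (T.law i).map (fun ω => ω 0) = Measure.dirac (State.site i) ⊗ₘ T.holdKernel := by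
  have h1 : (fun ω : ℕ → State I × ℝ => ω 0) =
      (fun x : Π _ : Finset.Iic 0, State I × ℝ => x ⟨0, Finset.mem_Iic.2 le_rfl⟩) ∘
        Preorder.frestrictLe (π := fun _ => State I × ℝ) 0 := rfl
  have h2 : (T.law i).map (Preorder.frestrictLe (π := fun _ => State I × ℝ) 0) =
      (Measure.dirac (State.site i) ⊗ₘ T.holdKernel).map
        (MeasurableEquiv.piUnique (fun _ : Finset.Iic 0 => State I × ℝ)).symm := by
    rw [law, Kernel.trajMeasure, Measure.map_comp _ _ (by fun_prop), Kernel.traj_map_frestrictLe,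
      Kernel.partialTraj_self]
    exact Measure.id_comp
  rw [h1, ← Measure.map_map (measurable_pi_apply _) (by fun_prop), h2,
    Measure.map_map (measurable_pi_apply _) (by fun_prop)]
  exact Measure.map_id

/-- The Markov property in the form that is used throughout: given the past up to step n, the next
step has the law `transition n`. -/
theorem map_law_succ (i : I) (n : ℕ) :
    (T.law i).map (fun ω => (Preorder.frestrictLe (π := fun _ => State I × ℝ) n ω, ω (n + 1))) =
      (T.law i).map (Preorder.frestrictLe (π := fun _ => State I × ℝ) n) ⊗ₘ T.transition n :=
  Kernel.map_frestrictLe_trajMeasure_compProd_eq_map_trajMeasure.symm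

theorem ae_law_zero {i : I} {p : State I × ℝ → Prop} (hp : MeasurableSet {z | p z})
    (h : ∀ᵐ s ∂T.holdKernel (.site i), p (.site i, s)) : ∀ᵐ ω ∂T.law i, p (ω 0) := by
  have := Measure.ae_compProd_of_ae_ae (μ := Measure.dirac (State.site i)) (κ := T.holdKernel) hp
    (by rw [ae_dirac_eq]; exact h)
  rw [← T.map_law_zero i] at this
  exact ae_of_ae_map (measurable_pi_apply 0).aemeasurable this

theorem ae_law_succ {i : I} {R : State I → State I × ℝ → Prop}
    (hR : MeasurableSet {q : State I × (State I × ℝ) | R q.1 q.2})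
    (h : ∀ x, ∀ᵐ z ∂T.stepKernel x, R x z) (n : ℕ) :
    ∀ᵐ ω ∂T.law i, R (ω n).1 (ω (n + 1)) := by
  have hm : Measurable (fun q : (Π _ : Finset.Iic n, State I × ℝ) × (State I × ℝ) =>
      ((q.1 ⟨n, Finset.mem_Iic.2 le_rfl⟩).1, q.2)) := by fun_prop
  have := Measure.ae_compProd_of_ae_ae
    (μ := (T.law i).map (Preorder.frestrictLe (π := fun _ => State I × ℝ) n))
    (κ := T.transition n)
    (p := fun q => R (q.1 ⟨n, Finset.mem_Iic.2 le_rfl⟩).1 q.2) (hm hR)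
    (Eventually.of_forall fun a => h _)
  rw [← T.map_law_succ i n] at this
  exact ae_of_ae_map (Measurable.aemeasurable (by fun_prop)) this

theorem fst_stepKernel (x : State I) : (T.stepKernel x).map Prod.fst = T.jumpLaw x :=
  Measure.fst_compProd (T.jumpLaw x) T.holdKernel

theorem lintegral_law_succ (i : I) (n : ℕ) (f : State I → ℝ≥0∞) :
    ∫⁻ ω, f (ω (n + 1)).1 ∂T.law i = ∫⁻ ω, ∫⁻ y, f y ∂T.jumpLaw (ω n).1 ∂T.law i := by
  have hf : Measurable f := measurable_from_top
  have h1 : ∫⁻ ω, f (ω (n + 1)).1 ∂T.law i =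
      ∫⁻ q, f q.2.1 ∂((T.law i).map
        (fun ω => (Preorder.frestrictLe (π := fun _ => State I × ℝ) n ω, ω (n + 1)))) := by
    rw [lintegral_map (by fun_prop) (by fun_prop)]
  rw [h1, map_law_succ, Measure.lintegral_compProd (by fun_prop), lintegral_map]
  · refine lintegral_congr fun ω => ?_
    rw [← T.fst_stepKernel, lintegral_map hf measurable_fst]
    rfl
  · exact (hf.comp (measurable_fst.comp measurable_snd)).lintegral_kernel_prod_right'
  · fun_prop

/-- The filtration of the sequence of visited states and holding times. -/
def pathFiltration (I : Type*) :
    Filtration ℕ (MeasurableSpace.pi : MeasurableSpace (ℕ → State I × ℝ)) :=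
  Filtration.piLE

theorem measurable_pathFiltration (n : ℕ) :
    Measurable[pathFiltration I n] (fun ω : ℕ → State I × ℝ => ω n) := by
  rw [pathFiltration, Filtration.piLE_eq_comap_frestrictLe]
  have : (fun ω : ℕ → State I × ℝ => ω n) =
      (fun x : Π _ : Finset.Iic n, State I × ℝ => x ⟨n, Finset.mem_Iic.2 le_rfl⟩) ∘
        Preorder.frestrictLe (π := fun _ => State I × ℝ) n := rfl
  rw [this]
  exact (measurable_pi_apply _).comp (comap_measurable _)

variable {T} in
/-- A bounded function of the jump chain which is preserved by the jump law is a martingale. -/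
theorem martingale_of_integral_jumpLaw {φ : State I → ℝ} {c : ℝ} (hc : ∀ x, |φ x| ≤ c)
    (hφ : ∀ x, ∫ y, φ y ∂T.jumpLaw x = φ x) (i : I) :
    Martingale (fun n ω => φ (ω n).1) (pathFiltration I) (T.law i) := by
  have hm : Measurable φ := measurable_from_top
  have hint : ∀ n, Integrable (fun ω : ℕ → State I × ℝ => φ (ω n).1) (T.law i) := fun n =>
    Integrable.of_bound (by fun_prop : Measurable _).aestronglyMeasurable c
      (Eventually.of_forall fun ω => hc _)
  refine martingale_of_setIntegral_eq_succ (fun n => ?_) hint fun n s hs => ?_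
  · exact (hm.comp (measurable_fst.comp (measurable_pathFiltration n))).stronglyMeasurable
  · rw [pathFiltration, Filtration.piLE_eq_comap_frestrictLe] at hs
    obtain ⟨B, hB, rfl⟩ := hs
    have hfr : Measurable (Preorder.frestrictLe (π := fun _ => State I × ℝ) n) := by fun_prop
    rw [← integral_indicator (hfr hB), ← integral_indicator (hfr hB)]
    -- The integral over a past event becomes an integral for the joint law of the past and the next
    -- step, where the Markov property applies.
    have h1 : ∫ ω, (Preorder.frestrictLe (π := fun _ => State I × ℝ) n ⁻¹' B).indicator
          (fun ω => φ (ω (n + 1)).1) ω ∂T.law i =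
        ∫ q, (B ×ˢ univ).indicator (fun q => φ q.2.1) q ∂((T.law i).map
        (fun ω => (Preorder.frestrictLe (π := fun _ => State I × ℝ) n ω, ω (n + 1)))) := by
      rw [integral_map (by fun_prop)]
      · refine integral_congr_ae (Eventually.of_forall fun ω => ?_)
        by_cases hω : Preorder.frestrictLe (π := fun _ => State I × ℝ) n ω ∈ B <;>
          simp [indicator, hω]
      · exact (Measurable.indicator (by fun_prop)
          (hB.prod MeasurableSet.univ)).aestronglyMeasurable
    have hmm : Measurable ((B ×ˢ (univ : Set (State I × ℝ))).indicator
        (fun q : (Π _ : Finset.Iic n, State I × ℝ) × (State I × ℝ) => φ q.2.1)) :=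
      Measurable.indicator (by fun_prop) (hB.prod MeasurableSet.univ)
    rw [h1, map_law_succ, Measure.integral_compProd, integral_map hfr.aemeasurable]
    · refine integral_congr_ae (Eventually.of_forall fun ω => ?_)
      by_cases hω : Preorder.frestrictLe (π := fun _ => State I × ℝ) n ω ∈ B
      · simp only [indicator, mem_preimage, hω, mem_prod, mem_univ, and_true, if_true]
        rw [← hφ, ← T.fst_stepKernel, integral_map measurable_fst.aemeasurable
          hm.aestronglyMeasurable]
        rfl
      · simp [indicator, hω]
    · exact (StronglyMeasurable.integral_kernel_prod_right'
        hmm.stronglyMeasurable).aestronglyMeasurable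
    · refine Integrable.of_bound hmm.aestronglyMeasurable |c| (Eventually.of_forall fun q => ?_)
      rw [Real.norm_eq_abs, indicator]
      split_ifs
      · exact (hc _).trans (le_abs_self c)
      · simp

end

/-! ### Conductances and the generator of the chain -/

section

variable {I : Type*} (T : TreeMatrix I)

open scoped Classical in
/-- The predecessor of a site, which for the root is the cemetery. -/
def parState (i : I) : State I := if i = T.root then .cemetery else .site (T.par i)

/-- The successors of a site as a finite set. -/
def succFinset (i : I) : Finset I :=
  ((T.locallyFinite i).subset (t := T.succs i) fun _ h => h.1).toFinset

theorem mem_succFinset {i l : I} : l ∈ T.succFinset i ↔ l ≠ T.root ∧ T.par l = i := by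
  rw [succFinset, Finite.mem_toFinset, mem_succs_iff]

theorem level_of_mem_succFinset {i l : I} (h : l ∈ T.succFinset i) :
    T.level l = T.level i + 1 := by
  rw [mem_succFinset] at h
  rw [← h.2, ← T.level_par h.1]

theorem site_ne_parState {i l : I} (h : l ∈ T.succFinset i) : State.site l ≠ T.parState i := by
  rw [parState]
  split_ifs with hi
  · simp
  · intro hl
    injection hl with hl
    have h1 := T.level_of_mem_succFinset h
    have h2 := T.level_par hi
    rw [← hl] at h2
    omega

/-- The conductance of the edge between a site and its predecessor. -/
def edgeCond (i : I) : ℝ := (T.incr (T.level i))⁻¹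

theorem edgeCond_pos (i : I) : 0 < T.edgeCond i := inv_pos.2 (T.incr_pos _)

theorem parState_ne_site (i : I) : T.parState i ≠ .site i := by
  rw [parState]
  split_ifs with h
  · simp
  · intro h'
    injection h' with h'
    exact T.par_ne h h'

theorem qMatrix_parState (i : I) : T.qMatrix (.site i) (T.parState i) = T.edgeCond i := by
  rw [parState]
  split_ifs with h
  · subst h
    simp [qMatrix, edgeCond, T.level_root, incr]
  · have hl := T.level_par h
    simp only [qMatrix]
    rw [if_neg (T.par_ne h).symm, if_pos (T.par_adj h).symm, edgeCond, max_eq_left (by omega)]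

theorem qMatrix_succ {i l : I} (h : l ∈ T.succFinset i) :
    T.qMatrix (.site i) (.site l) = T.edgeCond l := by
  have hl := T.level_of_mem_succFinset h
  rw [mem_succFinset] at h
  have hadj : T.graph.Adj i l := h.2 ▸ T.par_adj h.1
  simp only [qMatrix]
  rw [if_neg hadj.ne, if_pos hadj, edgeCond, max_eq_right (by omega)]

theorem qMatrix_eq_zero {i : I} {y : State I} (h1 : y ≠ .site i) (h2 : y ≠ T.parState i)
    (h3 : ∀ l ∈ T.succFinset i, y ≠ .site l) : T.qMatrix (.site i) y = 0 := by
  cases y with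
  | cemetery =>
    simp only [qMatrix]
    rw [if_neg]
    rintro rfl
    simp [parState] at h2
  | site j =>
    simp only [qMatrix]
    rw [if_neg fun h => h1 (by rw [h]), if_neg]
    intro hadj
    rcases T.adj_iff.1 hadj with ⟨hr, rfl⟩ | hr
    · simp [parState, hr] at h2
    · exact h3 j (T.mem_succFinset.2 hr) rfl

theorem rowMeasure_site (i : I) : T.rowMeasure (.site i) =
    ENNReal.ofReal (T.edgeCond i) • Measure.dirac (T.parState i) +
      ∑ l ∈ T.succFinset i, ENNReal.ofReal (T.edgeCond l) • Measure.dirac (State.site l) := by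
  classical
  ext s hs
  rw [rowMeasure, Measure.sum_apply _ hs]
  rw [tsum_eq_sum (s := insert (T.parState i) ((T.succFinset i).image State.site))]
  · rw [Finset.sum_insert, Finset.sum_image]
    · simp only [Measure.add_apply, Measure.coe_finsetSum, Finset.sum_apply]
      congr 1
      · rw [if_neg (T.parState_ne_site i), T.qMatrix_parState]
      · refine Finset.sum_congr rfl fun l hl => ?_
        rw [if_neg, T.qMatrix_succ hl]
        intro h
        injection h with h
        have := T.level_of_mem_succFinset hl
        rw [h] at this
        omega
    · intro a _ b _ h
      injection h
    · intro h
      obtain ⟨l, hl, h⟩ := Finset.mem_image.1 h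
      exact T.site_ne_parState hl h
  · intro y hy
    rw [Finset.mem_insert, Finset.mem_image] at hy
    push Not at hy
    by_cases h : y = .site i
    · simp [h]
    · rw [T.qMatrix_eq_zero h hy.1 fun l hl h' => hy.2 l hl h'.symm]
      simp

/-- The total conductance at a site. -/
def totalCond (i : I) : ℝ := T.edgeCond i + ∑ l ∈ T.succFinset i, T.edgeCond l

theorem totalCond_pos (i : I) : 0 < T.totalCond i :=
  add_pos_of_pos_of_nonneg (T.edgeCond_pos i) (Finset.sum_nonneg fun l _ => (T.edgeCond_pos l).le)

theorem rowMeasure_univ (i : I) :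
    T.rowMeasure (.site i) univ = ENNReal.ofReal (T.totalCond i) := by
  rw [rowMeasure_site, totalCond,
    ENNReal.ofReal_add (T.edgeCond_pos i).le (Finset.sum_nonneg fun l _ => (T.edgeCond_pos l).le),
    ENNReal.ofReal_sum_of_nonneg fun l _ => (T.edgeCond_pos l).le]
  simp

/-- The generator of the chain, applied to a function of the state. -/
def gen (φ : State I → ℝ) (i : I) : ℝ :=
  T.edgeCond i * (φ (T.parState i) - φ (.site i)) +
    ∑ l ∈ T.succFinset i, T.edgeCond l * (φ (.site l) - φ (.site i))

theorem integral_rowMeasure (φ : State I → ℝ) (i : I) : ∫ y, φ y ∂T.rowMeasure (.site i) =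
    T.edgeCond i * φ (T.parState i) + ∑ l ∈ T.succFinset i, T.edgeCond l * φ (.site l) := by
  have hint : ∀ (c : ℝ) (y : State I),
      Integrable φ (ENNReal.ofReal c • Measure.dirac y) := fun c y =>
    (integrable_dirac (by simp)).smul_measure ENNReal.ofReal_ne_top
  rw [rowMeasure_site, integral_add_measure (hint _ _) (integrable_finsetSum_measure.2
      fun l _ => hint _ _), integral_finsetSum_measure fun l _ => hint _ _]
  simp only [integral_smul_measure, integral_dirac, smul_eq_mul]
  rw [ENNReal.toReal_ofReal (T.edgeCond_pos i).le]
  congr 1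
  exact Finset.sum_congr rfl fun l _ => by rw [ENNReal.toReal_ofReal (T.edgeCond_pos l).le]

/-- Consequently a function is preserved by the jump law at a site exactly if the generator
annihilates it there. The symmetric weights `edgeCond` are easier to handle than jump probabilities.
-/
theorem integral_jumpLaw_site (φ : State I → ℝ) (i : I) :
    ∫ y, φ y ∂T.jumpLaw (.site i) = φ (.site i) + (T.totalCond i)⁻¹ * T.gen φ i := by
  have hZ := T.totalCond_pos i
  simp only [jumpLaw]
  rw [integral_smul_measure, integral_rowMeasure, rowMeasure_univ, ENNReal.toReal_inv,
    ENNReal.toReal_ofReal hZ.le, smul_eq_mul, gen]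
  have : T.edgeCond i * (φ (T.parState i) - φ (.site i)) +
      ∑ l ∈ T.succFinset i, T.edgeCond l * (φ (.site l) - φ (.site i)) =
      (T.edgeCond i * φ (T.parState i) + ∑ l ∈ T.succFinset i, T.edgeCond l * φ (.site l)) -
        T.totalCond i * φ (.site i) := by
    rw [totalCond, add_mul, Finset.sum_mul]
    simp only [mul_sub, Finset.sum_sub_distrib]
    ring
  rw [this]
  field_simp
  ring

theorem integral_jumpLaw_of_gen {φ : State I → ℝ} (h : ∀ i, T.gen φ i = 0) (x : State I) :
    ∫ y, φ y ∂T.jumpLaw x = φ x := by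
  cases x with
  | site i => rw [integral_jumpLaw_site, h, mul_zero, add_zero]
  | cemetery => simp [jumpLaw]

theorem ae_jumpLaw_site (i : I) : ∀ᵐ y ∂T.jumpLaw (.site i), y = T.parState i ∨
    ∃ l ∈ T.succFinset i, y = .site l := by
  simp only [jumpLaw]
  rw [Measure.ae_ennreal_smul_measure_iff]
  · rw [rowMeasure_site, ae_iff, Measure.add_apply, Measure.smul_apply, Measure.coe_finsetSum,
      Finset.sum_apply, Measure.dirac_apply' _ (MeasurableSet.of_discrete)]
    simp only [Measure.smul_apply, Measure.dirac_apply' _ (MeasurableSet.of_discrete)]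
    rw [indicator_of_notMem (by simp), smul_zero, zero_add]
    refine Finset.sum_eq_zero fun l hl => ?_
    rw [indicator_of_notMem, smul_zero]
    simp only [mem_ofPred_eq, not_not]
    exact Or.inr ⟨l, hl, rfl⟩
  · exact ENNReal.inv_ne_zero.2 (T.rowMeasure_univ_ne_top i)

/-! ### Almost sure properties of the paths -/

theorem ae_hold_pos (i : I) : ∀ᵐ ω ∂T.law i, ∀ n, 0 < (ω n).2 := by
  have hpos : ∀ x, ∀ᵐ s ∂T.holdKernel x, 0 < s := by
    intro x
    rw [ae_iff]
    have h : {a : ℝ | ¬ 0 < a} = Iic 0 := by ext; simp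
    rw [h]
    change expMeasure (T.holdRate x) (Iic 0) = 0
    have := isProbabilityMeasure_expMeasure (T.holdRate_pos x)
    have h0 := cdf_expMeasure_eq (T.holdRate_pos x) 0
    rw [cdf_eq_real, measureReal_def] at h0
    exact (measureReal_eq_zero_iff (measure_ne_top _ _)).1 (by simpa [measureReal_def] using h0)
  have hms : MeasurableSet {z : State I × ℝ | 0 < z.2} := measurableSet_lt (by fun_prop)
    (by fun_prop)
  refine ae_all_iff.2 fun n => ?_
  cases n with
  | zero => exact T.ae_law_zero (p := fun z => 0 < z.2) hms (hpos _)
  | succ n =>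
    refine T.ae_law_succ (R := fun _ z => 0 < z.2) (measurable_snd hms) (fun x => ?_) n
    exact Measure.ae_compProd_of_ae_ae hms (Eventually.of_forall fun y => hpos y)

theorem ae_zero_eq (i : I) : ∀ᵐ ω ∂T.law i, (ω 0).1 = .site i :=
  T.ae_law_zero (p := fun z => z.1 = .site i)
    (measurable_fst (MeasurableSet.of_discrete (s := {State.site i})))
    (Eventually.of_forall fun _ => rfl)

/-- The possible jumps of the chain. -/
def Jump (x y : State I) : Prop :=
  match x with
  | .site i => y = T.parState i ∨ ∃ l ∈ T.succFinset i, y = .site l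
  | .cemetery => y = .cemetery

theorem ae_jump [Countable I] (i : I) : ∀ᵐ ω ∂T.law i, ∀ n, T.Jump (ω n).1 (ω (n + 1)).1 := by
  refine ae_all_iff.2 fun n => ?_
  refine T.ae_law_succ (R := fun x z => T.Jump x z.1) ?_ (fun x => ?_) n
  · have hm : Measurable (fun q : State I × (State I × ℝ) => (q.1, q.2.1)) := by fun_prop
    exact hm (MeasurableSet.of_discrete (s := {q : State I × State I | T.Jump q.1 q.2}))
  · refine Measure.ae_compProd_of_ae_ae
      (measurable_fst (MeasurableSet.of_discrete (s := {y | T.Jump x y}))) ?_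
    cases x with
    | site i =>
      filter_upwards [T.ae_jumpLaw_site i] with y hy
      exact Eventually.of_forall fun _ => hy
    | cemetery =>
      simp only [jumpLaw]
      rw [ae_dirac_eq, eventually_pure]
      exact Eventually.of_forall fun _ => rfl

variable {T} in
theorem cemetery_of_le {ω : ℕ → State I × ℝ} (hω : ∀ n, T.Jump (ω n).1 (ω (n + 1)).1) {n m : ℕ}
    (h : n ≤ m) (hn : (ω n).1 = .cemetery) : (ω m).1 = .cemetery := by
  induction m, h using Nat.le_induction with
  | base => exact hn
  | succ m _ ih =>
    have := hω m
    rw [ih] at this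
    exact this

theorem jumpTime_succ (ω : ℕ → State I × ℝ) (n : ℕ) :
    jumpTime ω (n + 1) = jumpTime ω n + (ω n).2 := Finset.sum_range_succ _ _

theorem jumpTime_strictMono {ω : ℕ → State I × ℝ} (hω : ∀ n, 0 < (ω n).2) :
    StrictMono (jumpTime ω) :=
  strictMono_nat_of_lt_succ fun n => by rw [jumpTime_succ]; linarith [hω n]

theorem jumpTime_nonneg {ω : ℕ → State I × ℝ} (hω : ∀ n, 0 < (ω n).2) (n : ℕ) :
    0 ≤ jumpTime ω n :=
  Finset.sum_nonneg fun k _ => (hω k).le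

theorem stateAt_jumpTime {ω : ℕ → State I × ℝ} (hω : ∀ n, 0 < (ω n).2) (n : ℕ) :
    StateAt ω (jumpTime ω n) (ω n).1 :=
  ⟨n, le_rfl, jumpTime_strictMono hω n.lt_succ_self, rfl⟩

theorem hitsCemetery_iff {ω : ℕ → State I × ℝ} (hω : ∀ n, 0 < (ω n).2) :
    HitsCemetery ω ↔ ∃ n, (ω n).1 = .cemetery := by
  constructor
  · rintro ⟨t, _, n, _, _, h⟩
    exact ⟨n, h⟩
  · rintro ⟨n, h⟩
    exact ⟨jumpTime ω n, jumpTime_nonneg hω n, h ▸ stateAt_jumpTime hω n⟩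

variable {T} in
-- Positive holding times make the jump times strictly increasing, so late times before the lifetime
-- correspond to late jumps. From here on only the jump chain matters.
theorem exitsAt_iff {ω : ℕ → State I × ℝ} (hω : ∀ n, 0 < (ω n).2) {ξ : T.Boundary} :
    ExitsAt ω ξ ↔ (∀ n, (ω n).1 ≠ .cemetery) ∧
      ∀ n, ∀ᶠ k in atTop, ∃ i, (ω k).1 = .site i ∧ T.Below (ξ.at n) i := by
  rw [ExitsAt, hitsCemetery_iff hω, not_exists]
  refine and_congr Iff.rfl (forall_congr' fun n => ?_)
  constructor
  · rintro ⟨s, hs, ⟨x, m, hm1, hm2, hm3⟩, h⟩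
    filter_upwards [eventually_ge_atTop (m + 1)] with k hk
    exact h _ (hm2.le.trans ((jumpTime_strictMono hω).monotone hk)) _ (stateAt_jumpTime hω k)
  · intro h
    obtain ⟨K, hK⟩ := eventually_atTop.1 h
    refine ⟨jumpTime ω K, jumpTime_nonneg hω K, ⟨_, stateAt_jumpTime hω K⟩, ?_⟩
    rintro t ht x ⟨m, hm1, hm2, rfl⟩
    refine hK m ?_
    have := (jumpTime_strictMono hω).lt_iff_lt.1 (ht.trans_lt hm2)
    omega

end

section

variable {I : Type*} (T : TreeMatrix I)

/-! ### The probability to reach the cemetery -/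

/-- The probability that the jump chain started at a state is at the cemetery after `n` steps. -/
def hitBy : ℕ → State I → ℝ≥0∞
  | 0, .cemetery => 1
  | 0, .site _ => 0
  | n + 1, x => ∫⁻ y, hitBy n y ∂T.jumpLaw x

theorem hitBy_cemetery (n : ℕ) : T.hitBy n .cemetery = 1 := by
  induction n with
  | zero => rfl
  | succ n ih => simp [hitBy, jumpLaw, ih]

theorem hitBy_mono (x : State I) : Monotone fun n => T.hitBy n x := by
  refine monotone_nat_of_le_succ fun n => ?_
  induction n generalizing x with
  | zero =>
    cases x with
    | site i => exact zero_le
    | cemetery => rw [hitBy_cemetery, hitBy_cemetery]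
  | succ n ih => exact lintegral_mono fun y => ih y

theorem lintegral_hitBy (i : I) (n k : ℕ) :
    ∫⁻ ω, T.hitBy k (ω n).1 ∂T.law i = T.hitBy (n + k) (.site i) := by
  induction n generalizing k with
  | zero =>
    have : (fun ω : ℕ → State I × ℝ => T.hitBy k (ω 0).1) =ᵐ[T.law i]
        fun _ => T.hitBy k (.site i) := by
      filter_upwards [T.ae_zero_eq i] with ω hω
      rw [hω]
    rw [lintegral_congr_ae this]
    simp
  | succ n ih =>
    rw [T.lintegral_law_succ i n (T.hitBy k), show n + 1 + k = n + (k + 1) by omega, ← ih]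
    rfl

theorem measurableSet_state_eq (n : ℕ) (x : State I) :
    MeasurableSet {ω : ℕ → State I × ℝ | (ω n).1 = x} :=
  (measurable_fst.comp (measurable_pi_apply n)) (MeasurableSet.of_discrete (s := {x}))

theorem law_cemetery (i : I) (n : ℕ) :
    T.law i {ω | (ω n).1 = .cemetery} = T.hitBy n (.site i) := by
  rw [← add_zero n, ← T.lintegral_hitBy i n 0, add_zero,
    ← lintegral_indicator_one (measurableSet_state_eq n _)]
  refine lintegral_congr fun ω => ?_
  rcases h : (ω n).1 with j | _ <;> simp [indicator, h, hitBy]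

/-- The cemetery is absorbing, so that having visited it by step n is almost surely the same as
being there at step n. These events increase with n. -/
theorem law_exists_cemetery [Countable I] (i : I) :
    T.law i {ω | ∃ n, (ω n).1 = .cemetery} = ⨆ n, T.hitBy n (.site i) := by
  have h1 : {ω : ℕ → State I × ℝ | ∃ n, (ω n).1 = .cemetery} =
      ⋃ n, {ω | ∃ k ≤ n, (ω k).1 = .cemetery} := by
    ext ω
    simp only [mem_ofPred_eq, mem_iUnion]
    exact ⟨fun ⟨n, h⟩ => ⟨n, n, le_rfl, h⟩, fun ⟨_, k, _, h⟩ => ⟨k, h⟩⟩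
  have hmono : Monotone fun n => {ω : ℕ → State I × ℝ | ∃ k ≤ n, (ω k).1 = .cemetery} :=
    fun n m hnm ω ⟨k, hk, h⟩ => ⟨k, hk.trans hnm, h⟩
  rw [h1, hmono.measure_iUnion]
  refine iSup_congr fun n => ?_
  rw [← law_cemetery]
  refine measure_congr ?_
  filter_upwards [T.ae_jump i] with ω hω
  refine propext ⟨fun ⟨k, hk, h⟩ => cemetery_of_le hω hk h, fun h => ⟨n, le_rfl, h⟩⟩

theorem hitProb_eq_law (i : I) : T.hitProb i = T.law i {ω | ∃ n, (ω n).1 = .cemetery} := by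
  refine measure_congr ?_
  filter_upwards [T.ae_hold_pos i] with ω hω
  exact propext (hitsCemetery_iff hω)

theorem hitProb_eq [Countable I] (i : I) : T.hitProb i = ⨆ n, T.hitBy n (.site i) := by
  rw [hitProb_eq_law, law_exists_cemetery]

theorem hitProb_le_one (i : I) : T.hitProb i ≤ 1 := prob_le_one

theorem hitProb_ne_top (i : I) : T.hitProb i ≠ ∞ :=
  ((T.hitProb_le_one i).trans_lt ENNReal.one_lt_top).ne

/-- The probability to reach the cemetery, as a function of the state. -/
def hit : State I → ℝ
  | .site i => (T.hitProb i).toReal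
  | .cemetery => 1

theorem hit_eq [Countable I] (x : State I) : T.hit x = (⨆ n, T.hitBy n x).toReal := by
  cases x with
  | site i => rw [hit, hitProb_eq]
  | cemetery => simp [hit, hitBy_cemetery]

theorem hit_nonneg (x : State I) : 0 ≤ T.hit x := by
  cases x with
  | site i => exact ENNReal.toReal_nonneg
  | cemetery => exact zero_le_one

theorem hit_le_one (x : State I) : T.hit x ≤ 1 := by
  cases x with
  | site i => exact ENNReal.toReal_le_of_le_ofReal zero_le_one (by simpa using T.hitProb_le_one i)
  | cemetery => exact le_rfl

theorem abs_hit_le_one (x : State I) : |T.hit x| ≤ 1 := by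
  rw [abs_of_nonneg (T.hit_nonneg x)]
  exact T.hit_le_one x

/-- This is the limit of the recursion that defines `hitBy`, by monotone convergence. -/
theorem integral_hit_jumpLaw [Countable I] (x : State I) : ∫ y, T.hit y ∂T.jumpLaw x = T.hit x := by
  have hle : ∀ y, ⨆ n, T.hitBy n y ≤ 1 := by
    intro y
    cases y with
    | site i => rw [← hitProb_eq]; exact T.hitProb_le_one i
    | cemetery => simp [hitBy_cemetery]
  simp_rw [hit_eq]
  rw [integral_toReal (measurable_from_top.aemeasurable)
    (Eventually.of_forall fun y => (hle y).trans_lt ENNReal.one_lt_top),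
    lintegral_iSup (fun n => measurable_from_top) (fun n m h y => T.hitBy_mono y h)]
  congr 1
  refine le_antisymm (iSup_le fun n => ?_) (iSup_le fun n => ?_)
  · exact le_iSup_of_le (n + 1) le_rfl
  · exact le_iSup_of_le n (T.hitBy_mono x n.le_succ)

theorem gen_hit [Countable I] (i : I) : T.gen T.hit i = 0 := by
  have h := T.integral_jumpLaw_site T.hit i
  rw [integral_hit_jumpLaw] at h
  have h' : (T.totalCond i)⁻¹ * T.gen T.hit i = 0 := by linarith
  exact (mul_eq_zero.1 h').resolve_left (inv_pos.2 (T.totalCond_pos i)).ne'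

/-- The minimum principle: at a zero of `hit` all differences to the neighbours are nonnegative and
sum to zero with positive weights, so none can be positive. -/
theorem hit_pos_of_parState [Countable I] {i : I} (h : 0 < T.hit (T.parState i)) : 0 < T.hit (.site i) := by
  have hg := T.gen_hit i
  rw [gen] at hg
  by_contra hn
  have h0 : T.hit (.site i) = 0 := le_antisymm (not_lt.1 hn) (T.hit_nonneg _)
  simp only [h0, sub_zero] at hg
  have h1 := mul_pos (T.edgeCond_pos i) h
  have h2 : 0 ≤ ∑ l ∈ T.succFinset i, T.edgeCond l * T.hit (.site l) :=
    Finset.sum_nonneg fun l _ => mul_nonneg (T.edgeCond_pos l).le (T.hit_nonneg _)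
  linarith

theorem hit_site_pos [Countable I] (i : I) : 0 < T.hit (.site i) := by
  induction i using T.level_induction with
  | root => exact T.hit_pos_of_parState (by simp [parState, hit])
  | step i hi ih => exact T.hit_pos_of_parState (by simpa [parState, hi] using ih)

theorem hit_pos [Countable I] (x : State I) : 0 < T.hit x := by
  cases x with
  | site i => exact T.hit_site_pos i
  | cemetery => exact one_pos

variable {T} in
/-- The value of a bounded harmonic function is the mean of its limit along the path. -/
theorem integral_limit_of_harmonic {φ : State I → ℝ} {c : ℝ} (hc : ∀ x, |φ x| ≤ c)
    (hφ : ∀ i, T.gen φ i = 0) (i : I) {X : (ℕ → State I × ℝ) → ℝ}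
    (hX : ∀ᵐ ω ∂T.law i, Tendsto (fun n => φ (ω n).1) atTop (𝓝 (X ω))) :
    ∫ ω, X ω ∂T.law i = φ (.site i) := by
  have hmart := martingale_of_integral_jumpLaw hc (T.integral_jumpLaw_of_gen hφ) i
  have hconst : ∀ n, ∫ ω, φ (ω n).1 ∂T.law i = φ (.site i) := by
    intro n
    have h1 := hmart.setIntegral_eq (Nat.zero_le n) (s := univ) MeasurableSet.univ
    simp only [setIntegral_univ] at h1
    rw [← h1]
    have : (fun ω : ℕ → State I × ℝ => φ (ω 0).1) =ᵐ[T.law i] fun _ => φ (.site i) := by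
      filter_upwards [T.ae_zero_eq i] with ω hω
      rw [hω]
    rw [integral_congr_ae this]
    simp
  have hm : Measurable φ := measurable_from_top
  have hlim : Tendsto (fun n => ∫ ω, φ (ω n).1 ∂T.law i) atTop (𝓝 (∫ ω, X ω ∂T.law i)) :=
    tendsto_integral_of_dominated_convergence (fun _ => c)
      (fun n => (by fun_prop : Measurable _).aestronglyMeasurable) (integrable_const c)
      (fun n => Eventually.of_forall fun ω => hc _) hX
  simp only [hconst] at hlim
  exact tendsto_nhds_unique hlim tendsto_const_nhds

theorem measurableSet_exists_cemetery :
    MeasurableSet {ω : ℕ → State I × ℝ | ∃ n, (ω n).1 = .cemetery} := by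
  rw [ofPred_exists]
  exact MeasurableSet.iUnion fun n => measurableSet_state_eq n _

theorem ae_exists_limit_hit [Countable I] (i : I) :
    ∀ᵐ ω ∂T.law i, ∃ c, Tendsto (fun n => T.hit (ω n).1) atTop (𝓝 c) := by
  have hmart := martingale_of_integral_jumpLaw T.abs_hit_le_one T.integral_hit_jumpLaw i
  have hbdd : ∀ n, eLpNorm (fun ω : ℕ → State I × ℝ => T.hit (ω n).1) 1 (T.law i) ≤
      (1 : NNReal) := fun n => by
    have := eLpNorm_le_of_ae_bound (p := 1) (μ := T.law i) (C := 1)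
      (f := fun ω : ℕ → State I × ℝ => T.hit (ω n).1)
      (Eventually.of_forall fun ω => T.abs_hit_le_one _)
    simpa only [measure_univ, ENNReal.one_rpow, one_mul, ENNReal.ofReal_one, ENNReal.coe_one]
      using this
  exact hmart.submartingale.exists_ae_tendsto_of_bdd hbdd

theorem exists_limit_hit [Countable I] (i : I) : ∃ L : (ℕ → State I × ℝ) → ℝ,
    ∀ᵐ ω ∂T.law i, Tendsto (fun n => T.hit (ω n).1) atTop (𝓝 (L ω)) := by
  refine ⟨fun ω => limUnder atTop fun n => T.hit (ω n).1, ?_⟩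
  filter_upwards [T.ae_exists_limit_hit i] with ω hω
  exact tendsto_nhds_limUnder hω

/-- On the event that the cemetery is not reached, the probability to reach it converges to `0`
along the path. -/
theorem ae_tendsto_hit [Countable I] (i : I) : ∀ᵐ ω ∂T.law i, (∀ n, (ω n).1 ≠ .cemetery) →
    Tendsto (fun n => T.hit (ω n).1) atTop (𝓝 0) := by
  have hm : Measurable T.hit := measurable_from_top
  have hYm : ∀ n, Measurable fun ω : ℕ → State I × ℝ => T.hit (ω n).1 := fun n =>
    hm.comp (measurable_fst.comp (measurable_pi_apply n))
  obtain ⟨L, hconv⟩ := T.exists_limit_hit i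
  have hLint := integral_limit_of_harmonic T.abs_hit_le_one T.gen_hit i hconv
  set A := {ω : ℕ → State I × ℝ | ∃ n, (ω n).1 = .cemetery}
  have hA : MeasurableSet A := measurableSet_exists_cemetery
  have hAint : ∫ ω, A.indicator (fun _ => (1 : ℝ)) ω ∂T.law i = T.hit (.site i) := by
    rw [integral_indicator hA, setIntegral_const, smul_eq_mul, mul_one, hit, hitProb_eq_law,
      measureReal_def]
  have hLm : AEStronglyMeasurable L (T.law i) := by
    refine aestronglyMeasurable_of_tendsto_ae
      (f := fun n (ω : ℕ → State I × ℝ) => T.hit (ω n).1) atTop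
      (fun n => (hYm n).aestronglyMeasurable) ?_
    exact hconv
  have hLb : ∀ᵐ ω ∂T.law i, 0 ≤ L ω ∧ L ω ≤ 1 := by
    filter_upwards [hconv] with ω hω
    exact ⟨ge_of_tendsto' hω fun n => T.hit_nonneg _, le_of_tendsto' hω fun n => T.hit_le_one _⟩
  have hLi : Integrable L (T.law i) := Integrable.of_bound hLm 1 (by
    filter_upwards [hLb] with ω hω
    rw [Real.norm_eq_abs, abs_le]
    constructor <;> linarith [hω.1, hω.2])
  have hAi : Integrable (A.indicator fun _ => (1 : ℝ)) (T.law i) :=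
    (integrable_const 1).indicator hA
  -- The limit L is 1 on the event A of absorption and nonnegative elsewhere, so it dominates the
  -- indicator of A. Both have mean h(i), hence they agree almost surely, and L = 0 off A.
  have hge : ∀ᵐ ω ∂T.law i, 0 ≤ L ω - A.indicator (fun _ => (1 : ℝ)) ω := by
    filter_upwards [hconv, hLb, T.ae_jump i] with ω hω hb hj
    by_cases hωA : ω ∈ A
    · obtain ⟨n, hn⟩ := hωA
      have : Tendsto (fun n => T.hit (ω n).1) atTop (𝓝 1) := by
        refine tendsto_const_nhds.congr' ?_
        filter_upwards [eventually_ge_atTop n] with m hm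
        rw [cemetery_of_le hj hm hn]
        rfl
      rw [tendsto_nhds_unique hω this, indicator_of_mem (show ω ∈ A from ⟨n, hn⟩), sub_self]
    · rw [indicator_of_notMem hωA, sub_zero]
      exact hb.1
  have hzero := (integral_eq_zero_iff_of_nonneg_ae hge (hLi.sub hAi)).1 (by
    rw [integral_sub hLi hAi, hAint, hLint, sub_self])
  filter_upwards [hzero, hconv] with ω h0 hω hne
  have hωA : ω ∉ A := fun ⟨n, hn⟩ => hne n hn
  simp only [Pi.zero_apply, indicator_of_notMem hωA, sub_zero] at h0
  rwa [h0] at hω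

end

section

variable {I : Type*} (T : TreeMatrix I)

/-! ### Harmonic functions and the exit distribution -/

open scoped Classical in
/-- The indicator function of a branch. -/
def branchInd (j : I) : State I → ℝ
  | .site i => if T.Below j i then 1 else 0
  | .cemetery => 0

theorem branchInd_nonneg (j : I) (x : State I) : 0 ≤ T.branchInd j x := by
  cases x <;> simp only [branchInd] <;> [split_ifs; skip] <;> norm_num

theorem branchInd_le_one (j : I) (x : State I) : T.branchInd j x ≤ 1 := by
  cases x <;> simp only [branchInd] <;> [split_ifs; skip] <;> norm_num

theorem branchInd_self (j : I) : T.branchInd j (.site j) = 1 := if_pos (T.below_refl j)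

theorem branchInd_root_of_ne {j : I} (hj : j ≠ T.root) : T.branchInd j (.site T.root) = 0 :=
  if_neg fun h => hj (T.below_root_iff.1 h)

theorem branchInd_par {j l : I} (hl : l ≠ T.root) (hlj : l ≠ j) :
    T.branchInd j (.site (T.par l)) = T.branchInd j (.site l) := by
  have h : T.Below j l ↔ T.Below j (T.par l) := by simp [T.below_iff hl, hlj.symm]
  classical exact (if_congr h rfl rfl).symm

theorem branchInd_par_self {j : I} (hj : j ≠ T.root) : T.branchInd j (.site (T.par j)) = 0 := by
  refine if_neg fun h => ?_
  have h1 := h.level_le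
  have h2 := T.level_par hj
  omega

theorem branchInd_parState {j i : I} (hij : i ≠ j) :
    T.branchInd j (T.parState i) = T.branchInd j (.site i) := by
  rw [parState]
  split_ifs with hi
  · subst hi
    rw [T.branchInd_root_of_ne hij.symm]
    rfl
  · exact T.branchInd_par hi hij

theorem branchInd_parState_self (j : I) : T.branchInd j (T.parState j) = 0 := by
  rw [parState]
  split_ifs with hj
  · rfl
  · exact T.branchInd_par_self hj

theorem parState_eq_site_iff {j i : I} : T.parState j = .site i ↔ j ∈ T.succFinset i := by
  rw [mem_succFinset, parState]
  split_ifs with h <;> simp [h]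

open scoped Classical in
-- Cutting off at the branch of j affects only the edge from j to its predecessor, so the generator
-- acquires two point sources, at the two ends of this edge.
theorem gen_mul_branchInd (ψ : State I → ℝ) (j i : I) :
    T.gen (fun x => ψ x * T.branchInd j x) i = T.branchInd j (.site i) * T.gen ψ i
      - (if i = j then T.edgeCond j * ψ (T.parState j) else 0)
      + (if T.parState j = .site i then T.edgeCond j * ψ (.site j) else 0) := by
  have hpar : T.edgeCond i * (ψ (T.parState i) * T.branchInd j (T.parState i) -
      ψ (.site i) * T.branchInd j (.site i)) =
      T.branchInd j (.site i) * (T.edgeCond i * (ψ (T.parState i) - ψ (.site i)))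
        - (if i = j then T.edgeCond j * ψ (T.parState j) else 0) := by
    split_ifs with hij
    · subst hij
      rw [T.branchInd_parState_self, T.branchInd_self]
      ring
    · rw [T.branchInd_parState hij]
      ring
  have hsum : ∑ l ∈ T.succFinset i, T.edgeCond l * (ψ (.site l) * T.branchInd j (.site l) -
      ψ (.site i) * T.branchInd j (.site i)) =
      T.branchInd j (.site i) * (∑ l ∈ T.succFinset i,
        T.edgeCond l * (ψ (.site l) - ψ (.site i)))
        + (if T.parState j = .site i then T.edgeCond j * ψ (.site j) else 0) := by
    have hterm : ∀ l ∈ T.succFinset i, T.edgeCond l * (ψ (.site l) * T.branchInd j (.site l) -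
        ψ (.site i) * T.branchInd j (.site i)) =
        T.branchInd j (.site i) * (T.edgeCond l * (ψ (.site l) - ψ (.site i))) +
          if l = j then T.edgeCond j * ψ (.site j) else 0 := by
      intro l hl
      rw [mem_succFinset] at hl
      obtain ⟨hr, rfl⟩ := hl
      split_ifs with hlj
      · subst hlj
        rw [T.branchInd_self, T.branchInd_par_self hr]
        ring
      · rw [T.branchInd_par hr hlj]
        ring
    rw [Finset.sum_congr rfl hterm, Finset.sum_add_distrib, Finset.mul_sum,
      Finset.sum_ite_eq']
    simp only [T.parState_eq_site_iff]
  simp only [gen]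
  rw [hpar, hsum]
  ring

theorem gen_add (φ ψ : State I → ℝ) (i : I) :
    T.gen (fun x => φ x + ψ x) i = T.gen φ i + T.gen ψ i := by
  simp only [gen, add_sub_add_comm, mul_add, Finset.sum_add_distrib]
  ring

theorem gen_const_mul (a : ℝ) (φ : State I → ℝ) (i : I) :
    T.gen (fun x => a * φ x) i = a * T.gen φ i := by
  simp only [gen, mul_add, Finset.mul_sum]
  congr 1
  · ring
  · exact Finset.sum_congr rfl fun l _ => by ring

theorem gen_one (i : I) : T.gen (fun _ => 1) i = 0 := by simp [gen]

open scoped Classical in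
/-- The Green function of a site `k`, up to a constant multiple: it is dominated by the probability
to reach the cemetery, and harmonic except at `k`. -/
theorem exists_green [Countable I] (k : I) : ∃ F : State I → ℝ, ∃ c : ℝ,
    (∀ x, |F x| ≤ c * T.hit x) ∧ F .cemetery = 0 ∧ F (.site T.root) = T.w 0 ∧
    ∀ i, T.gen F i = -(if i = k then (T.hit (.site k))⁻¹ else 0) := by
  induction k using T.level_induction with
  | root =>
    -- The factor normalizes the value at the root to w_0. The only source of `hit`, cut off to the
    -- whole tree, is at the root, as the other end of the edge is the cemetery.
    set a := T.w 0 / T.hit (.site T.root) with ha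
    have ha0 : 0 ≤ a := div_nonneg (T.w_pos 0).le (T.hit_nonneg _)
    have hr := (T.hit_site_pos T.root).ne'
    refine ⟨fun x => a * (T.hit x * T.branchInd T.root x), a, fun x => ?_, ?_, ?_, fun i => ?_⟩
    · rw [abs_mul, abs_mul, abs_of_nonneg ha0, abs_of_nonneg (T.hit_nonneg x),
        abs_of_nonneg (T.branchInd_nonneg _ x)]
      exact mul_le_mul_of_nonneg_left
        (mul_le_of_le_one_right (T.hit_nonneg x) (T.branchInd_le_one _ x)) ha0
    · simp [branchInd]
    · beta_reduce
      rw [T.branchInd_self, mul_one, ha, div_mul_cancel₀ _ hr]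
    · have hp : T.parState T.root = .cemetery := by simp [parState]
      rw [gen_const_mul, gen_mul_branchInd, gen_hit, hp,
        if_neg (show ¬ State.cemetery = State.site i by simp)]
      split_ifs with h
      · have hw := (T.w_pos 0).ne'
        rw [ha, edgeCond, T.level_root, incr, show T.hit .cemetery = 1 from rfl]
        field_simp
        ring
      · ring
  | step j hj ih =>
    obtain ⟨F, c, hFc, hF0, hFr, hFg⟩ := ih
    have hp : T.parState j = .site (T.par j) := by simp [parState, hj]
    have h1 := T.hit_site_pos j
    have h2 := T.hit_site_pos (T.par j)
    have h3 := T.edgeCond_pos j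
    -- With this b the added term cancels the pole of F at the predecessor of j and creates a pole
    -- of strength 1/h(j) at j. It vanishes at the root, so the value there stays w_0.
    set b := (T.edgeCond j * T.hit (.site j) * T.hit (.site (T.par j)))⁻¹ with hb
    have hb0 : 0 < b := by positivity
    refine ⟨fun x => F x + b * (T.hit x * T.branchInd j x), c + b, fun x => ?_, ?_, ?_,
      fun i => ?_⟩
    · refine (abs_add_le _ _).trans ?_
      rw [add_mul]
      refine add_le_add (hFc x) ?_
      rw [abs_mul, abs_mul, abs_of_pos hb0, abs_of_nonneg (T.hit_nonneg x),
        abs_of_nonneg (T.branchInd_nonneg _ x)]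
      exact mul_le_mul_of_nonneg_left
        (mul_le_of_le_one_right (T.hit_nonneg x) (T.branchInd_le_one _ x)) hb0.le
    · simp [branchInd, hF0]
    · beta_reduce
      rw [T.branchInd_root_of_ne hj, hFr]
      ring
    · rw [gen_add, gen_const_mul, gen_mul_branchInd, gen_hit, hFg, hp]
      have e1 : b * (T.edgeCond j * T.hit (.site (T.par j))) = (T.hit (.site j))⁻¹ := by
        rw [hb]
        field_simp
      have e2 : b * (T.edgeCond j * T.hit (.site j)) = (T.hit (.site (T.par j)))⁻¹ := by
        rw [hb]
        field_simp
      have e3 : (State.site (T.par j) = State.site i) ↔ i = T.par j := by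
        rw [State.site.injEq, eq_comm]
      simp only [e3]
      rw [mul_add, mul_sub, mul_ite, mul_ite, e1, e2]
      split_ifs <;> ring

/-- The path eventually stays in the branch of `j`. -/
def EventuallyIn (j : I) (ω : ℕ → State I × ℝ) : Prop :=
  ∀ᶠ k in atTop, ∃ i, (ω k).1 = .site i ∧ T.Below j i

theorem measurableSet_eventuallyIn (j : I) : MeasurableSet {ω | T.EventuallyIn j ω} := by
  simp only [EventuallyIn, eventually_atTop]
  rw [ofPred_exists]
  refine MeasurableSet.iUnion fun n => ?_
  simp only [ofPred_forall]
  refine MeasurableSet.iInter fun m => MeasurableSet.iInter fun _ => ?_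
  exact (measurable_fst.comp (measurable_pi_apply m))
    (MeasurableSet.of_discrete (s := {x : State I | ∃ i, x = .site i ∧ T.Below j i}))

variable {T} in
theorem adj_of_jump {i l : I} (h : T.Jump (.site i) (.site l)) : T.graph.Adj i l := by
  rw [adj_iff]
  rcases h with h | ⟨l', hlmem, h⟩
  · left
    rw [parState] at h
    split_ifs at h with hi
    injection h with h
    exact ⟨hi, h.symm⟩
  · right
    injection h with h
    subst h
    exact T.mem_succFinset.1 hlmem

/-- The path has positive holding times and follows the edges, and if it does not reach the
cemetery, it exits at a boundary point along which `hit` converges to `0`. -/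
structure GoodPath (ω : ℕ → State I × ℝ) : Prop where
  hold_pos : ∀ n, 0 < (ω n).2
  jump : ∀ n, T.Jump (ω n).1 (ω (n + 1)).1
  zero : (ω 0).1 = .site T.root
  tendsto_hit : (∀ n, (ω n).1 ≠ .cemetery) → Tendsto (fun n => T.hit (ω n).1) atTop (𝓝 0)

theorem ae_goodPath [Countable I] : ∀ᵐ ω ∂T.law T.root, T.GoodPath ω := by
  filter_upwards [T.ae_hold_pos T.root, T.ae_jump T.root, T.ae_zero_eq T.root,
    T.ae_tendsto_hit T.root] with ω h1 h2 h3 h4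
  exact ⟨h1, h2, h3, h4⟩

/-! ### Convergence of typical paths to the boundary -/

section GoodPath

variable {T} {ω : ℕ → State I × ℝ}

theorem GoodPath.exists_exit [Countable I] (hω : T.GoodPath ω)
    (hne : ∀ n, (ω n).1 ≠ .cemetery) :
    ∃ ξ : T.Boundary, ExitsAt ω ξ ∧ ∀ ε > 0, ∃ n, T.hit (.site (ξ.at n)) < ε := by
  have hsite : ∀ n, ∃ i, (ω n).1 = .site i := by
    intro n
    rcases h : (ω n).1 with i | _
    · exact ⟨i, rfl⟩
    · exact absurd h (hne n)
  choose y hy using hsite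
  have hadj : ∀ k, T.graph.Adj (y k) (y (k + 1)) := by
    intro k
    have := hω.jump k
    rw [hy, hy] at this
    exact adj_of_jump this
  have hlim := hω.tendsto_hit hne
  simp only [hy] at hlim
  -- Since `hit` is positive at each site but tends to 0 along the path, no site is visited
  -- infinitely often.
  have hfin : ∀ i, ∀ᶠ k in atTop, y k ≠ i := by
    intro i
    filter_upwards [hlim.eventually_lt_const (T.hit_site_pos i)] with k hk h
    rw [h] at hk
    exact lt_irrefl _ hk
  obtain ⟨ξ, hξ⟩ := T.exists_boundary_limit hadj hfin
  refine ⟨ξ, (exitsAt_iff hω.hold_pos).2 ⟨hne, fun n => ?_⟩, fun ε hε => ?_⟩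
  · filter_upwards [hξ n] with k hk
    exact ⟨y k, hy k, hk⟩
  · have h0 : y 0 = T.root := by
      have := hω.zero
      rw [hy] at this
      injection this
    have hvis : ∀ n, ∃ m, y m = ξ.at n := by
      intro n
      obtain ⟨k, hk⟩ := (hξ n).exists
      exact T.exists_visit h0 hadj hk
    choose τ hτ using hvis
    -- The sites ξ(n) have different levels, so the visiting times are distinct. This forces them to
    -- infinity, and `hit` tends to 0 along ξ(n) as well.
    have hinj : Function.Injective τ := by
      intro a b hab
      have := hτ b
      rw [← hab, hτ a] at this
      rw [← ξ.level_at a, this, ξ.level_at]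
    have := (hlim.comp (Nat.cofinite_eq_atTop ▸ hinj.tendsto_cofinite)).eventually_lt_const hε
    obtain ⟨n, hn⟩ := this.exists
    refine ⟨n, ?_⟩
    simpa [hτ] using hn

theorem GoodPath.not_eventuallyIn (hω : T.GoodPath ω) {n : ℕ}
    (hn : (ω n).1 = .cemetery) (j : I) : ¬ T.EventuallyIn j ω := by
  intro h
  obtain ⟨k, ⟨i, hi, -⟩, hk⟩ := (h.and (eventually_ge_atTop n)).exists
  rw [cemetery_of_le hω.jump hk hn] at hi
  simp at hi

theorem GoodPath.eventuallyIn_iff (hω : T.GoodPath ω) {ξ : T.Boundary}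
    (hξ : ExitsAt ω ξ) (j : I) :
    T.EventuallyIn j ω ↔ ξ ∈ T.shadow j := by
  rw [exitsAt_iff hω.hold_pos] at hξ
  rw [mem_shadow_iff]
  constructor
  · intro h
    obtain ⟨k, ⟨i, hi, hb⟩, ⟨i', hi', hb'⟩⟩ := (h.and (hξ.2 (T.level j))).exists
    rw [hi] at hi'
    injection hi' with hi'
    subst hi'
    exact hb'.eq_of_level hb (ξ.level_at _)
  · intro h
    have := hξ.2 (T.level j)
    rwa [h] at this

/-- The exit point decides: if the path does not stay in the branch of j, it finally stays in the
branch of another site of the same level. -/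
theorem GoodPath.tendsto_branchInd [Countable I] (hω : T.GoodPath ω)
    (hne : ∀ n, (ω n).1 ≠ .cemetery) (j : I) :
    Tendsto (fun n => T.branchInd j (ω n).1) atTop
      (𝓝 ({ω | T.EventuallyIn j ω}.indicator (fun _ => (1 : ℝ)) ω)) := by
  obtain ⟨ξ, hξ, -⟩ := hω.exists_exit hne
  refine tendsto_const_nhds.congr' ?_
  by_cases h : T.EventuallyIn j ω
  · rw [indicator_of_mem (show ω ∈ {ω | T.EventuallyIn j ω} from h)]
    filter_upwards [h] with k hk
    obtain ⟨i, hi, hb⟩ := hk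
    rw [hi, branchInd, if_pos hb]
  · rw [indicator_of_notMem (show ω ∉ {ω | T.EventuallyIn j ω} from h)]
    rw [hω.eventuallyIn_iff hξ, mem_shadow_iff] at h
    filter_upwards [((exitsAt_iff hω.hold_pos).1 hξ).2 (T.level j)] with k hk
    obtain ⟨i, hi, hb⟩ := hk
    rw [hi, branchInd, if_neg]
    intro hb'
    exact h (hb.eq_of_level hb' (ξ.level_at _))

end GoodPath

variable {T} in
-- A bounded harmonic function is the mean of its limit. Absorbed paths contribute nothing because
-- of `h0`, so its value at the root is the mean of the indicator.
theorem law_real_eventuallyIn_of_harmonic [Countable I] {φ : State I → ℝ} {c : ℝ}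
    (hc : ∀ x, |φ x| ≤ c) (hφ : ∀ i, T.gen φ i = 0) (h0 : φ .cemetery = 0) {j : I}
    (hlim : ∀ ω, T.GoodPath ω → (∀ n, (ω n).1 ≠ .cemetery) →
      Tendsto (fun n => φ (ω n).1) atTop
        (𝓝 ({ω | T.EventuallyIn j ω}.indicator (fun _ => (1 : ℝ)) ω))) :
    (T.law T.root).real {ω | T.EventuallyIn j ω} = φ (.site T.root) := by
  have := integral_limit_of_harmonic hc hφ T.root
    (X := {ω | T.EventuallyIn j ω}.indicator (fun _ => (1 : ℝ))) (by
      filter_upwards [T.ae_goodPath] with ω hω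
      by_cases hne : ∀ n, (ω n).1 ≠ .cemetery
      · exact hlim ω hω hne
      · push Not at hne
        obtain ⟨n, hn⟩ := hne
        rw [indicator_of_notMem (show ω ∉ {ω | T.EventuallyIn j ω} from
          hω.not_eventuallyIn hn j)]
        refine tendsto_const_nhds.congr' ?_
        filter_upwards [eventually_ge_atTop n] with m hm
        rw [cemetery_of_le hω.jump hm hn, h0])
  rwa [integral_indicator (T.measurableSet_eventuallyIn j), setIntegral_const, smul_eq_mul,
    mul_one] at this

/-- The probability that the path from the root exits in the shadow of `j`. -/
theorem law_real_eventuallyIn [Countable I] (j : I) :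
    (T.law T.root).real {ω | T.EventuallyIn j ω} =
      T.w 0 * T.edgeCond j * (T.hit (T.parState j) - T.hit (.site j)) := by
  by_cases hj : j = T.root
  · subst hj
    have hw := (T.w_pos 0).ne'
    -- For the root the required harmonic function is 1 - h.
    rw [law_real_eventuallyIn_of_harmonic (φ := fun x => 1 + (-1) * T.hit x) (c := 1)]
    · simp only [parState, if_true, hit, edgeCond, T.level_root, incr]
      field_simp
      ring
    · intro x
      rw [abs_le]
      constructor <;> linarith [T.hit_nonneg x, T.hit_le_one x]
    · intro i
      rw [gen_add, gen_one, gen_const_mul, gen_hit]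
      ring
    · simp [hit]
    · intro ω hω hne
      have h1 := (hω.tendsto_hit hne).const_mul (-1)
      obtain ⟨ξ, hξ, -⟩ := hω.exists_exit hne
      have h2 : T.EventuallyIn T.root ω :=
        (hω.eventuallyIn_iff hξ _).2 (mem_shadow_iff.2 (T.level_root.symm ▸ ξ.at_zero))
      rw [indicator_of_mem (show ω ∈ {ω | T.EventuallyIn T.root ω} from h2)]
      simpa using h1.const_add 1
  · obtain ⟨F, c, hFc, hF0, hFr, hFg⟩ := T.exists_green (T.par j)
    have hp : T.parState j = .site (T.par j) := by simp [parState, hj]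
    -- With a = 1/h(pred j) the factor 1 - a h vanishes at the predecessor of j, so cutting it off
    -- at the branch leaves a source at that predecessor only. Its strength is c_j (1 - h(j)/h(pred
    -- j)), with c_j the conductance of the edge, which the Green function times β cancels. Along
    -- unabsorbed paths F and h tend to 0, so only the indicator remains in the limit.
    set β := T.edgeCond j * (T.hit (T.parState j) - T.hit (.site j)) with hβ
    set a := (T.hit (T.parState j))⁻¹ with ha
    have hpos : 0 < T.hit (T.parState j) := T.hit_pos _
    have ha0 : 0 < a := inv_pos.2 hpos
    have hc0 : 0 ≤ c := by
      have := (abs_nonneg _).trans (hFc .cemetery)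
      simpa [hit] using this
    rw [law_real_eventuallyIn_of_harmonic
      (φ := fun x => β * F x + (1 + (-a) * T.hit x) * T.branchInd j x)
      (c := |β| * c + (1 + a))]
    · rw [T.branchInd_root_of_ne hj, hFr, hβ]
      ring
    · intro x
      refine (abs_add_le _ _).trans (add_le_add ?_ ?_)
      · rw [abs_mul]
        refine mul_le_mul_of_nonneg_left ((hFc x).trans ?_) (abs_nonneg _)
        exact mul_le_of_le_one_right hc0 (T.hit_le_one x)
      · rw [abs_mul, abs_of_nonneg (T.branchInd_nonneg _ x)]
        refine (mul_le_of_le_one_right (abs_nonneg _) (T.branchInd_le_one _ x)).trans ?_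
        refine (abs_add_le _ _).trans ?_
        rw [abs_one, abs_mul, abs_neg, abs_of_pos ha0, abs_of_nonneg (T.hit_nonneg x)]
        have := mul_le_of_le_one_right ha0.le (T.hit_le_one x)
        linarith
    · intro i
      classical
      rw [gen_add, gen_const_mul, gen_mul_branchInd, gen_add, gen_one, gen_const_mul, gen_hit,
        hFg, hp]
      have e3 : (State.site (T.par j) = State.site i) ↔ i = T.par j := by
        rw [State.site.injEq, eq_comm]
      simp only [e3]
      have e4 : 1 + (-a) * T.hit (.site (T.par j)) = 0 := by
        rw [ha, hp, neg_mul, inv_mul_cancel₀ (hp ▸ hpos.ne')]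
        ring
      rw [e4]
      split_ifs <;> simp only [mul_zero, sub_zero, add_zero, neg_zero, zero_add]
      all_goals
        rw [hβ, ha, hp]
        have := (hp ▸ hpos.ne' : T.hit (.site (T.par j)) ≠ 0)
        field_simp
        ring
    · simp [hF0, branchInd]
    · intro ω hω hne
      have h1 := hω.tendsto_hit hne
      have h2 : Tendsto (fun n => F (ω n).1) atTop (𝓝 0) := by
        refine squeeze_zero_norm (fun n => hFc _) ?_
        simpa using h1.const_mul c
      have h3 := (h2.const_mul β).add
        (((h1.const_mul (-a)).const_add 1).mul (hω.tendsto_branchInd hne j))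
      simpa using h3

end

section

variable {I : Type*} (T : TreeMatrix I)

/-! ### The exit measure -/

theorem isOpen_shadow (i : I) : IsOpen (T.shadow i) :=
  TopologicalSpace.isOpen_generateFrom_of_mem ⟨i, rfl⟩

theorem measurableSet_shadow (i : I) : MeasurableSet (T.shadow i) :=
  (T.isOpen_shadow i).measurableSet

theorem measurableSet_C (n : ℕ) (ξ : T.Boundary) : MeasurableSet (T.C n ξ) := by
  rw [C_eq_shadow]
  exact T.measurableSet_shadow _

instance [Countable I] : SecondCountableTopology T.Boundary :=
  ⟨⟨range T.shadow, countable_range _, rfl⟩⟩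

theorem borel_eq_generateFrom_shadow [Countable I] :
    (inferInstance : MeasurableSpace T.Boundary) =
      MeasurableSpace.generateFrom (range T.shadow) :=
  borel_eq_generateFrom_of_subbasis rfl

theorem exitsAt_unique {ω : ℕ → State I × ℝ} (hω : T.GoodPath ω) {ξ η : T.Boundary}
    (hξ : ExitsAt ω ξ) (hη : ExitsAt ω η) : ξ = η := by
  refine Boundary.ext fun n => ?_
  have h1 : ξ ∈ T.shadow (ξ.at n) := ⟨n, rfl⟩
  rw [← hω.eventuallyIn_iff hξ, hω.eventuallyIn_iff hη, mem_shadow_iff, ξ.level_at] at h1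
  exact h1.symm

theorem exitPoint_eq {ω : ℕ → State I × ℝ} (hω : T.GoodPath ω) {ξ : T.Boundary}
    (hξ : ExitsAt ω ξ) : T.exitPoint ω = .inl ξ := by
  have h : ∃ ξ : T.Boundary, ExitsAt ω ξ := ⟨ξ, hξ⟩
  rw [exitPoint, dif_pos h, T.exitsAt_unique hω h.choose_spec hξ]

theorem exitPoint_mem_shadow_iff [Countable I] {ω : ℕ → State I × ℝ} (hω : T.GoodPath ω) (j : I) :
    T.exitPoint ω ∈ (Sum.inl '' T.shadow j : Set (T.Boundary ⊕ Unit)) ↔ T.EventuallyIn j ω := by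
  by_cases hne : ∀ n, (ω n).1 ≠ .cemetery
  · obtain ⟨ξ, hξ, -⟩ := hω.exists_exit hne
    rw [T.exitPoint_eq hω hξ, hω.eventuallyIn_iff hξ]
    simp
  · push Not at hne
    obtain ⟨n, hn⟩ := hne
    refine iff_of_false ?_ (hω.not_eventuallyIn hn j)
    rw [exitPoint, dif_neg]
    · simp
    · rintro ⟨ξ, hξ⟩
      exact ((exitsAt_iff hω.hold_pos).1 hξ).1 n hn

theorem shadow_root : T.shadow T.root = univ := by
  ext ξ
  simp only [mem_univ, iff_true]
  exact ⟨0, ξ.at_zero⟩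

theorem aemeasurable_exitPoint [Countable I] : AEMeasurable T.exitPoint (T.law T.root) := by
  classical
  -- The exit point is examined only on a measurable set of good paths of full measure, where the
  -- preimages of shadows are explicit.
  obtain ⟨s, hs, hsm, hsg⟩ := (T.ae_goodPath).exists_measurable_mem
  have key : ∀ B : Set T.Boundary, MeasurableSet B →
      MeasurableSet (s ∩ T.exitPoint ⁻¹' (Sum.inl '' B)) := by
    have hshadow : ∀ j, MeasurableSet (s ∩ T.exitPoint ⁻¹' (Sum.inl '' T.shadow j)) := by
      intro j
      have : s ∩ T.exitPoint ⁻¹' (Sum.inl '' T.shadow j) = s ∩ {ω | T.EventuallyIn j ω} := by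
        ext ω
        exact and_congr_right fun hω => T.exitPoint_mem_shadow_iff (hsg ω hω) j
      rw [this]
      exact hsm.inter (T.measurableSet_eventuallyIn j)
    intro B hB
    replace hB : MeasurableSet[MeasurableSpace.generateFrom (range T.shadow)] B :=
      T.borel_eq_generateFrom_shadow ▸ hB
    induction B, hB using MeasurableSpace.generateFrom_induction with
    | hC B hB _ =>
      obtain ⟨j, rfl⟩ := hB
      exact hshadow j
    | empty => simp
    | compl B _ ih =>
      -- Complements are taken within the paths that exit at the boundary, and the whole boundary is
      -- the shadow of the root.
      have h1 := (hshadow T.root).diff ih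
      convert h1 using 1
      rw [shadow_root]
      ext ω
      simp only [mem_inter_iff, mem_preimage, mem_image, Set.mem_sdiff, mem_univ, true_and,
        mem_compl_iff]
      constructor
      · rintro ⟨h, ξ, hξ, he⟩
        refine ⟨⟨h, ξ, he⟩, fun h' => ?_⟩
        obtain ⟨-, η, hη, he'⟩ := h'
        rw [← he] at he'
        exact hξ (Sum.inl_injective he' ▸ hη)
      · rintro ⟨⟨h, ξ, he⟩, h'⟩
        exact ⟨h, ξ, fun hξ => h' ⟨h, ξ, hξ, he⟩, he⟩
    | iUnion B _ ih =>
      rw [image_iUnion, preimage_iUnion, inter_iUnion]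
      exact MeasurableSet.iUnion ih
  refine ⟨s.piecewise T.exitPoint fun _ => .inr (), ?_, ?_⟩
  · intro t ht
    have h1 := key _ (measurable_inl ht)
    have h2 : s.piecewise T.exitPoint (fun _ => Sum.inr ()) ⁻¹' t =
        (s ∩ T.exitPoint ⁻¹' (Sum.inl '' (Sum.inl ⁻¹' t))) ∪
          ((s ∩ T.exitPoint ⁻¹' (Sum.inl '' univ))ᶜ ∩ {_ω | Sum.inr () ∈ t}) := by
      ext ω
      by_cases hω : ω ∈ s
      · rw [mem_preimage, piecewise_eq_of_mem _ _ _ hω]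
        rcases h : T.exitPoint ω with ξ | u <;> simp [hω, h]
      · rw [mem_preimage, piecewise_eq_of_notMem _ _ _ hω]
        simp [hω]
    rw [h2]
    exact h1.union ((key _ MeasurableSet.univ).compl.inter (MeasurableSet.const _))
  · filter_upwards [hs] with ω hω
    rw [piecewise_eq_of_mem _ _ _ hω]

theorem measurableEmbedding_inl {α β : Type*} [MeasurableSpace α] [MeasurableSpace β] :
    MeasurableEmbedding (Sum.inl : α → α ⊕ β) :=
  ⟨Sum.inl_injective, measurable_inl, fun _ hs => measurableSet_inl_image.2 hs⟩

theorem map_exitPoint_shadow [Countable I] (j : I) :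
    (T.law T.root).map T.exitPoint (Sum.inl '' T.shadow j) =
      T.law T.root {ω | T.EventuallyIn j ω} := by
  rw [Measure.map_apply_of_aemeasurable T.aemeasurable_exitPoint
    (measurableEmbedding_inl.measurableSet_image.2 (T.measurableSet_shadow j))]
  refine measure_congr ?_
  filter_upwards [T.ae_goodPath] with ω hω
  exact propext (T.exitPoint_mem_shadow_iff hω j)

theorem exitMeasure_apply [Countable I] (B : Set T.Boundary) :
    T.exitMeasure B = (T.law T.root {ω | T.EventuallyIn T.root ω})⁻¹ *
      (T.law T.root).map T.exitPoint (Sum.inl '' B) := by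
  have hr : (range Sum.inl : Set (T.Boundary ⊕ Unit)) = Sum.inl '' T.shadow T.root := by
    rw [shadow_root, image_univ]
  rw [exitMeasure, measurableEmbedding_inl.comap_apply, cond_apply measurableSet_range_inl,
    inter_eq_self_of_subset_right (image_subset_range _ _), hr, map_exitPoint_shadow]

/-- The constant value of `G_0` on the regular points. -/
def alpha : ℝ := T.w 0 / (1 - T.hit (.site T.root))

theorem law_real_eventuallyIn_root [Countable I] :
    (T.law T.root).real {ω | T.EventuallyIn T.root ω} = 1 - T.hit (.site T.root) := by
  rw [law_real_eventuallyIn, edgeCond, T.level_root, incr,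
    mul_inv_cancel₀ (T.w_pos 0).ne', one_mul, parState, if_pos rfl,
    show T.hit .cemetery = 1 from rfl]

variable {T} in
theorem Transient.hit_root_lt (hT : T.Transient) : T.hit (.site T.root) < 1 := by
  rw [hit, ← ENNReal.toReal_one]
  exact ENNReal.toReal_strict_mono ENNReal.one_ne_top hT

variable {T} in
theorem Transient.alpha_pos (hT : T.Transient) : 0 < T.alpha :=
  div_pos (T.w_pos 0) (sub_pos.2 hT.hit_root_lt)

variable {T} in
theorem Transient.isProbabilityMeasure [Countable I] (hT : T.Transient) :
    IsProbabilityMeasure T.exitMeasure := by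
  refine ⟨?_⟩
  rw [T.exitMeasure_apply univ, ← shadow_root, map_exitPoint_shadow]
  refine ENNReal.inv_mul_cancel (fun h => ?_) (measure_ne_top _ _)
  have h1 := T.law_real_eventuallyIn_root
  rw [measureReal_def, h] at h1
  have := hT.hit_root_lt
  simp at h1
  linarith

variable {T} in
-- The identity on which everything rests. The conductance in the exit probability cancels Δ, and
-- conditioning on exit at the boundary divides w_0 by 1 - h(r), which gives α.
theorem Transient.incr_mul_exitMeasure_shadow [Countable I] (j : I) :
    T.incr (T.level j) * T.exitMeasure.real (T.shadow j) =
      T.alpha * (T.hit (T.parState j) - T.hit (.site j)) := by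
  rw [measureReal_def, T.exitMeasure_apply (T.shadow j), map_exitPoint_shadow,
    ENNReal.toReal_mul, ENNReal.toReal_inv, ← measureReal_def, ← measureReal_def,
    law_real_eventuallyIn_root, law_real_eventuallyIn, alpha, edgeCond]
  have := (T.incr_pos (T.level j)).ne'
  field_simp

/-- The decrease of `hit` across an edge is a nonnegative multiple of the mass of a shadow. -/
theorem hit_le_parState [Countable I] (hT : T.Transient) (j : I) :
    T.hit (.site j) ≤ T.hit (T.parState j) := by
  have h := Transient.incr_mul_exitMeasure_shadow (T := T) j
  have h1 : 0 ≤ T.incr (T.level j) * T.exitMeasure.real (T.shadow j) :=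
    mul_nonneg (T.incr_pos _).le measureReal_nonneg
  rw [h] at h1
  have := nonneg_of_mul_nonneg_right h1 hT.alpha_pos
  linarith

theorem hit_antitone [Countable I] (hT : T.Transient) {i j : I} (h : T.Below i j) :
    T.hit (.site j) ≤ T.hit (.site i) := by
  induction j using T.level_induction with
  | root =>
    rw [below_root_iff] at h
    rw [h]
  | step j hj ih =>
    rcases (T.below_iff hj).1 h with rfl | h
    · exact le_rfl
    · refine (T.hit_le_parState hT j).trans ?_
      rw [parState, if_neg hj]
      exact ih h

/-- Because `hit` decreases away from the root, its supremum over the branch of ξ(n) is attained at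
ξ(n), so the ray alone decides regularity. -/
theorem mem_regular_iff [Countable I] (hT : T.Transient) {ξ : T.Boundary} :
    ξ ∈ T.regular ↔ Tendsto (fun n => T.hit (.site (ξ.at n))) atTop (𝓝 0) := by
  have hreal : Tendsto T.hitProb ξ.toward (𝓝 0) ↔
      Tendsto (fun i => T.hit (.site i)) ξ.toward (𝓝 0) := by
    have := ENNReal.tendsto_toReal_iff (fi := ξ.toward) (f := T.hitProb) (fun i => T.hitProb_ne_top i)
      ENNReal.zero_ne_top
    exact this.symm
  rw [regular, mem_ofPred_eq, hreal]
  have hbasis : ξ.toward.HasBasis (fun _ => True) fun n => {j | T.Below (ξ.at n) j} := by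
    refine hasBasis_iInf_principal ?_
    refine directed_of_isDirected_le fun n m h j hj => ?_
    exact (ξ.below_at h).trans hj
  constructor
  · intro h
    refine h.comp ?_
    rw [hbasis.tendsto_right_iff]
    intro n _
    filter_upwards [eventually_ge_atTop n] with m hm
    exact ξ.below_at hm
  · intro h
    rw [Metric.tendsto_nhds]
    intro ε hε
    obtain ⟨n, hn⟩ := (h.eventually_lt_const hε).exists
    refine hbasis.eventually_iff.2 ⟨n, trivial, fun j hj => ?_⟩
    rw [Real.dist_eq, sub_zero, abs_of_nonneg (T.hit_nonneg _)]
    exact (T.hit_antitone hT hj).trans_lt hn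

theorem mem_regular_iff_exists [Countable I] (hT : T.Transient) {ξ : T.Boundary} :
    ξ ∈ T.regular ↔ ∀ m : ℕ, ∃ n, T.hit (.site (ξ.at n)) < 1 / (m + 1 : ℝ) := by
  rw [T.mem_regular_iff hT]
  constructor
  · intro h m
    exact (h.eventually_lt_const (by positivity)).exists
  · intro h
    rw [Metric.tendsto_atTop]
    intro ε hε
    obtain ⟨m, hm⟩ := exists_nat_one_div_lt hε
    obtain ⟨n, hn⟩ := h m
    refine ⟨n, fun k hk => ?_⟩
    rw [Real.dist_eq, sub_zero, abs_of_nonneg (T.hit_nonneg _)]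
    exact (T.hit_antitone hT (ξ.below_at hk)).trans_lt (hn.trans hm)

theorem measurable_at [Countable I] (n : ℕ) : Measurable[_, ⊤] fun ξ : T.Boundary => ξ.at n := by
  let _ : MeasurableSpace I := ⊤
  refine measurable_to_countable' fun i => ?_
  by_cases hi : T.level i = n
  · convert T.measurableSet_shadow i using 1
    ext ξ
    rw [mem_shadow_iff, hi]
    rfl
  · convert MeasurableSet.empty using 1
    ext ξ
    simp only [mem_preimage, mem_singleton_iff, mem_empty_iff_false, iff_false]
    rintro rfl
    exact hi (ξ.level_at n)

theorem measurable_comp_at [Countable I] {β : Type*} [MeasurableSpace β] (f : I → β) (n : ℕ) :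
    Measurable fun ξ : T.Boundary => f (ξ.at n) := by
  let _ : MeasurableSpace I := ⊤
  exact (measurable_from_top (f := f)).comp (T.measurable_at n)

theorem measurableSet_regular [Countable I] (hT : T.Transient) : MeasurableSet T.regular := by
  have : T.regular = ⋂ m : ℕ, ⋃ n, {ξ | T.hit (.site (ξ.at n)) < 1 / (m + 1 : ℝ)} := by
    ext ξ
    rw [T.mem_regular_iff_exists hT]
    simp
  rw [this]
  refine MeasurableSet.iInter fun m => MeasurableSet.iUnion fun n => ?_
  exact measurableSet_lt (T.measurable_comp_at (fun i => T.hit (.site i)) n) measurable_const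

/-- The exit point of a good path has points on its ray with arbitrarily small `hit`, and by
monotonicity this suffices. -/
theorem ae_mem_regular [Countable I] (hT : T.Transient) : ∀ᵐ ξ ∂T.exitMeasure, ξ ∈ T.regular := by
  rw [ae_iff]
  have hm : MeasurableSet {ξ | ξ ∉ T.regular} := (T.measurableSet_regular hT).compl
  rw [T.exitMeasure_apply, Measure.map_apply_of_aemeasurable T.aemeasurable_exitPoint
    (measurableEmbedding_inl.measurableSet_image.2 hm)]
  refine mul_eq_zero_of_right _ ?_
  refine measure_mono_null (t := {ω | ¬ T.GoodPath ω}) ?_ (ae_iff.1 T.ae_goodPath)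
  rintro ω ⟨ξ, hξ, he⟩ hω
  by_cases hne : ∀ n, (ω n).1 ≠ .cemetery
  · obtain ⟨η, hη, hlim⟩ := hω.exists_exit hne
    rw [T.exitPoint_eq hω hη] at he
    obtain rfl := Sum.inl_injective he
    refine hξ ((T.mem_regular_iff_exists hT).2 fun m => hlim _ (by positivity))
  · have : T.exitPoint ω ∉ (Sum.inl '' T.shadow T.root : Set (T.Boundary ⊕ Unit)) := by
      rw [T.exitPoint_mem_shadow_iff hω]
      push Not at hne
      obtain ⟨n, hn⟩ := hne
      exact hω.not_eventuallyIn hn _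
    rw [shadow_root, image_univ] at this
    exact this ⟨ξ, he⟩

end

section

variable {I : Type*} (T : TreeMatrix I)

/-! ### Topology of the boundary -/

theorem nhds_basis_C (ξ : T.Boundary) : (𝓝 ξ).HasBasis (fun _ => True) fun n => T.C n ξ := by
  have h : 𝓝 ξ = ⨅ n, 𝓟 (T.C n ξ) := by
    rw [TopologicalSpace.nhds_generateFrom]
    refine le_antisymm (le_iInf fun n => ?_) (le_iInf₂ fun s hs => ?_)
    · refine iInf₂_le (T.C n ξ) ⟨mem_C_self n ξ, ξ.at n, ?_⟩
      rw [C_eq_shadow]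
    · obtain ⟨hξ, i, rfl⟩ := hs
      rw [mem_shadow_iff] at hξ
      refine iInf_le_of_le (T.level i) ?_
      rw [C_eq_shadow, hξ]
  rw [h]
  exact hasBasis_iInf_principal (directed_of_isDirected_le fun n m h => C_anti h ξ)

theorem C_mem_nhds (n : ℕ) (ξ : T.Boundary) : T.C n ξ ∈ 𝓝 ξ :=
  (T.nhds_basis_C ξ).mem_of_mem trivial

instance : T2Space T.Boundary := by
  refine ⟨fun ξ η h => ?_⟩
  obtain ⟨n, hn⟩ : ∃ n, ξ.at n ≠ η.at n := by
    by_contra hcon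
    push Not at hcon
    exact h (Boundary.ext hcon)
  refine ⟨T.C n ξ, T.C n η, ?_, ?_, mem_C_self _ _, mem_C_self _ _, ?_⟩
  · rw [C_eq_shadow]
    exact T.isOpen_shadow _
  · rw [C_eq_shadow]
    exact T.isOpen_shadow _
  · refine Set.disjoint_left.2 fun z h1 h2 => hn ?_
    rw [mem_C_iff] at h1 h2
    rw [h1, h2]

/-- Each level is finite, so an ultrafilter selects one site on every level. The selected sites form
a ray, which is the limit. -/
instance : CompactSpace T.Boundary := by
  refine ⟨isCompact_iff_ultrafilter_le_nhds.2 fun F _ => ?_⟩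
  have hsel : ∀ n, ∃ i, ∀ᶠ ξ in (F : Filter T.Boundary), ξ.at n = i := by
    intro n
    have : ∀ᶠ ξ in (F : Filter T.Boundary), ∃ i ∈ {i | T.level i ≤ n}, ξ.at n = i :=
      Eventually.of_forall fun ξ => ⟨ξ.at n, (ξ.level_at n).le, rfl⟩
    rw [Ultrafilter.eventually_exists_mem_iff (T.finite_level_le n)] at this
    obtain ⟨i, -, hi⟩ := this
    exact ⟨i, hi⟩
  choose x hx using hsel
  refine ⟨⟨x, ?_, fun n => ?_, fun n => ?_⟩, mem_univ _, ?_⟩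
  · obtain ⟨ξ, hξ⟩ := (hx 0).exists
    rw [← hξ, ξ.at_zero]
  · obtain ⟨ξ, hξ⟩ := (hx n).exists
    rw [← hξ, ξ.level_at]
  · obtain ⟨ξ, hξ, hξ'⟩ := ((hx n).and (hx (n + 1))).exists
    rw [← hξ, ← hξ']
    exact ξ.adj_at n
  · refine (T.nhds_basis_C _).ge_iff.2 fun n _ => ?_
    filter_upwards [hx n] with ξ hξ
    exact hξ.symm

/-- A continuous function on the boundary varies little on the sets `C^M(ξ)`, uniformly. -/
theorem exists_level_forall_dist_le (f : C(T.Boundary, ℝ)) {ε : ℝ} (hε : 0 < ε) :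
    ∃ M, ∀ ξ η : T.Boundary, ξ.at M = η.at M → |f ξ - f η| ≤ ε := by
  have hloc : ∀ ξ : T.Boundary, ∃ n, ∀ η ∈ T.C n ξ, |f η - f ξ| < ε / 2 := by
    intro ξ
    have := Metric.continuous_iff'.1 f.continuous ξ (ε / 2) (half_pos hε)
    obtain ⟨n, -, hn⟩ := (T.nhds_basis_C ξ).eventually_iff.1 this
    exact ⟨n, fun η hη => hn hη⟩
  choose n hn using hloc
  obtain ⟨t, ht⟩ := isCompact_univ.elim_nhds_subcover (fun ξ => T.C (n ξ) ξ)
    fun ξ _ => T.C_mem_nhds _ _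
  refine ⟨t.sup n, fun ξ η h => ?_⟩
  obtain ⟨z, hz, hξz⟩ := mem_iUnion₂.1 (ht.2 (mem_univ ξ))
  have hηz : η ∈ T.C (n z) z := by
    rw [mem_C_iff] at hξz ⊢
    rw [hξz]
    exact Boundary.at_eq_of_le (Finset.le_sup hz) h
  have h1 := hn z ξ hξz
  have h2 := hn z η hηz
  rw [abs_sub_comm] at h2
  have := abs_sub_le (f ξ) (f z) (f η)
  linarith

/-! ### The functions `G_n` -/

/-- The function `ξ ↦ α ℙ_{ξ(n-1)}(T_{∂_r} < ∞)`, which is equal to `G_n` on the regular points. -/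
def gReg (n : ℕ) (ξ : T.Boundary) : ℝ := T.alpha * T.hit (T.parState (ξ.at n))

variable {T}

theorem gReg_congr {n : ℕ} {ξ η : T.Boundary} (h : ξ.at n = η.at n) :
    T.gReg n ξ = T.gReg n η := by
  rw [gReg, gReg, h]

theorem gReg_zero (ξ : T.Boundary) : T.gReg 0 ξ = T.alpha := by
  rw [gReg, ξ.at_zero, parState, if_pos rfl, show T.hit .cemetery = 1 from rfl, mul_one]

theorem gReg_succ (n : ℕ) (ξ : T.Boundary) :
    T.gReg (n + 1) ξ = T.alpha * T.hit (.site (ξ.at n)) := by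
  rw [gReg, parState, if_neg (ξ.at_succ_ne_root n), ξ.par_at]

/-- The gain of one level is essential: G_n and G_{n+1} are both functions of ξ(n) on the regular
points, hence so are the coefficients of p. -/
theorem gReg_succ_congr {n : ℕ} {ξ η : T.Boundary} (h : ξ.at n = η.at n) :
    T.gReg (n + 1) ξ = T.gReg (n + 1) η := by
  rw [gReg_succ, gReg_succ, h]

variable [Countable I]

theorem measurable_measure_C (n : ℕ) : Measurable fun ξ => T.exitMeasure (T.C n ξ) := by
  simp only [C_eq_shadow]
  exact T.measurable_comp_at (fun i => T.exitMeasure (T.shadow i)) n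

theorem measurable_G (n : ℕ) : Measurable (T.G n) :=
  Measurable.tsum fun k => (measurable_measure_C (n + k)).const_mul _

/-- The transience assumption as a typeclass. -/
class IsTransient (T : TreeMatrix I) : Prop where
  out : T.Transient

variable [hT : T.IsTransient]

instance : IsProbabilityMeasure T.exitMeasure := hT.out.isProbabilityMeasure

theorem alpha_pos : 0 < T.alpha := hT.out.alpha_pos

theorem gReg_pos (n : ℕ) (ξ : T.Boundary) : 0 < T.gReg n ξ := mul_pos alpha_pos (T.hit_pos _)

theorem gReg_sub_succ (n : ℕ) (ξ : T.Boundary) :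
    T.gReg n ξ - T.gReg (n + 1) ξ = T.incr n * T.exitMeasure.real (T.C n ξ) := by
  have := Transient.incr_mul_exitMeasure_shadow (T := T) (ξ.at n)
  rw [ξ.level_at] at this
  rw [C_eq_shadow, this, gReg_succ, gReg]
  ring

theorem gReg_antitone (ξ : T.Boundary) : Antitone fun n => T.gReg n ξ := by
  refine antitone_nat_of_succ_le fun n => ?_
  have := gReg_sub_succ n ξ
  have : 0 ≤ T.incr n * T.exitMeasure.real (T.C n ξ) :=
    mul_nonneg (T.incr_pos n).le measureReal_nonneg
  linarith

/-- The series that defines G_n telescopes by `gReg_sub_succ`. At a point that is not regular, the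
limit L measures the deviation from `gReg`. -/
theorem G_eq_of_tendsto {ξ : T.Boundary} {L : ℝ}
    (hL : Tendsto (fun n => T.gReg n ξ) atTop (𝓝 L)) (n : ℕ) :
    T.G n ξ = ENNReal.ofReal (T.gReg n ξ - L) := by
  have hnn : ∀ k, 0 ≤ T.incr (n + k) * T.exitMeasure.real (T.C (n + k) ξ) := fun k =>
    mul_nonneg (T.incr_pos _).le measureReal_nonneg
  have hs : HasSum (fun k => T.incr (n + k) * T.exitMeasure.real (T.C (n + k) ξ))
      (T.gReg n ξ - L) := by
    rw [hasSum_iff_tendsto_nat_of_nonneg hnn]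
    have hsum : ∀ N, ∑ k ∈ Finset.range N, T.incr (n + k) * T.exitMeasure.real (T.C (n + k) ξ) =
        T.gReg n ξ - T.gReg (n + N) ξ := by
      intro N
      induction N with
      | zero => simp
      | succ N ih =>
        rw [Finset.sum_range_succ, ih, ← gReg_sub_succ]
        ring_nf
    simp only [hsum]
    refine tendsto_const_nhds.sub ?_
    have := (tendsto_add_atTop_iff_nat n).2 hL
    simpa only [add_comm] using this
  rw [G, ← hs.tsum_eq, ENNReal.ofReal_tsum_of_nonneg hnn hs.summable]
  refine tsum_congr fun k => ?_
  rw [ENNReal.ofReal_mul (T.incr_pos _).le, ofReal_measureReal]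

theorem exists_tendsto_gReg (ξ : T.Boundary) :
    ∃ L, 0 ≤ L ∧ (∀ n, L ≤ T.gReg n ξ) ∧ Tendsto (fun n => T.gReg n ξ) atTop (𝓝 L) := by
  have hb : BddBelow (range fun n => T.gReg n ξ) :=
    ⟨0, by rintro _ ⟨n, rfl⟩; exact (gReg_pos n ξ).le⟩
  exact ⟨_, le_ciInf fun n => (gReg_pos n ξ).le, fun n => ciInf_le hb n,
    tendsto_atTop_ciInf (gReg_antitone ξ) hb⟩

theorem G_ne_top (n : ℕ) (ξ : T.Boundary) : T.G n ξ ≠ ∞ := by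
  obtain ⟨L, -, -, hL⟩ := exists_tendsto_gReg ξ
  rw [G_eq_of_tendsto hL]
  exact ENNReal.ofReal_ne_top

theorem G_eq_add (n : ℕ) (ξ : T.Boundary) :
    T.G n ξ = ENNReal.ofReal (T.incr n) * T.exitMeasure (T.C n ξ) + T.G (n + 1) ξ := by
  rw [G, tsum_eq_zero_add' ENNReal.summable, G, add_zero]
  congr 1
  refine tsum_congr fun k => ?_
  rw [show n + (k + 1) = n + 1 + k by omega]

theorem G_ne_zero {ξ : T.Boundary} (hξ : ξ ∈ T.accessible) (n : ℕ) : T.G n ξ ≠ 0 := by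
  rw [G_eq_add]
  refine fun h => ?_
  have h1 := (add_eq_zero.1 h).1
  rcases mul_eq_zero.1 h1 with h2 | h2
  · exact (T.incr_pos n).not_ge (ENNReal.ofReal_eq_zero.1 h2)
  · exact (hξ n).ne' h2

theorem tendsto_gReg {ξ : T.Boundary} (hξ : ξ ∈ T.regular) :
    Tendsto (fun n => T.gReg n ξ) atTop (𝓝 0) := by
  rw [T.mem_regular_iff hT.out] at hξ
  rw [← tendsto_add_atTop_iff_nat 1]
  simp only [gReg_succ]
  simpa using hξ.const_mul T.alpha

theorem G_eq_gReg {ξ : T.Boundary} (hξ : ξ ∈ T.regular) (n : ℕ) :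
    T.G n ξ = ENNReal.ofReal (T.gReg n ξ) := by
  rw [G_eq_of_tendsto (tendsto_gReg hξ), sub_zero]

/-- If C^n(ξ) has mass zero, then `gReg` is constant along ξ from level n on, and this constant is
positive. -/
theorem regular_subset_accessible : T.regular ⊆ T.accessible := by
  intro ξ hξ n
  rw [pos_iff_ne_zero]
  intro h0
  have hconst : ∀ m, n ≤ m → T.gReg m ξ = T.gReg n ξ := by
    intro m hm
    induction m, hm using Nat.le_induction with
    | base => rfl
    | succ m hm ih =>
      have h1 := gReg_sub_succ m ξ
      rw [measureReal_def, measure_mono_null (C_anti hm ξ) h0] at h1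
      simp at h1
      linarith
  have := tendsto_nhds_unique (tendsto_gReg hξ)
    (tendsto_const_nhds.congr' (by
      filter_upwards [eventually_ge_atTop n] with m hm
      exact (hconst m hm).symm))
  exact (gReg_pos n ξ).ne this

theorem measure_C_ne_zero {ξ : T.Boundary} (hξ : ξ ∈ T.regular) (n : ℕ) :
    T.exitMeasure (T.C n ξ) ≠ 0 := (regular_subset_accessible hξ n).ne'

theorem measureReal_C_pos {ξ : T.Boundary} (hξ : ξ ∈ T.regular) (n : ℕ) :
    0 < T.exitMeasure.real (T.C n ξ) :=
  ENNReal.toReal_pos (measure_C_ne_zero hξ n) (measure_ne_top _ _)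

theorem ae_regular : ∀ᵐ ξ ∂T.exitMeasure, ξ ∈ T.regular := T.ae_mem_regular hT.out

end

section

variable {I : Type*} {T : TreeMatrix I}

/-! ### Hierarchical kernels -/

/-- The kernel `∑_{n ≤ |ξ ∧ η|} A_n(ξ)`. -/
def ker (A : ℕ → T.Boundary → ℝ≥0∞) (ξ η : T.Boundary) : ℝ≥0∞ :=
  ∑' n, (T.C n ξ).indicator (fun _ => A n ξ) η

/-- The part `∑_{M ≤ n ≤ |ξ ∧ η|} A_n(ξ)` of a hierarchical kernel. -/
def kerTail (A : ℕ → T.Boundary → ℝ≥0∞) (M : ℕ) (ξ η : T.Boundary) : ℝ≥0∞ :=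
  ∑' n, (T.C (n + M) ξ).indicator (fun _ => A (n + M) ξ) η

theorem kerTail_zero (A : ℕ → T.Boundary → ℝ≥0∞) (ξ η : T.Boundary) :
    kerTail A 0 ξ η = ker A ξ η := rfl

theorem ker_eq_sum_add_kerTail (A : ℕ → T.Boundary → ℝ≥0∞) (M : ℕ) (ξ η : T.Boundary) :
    ker A ξ η = ∑ n ∈ Finset.range M, (T.C n ξ).indicator (fun _ => A n ξ) η +
      kerTail A M ξ η :=
  (ENNReal.summable.sum_add_tsum_nat_add' (k := M)).symm

theorem natCast_le_meetLevel_iff {n : ℕ} {ξ η : T.Boundary} :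
    (n : ℕ∞) ≤ meetLevel ξ η ↔ η ∈ T.C n ξ := by
  rw [mem_C_iff]
  constructor
  · intro h
    cases n with
    | zero => rw [ξ.at_zero, η.at_zero]
    | succ n =>
      have h1 : (n : ℕ∞) < meetLevel ξ η :=
        lt_of_lt_of_le (by exact_mod_cast n.lt_succ_self) h
      obtain ⟨⟨m, hm⟩, hlt⟩ := lt_iSup_iff.1 h1
      have : n < m := by exact_mod_cast hlt
      exact Boundary.at_eq_of_le this hm
  · intro h
    exact le_iSup (fun n : {n : ℕ // ξ.at n = η.at n} => (n.1 : ℕ∞)) ⟨n, h⟩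

/-- The coefficients of the kernel `p`. -/
def pCoeff (t : ℝ) (n : ℕ) (ξ : T.Boundary) : ℝ≥0∞ :=
  ENNReal.ofReal (expDecay t (T.G n ξ) - expDecay t (T.G (n + 1) ξ)) / T.exitMeasure (T.C n ξ)

/-- The coefficients of the kernel `U`. -/
def uCoeff (n : ℕ) (_ : T.Boundary) : ℝ≥0∞ := ENNReal.ofReal (T.incr n)

theorem p_eq_ker (t : ℝ) (ξ η : T.Boundary) : T.p t ξ η = ker (pCoeff t) ξ η := by
  classical
  refine tsum_congr fun n => ?_
  simp only [natCast_le_meetLevel_iff, indicator, pCoeff]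

theorem sum_incr (n : ℕ) : ∑ k ∈ Finset.range (n + 1), T.incr k = T.w n := by
  induction n with
  | zero => simp [incr]
  | succ n ih =>
    rw [Finset.sum_range_succ, ih, incr]
    ring

theorem sum_uCoeff (n : ℕ) (ξ : T.Boundary) :
    ∑ k ∈ Finset.range (n + 1), uCoeff k ξ = ENNReal.ofReal (T.w n) := by
  simp only [uCoeff]
  rw [← sum_incr, ENNReal.ofReal_sum_of_nonneg fun k _ => (T.incr_pos k).le]

/-- Here w_n is the sum of Δ_0, …, Δ_n. On the diagonal no level is cut off, and the full series is
the limit of w. -/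
theorem U_eq_ker (ξ η : T.Boundary) : T.U ξ η = ker uCoeff ξ η := by
  rw [U, ker]
  split_ifs with h
  · subst h
    have h1 : ∀ n, (T.C n ξ).indicator (fun _ => uCoeff n ξ) ξ = uCoeff n ξ := fun n =>
      indicator_of_mem (mem_C_self n ξ) _
    simp only [h1]
    rw [ENNReal.tsum_eq_iSup_nat]
    refine le_antisymm (iSup_le fun n => ?_) (iSup_le fun n => ?_)
    · exact le_iSup_of_le (n + 1) (sum_uCoeff n ξ).ge
    · refine le_iSup_of_le n ?_
      rw [← sum_uCoeff n ξ]
      exact Finset.sum_le_sum_of_subset (Finset.range_subset_range.2 n.le_succ)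
  · obtain ⟨k, hk⟩ : ∃ k, ξ.at k ≠ η.at k := by
      by_contra hcon
      push Not at hcon
      exact h (Boundary.ext hcon)
    have hne : meetLevel ξ η ≠ ⊤ := by
      intro htop
      exact hk (mem_C_iff.1 (natCast_le_meetLevel_iff.1 (htop ▸ le_top)))
    obtain ⟨N, hN⟩ := ENat.ne_top_iff_exists.1 hne
    have hmem : ∀ n, η ∈ T.C n ξ ↔ n < N + 1 := by
      intro n
      rw [← natCast_le_meetLevel_iff, ← hN, Nat.lt_succ_iff]
      exact_mod_cast Iff.rfl
    rw [← hN, ENat.toNat_natCast, ← sum_uCoeff N ξ]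
    rw [tsum_eq_sum (s := Finset.range (N + 1))]
    · refine Finset.sum_congr rfl fun n hn => ?_
      rw [indicator_of_mem ((hmem n).2 (Finset.mem_range.1 hn))]
    · intro n hn
      rw [indicator_of_notMem fun hm => hn (Finset.mem_range.2 ((hmem n).1 hm))]

variable [Countable I]

theorem measurableSet_mem_C (n : ℕ) :
    MeasurableSet {q : T.Boundary × T.Boundary | q.2 ∈ T.C n q.1} := by
  have : {q : T.Boundary × T.Boundary | q.2 ∈ T.C n q.1} =
      ⋃ i, {q | q.1.at n = i} ∩ {q | q.2.at n = i} := by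
    ext q
    simp [mem_C_iff, eq_comm]
  let _ : MeasurableSpace I := ⊤
  rw [this]
  refine MeasurableSet.iUnion fun i => MeasurableSet.inter ?_ ?_
  · exact ((T.measurable_at n).comp measurable_fst) (measurableSet_singleton i)
  · exact ((T.measurable_at n).comp measurable_snd) (measurableSet_singleton i)

/-- The parameter will be the time, so that Tonelli applies jointly to t, ξ and η. -/
theorem measurable_ker_param {Θ : Type*} [MeasurableSpace Θ] {A : Θ → ℕ → T.Boundary → ℝ≥0∞}
    (hA : ∀ n, Measurable fun q : Θ × T.Boundary => A q.1 n q.2) :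
    Measurable fun q : Θ × (T.Boundary × T.Boundary) => ker (A q.1) q.2.1 q.2.2 := by
  refine Measurable.tsum fun n => ?_
  have : (fun q : Θ × (T.Boundary × T.Boundary) =>
      (T.C n q.2.1).indicator (fun _ => A q.1 n q.2.1) q.2.2) =
      {q : Θ × (T.Boundary × T.Boundary) | q.2.2 ∈ T.C n q.2.1}.indicator
        (fun q => A q.1 n q.2.1) := by
    ext q
    simp [indicator]
  rw [this]
  exact ((hA n).comp (by fun_prop : Measurable fun q : Θ × (T.Boundary × T.Boundary) =>
    (q.1, q.2.1))).indicator (measurable_snd (measurableSet_mem_C n))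

theorem measurable_ker {A : ℕ → T.Boundary → ℝ≥0∞} (hA : ∀ n, Measurable (A n)) :
    Measurable fun q : T.Boundary × T.Boundary => ker A q.1 q.2 :=
  (measurable_ker_param (Θ := Unit) (A := fun _ => A) fun n => (hA n).comp measurable_snd).comp
    (measurable_const.prodMk measurable_id : Measurable fun q : T.Boundary × T.Boundary => ((), q))

theorem measurable_expDecay : Measurable fun q : ℝ × ℝ≥0∞ => expDecay q.1 q.2 := by
  refine Measurable.ite (measurable_snd (measurableSet_singleton 0)) measurable_const ?_
  fun_prop

theorem measurable_pCoeff_param (n : ℕ) :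
    Measurable fun q : ℝ × T.Boundary => pCoeff q.1 n q.2 := by
  have h : ∀ n, Measurable fun q : ℝ × T.Boundary => expDecay q.1 (T.G n q.2) := fun n =>
    measurable_expDecay.comp (measurable_fst.prodMk ((measurable_G n).comp measurable_snd))
  exact ((h n).sub (h (n + 1))).ennreal_ofReal.div ((measurable_measure_C n).comp measurable_snd)

theorem measurable_pCoeff (t : ℝ) (n : ℕ) : Measurable (pCoeff (T := T) t n) := by
  have h : ∀ n, Measurable fun ξ : T.Boundary => expDecay t (T.G n ξ) := fun n =>
    measurable_expDecay.comp (measurable_const.prodMk (measurable_G n))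
  exact ((h n).sub (h (n + 1))).ennreal_ofReal.div (measurable_measure_C n)

theorem measurable_p_param :
    Measurable fun q : ℝ × (T.Boundary × T.Boundary) => T.p q.1 q.2.1 q.2.2 := by
  simp only [p_eq_ker]
  exact measurable_ker_param measurable_pCoeff_param

theorem measurable_p (t : ℝ) : Measurable fun q : T.Boundary × T.Boundary => T.p t q.1 q.2 := by
  simp only [p_eq_ker]
  exact measurable_ker (measurable_pCoeff t)

theorem measurable_kerTail_right (A : ℕ → T.Boundary → ℝ≥0∞) (M : ℕ) (ξ : T.Boundary) :
    Measurable (kerTail A M ξ) :=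
  Measurable.tsum fun n => measurable_const.indicator (T.measurableSet_C (n + M) ξ)

theorem measurable_ker_right (A : ℕ → T.Boundary → ℝ≥0∞) (ξ : T.Boundary) :
    Measurable (ker A ξ) := measurable_kerTail_right A 0 ξ

theorem lintegral_kerTail_mul (A : ℕ → T.Boundary → ℝ≥0∞) (M : ℕ) (ξ : T.Boundary)
    {f : T.Boundary → ℝ≥0∞} (hf : Measurable f) :
    ∫⁻ η, kerTail A M ξ η * f η ∂T.exitMeasure =
      ∑' n, A (n + M) ξ * ∫⁻ η in T.C (n + M) ξ, f η ∂T.exitMeasure := by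
  simp only [kerTail, ← ENNReal.tsum_mul_right]
  rw [lintegral_tsum]
  · refine tsum_congr fun n => ?_
    rw [← lintegral_const_mul _ hf, ← lintegral_indicator (T.measurableSet_C _ _)]
    refine lintegral_congr fun η => ?_
    by_cases h : η ∈ T.C (n + M) ξ <;> simp [h]
  · intro n
    exact ((measurable_const.indicator (T.measurableSet_C _ _)).mul hf).aemeasurable

theorem lintegral_kerTail (A : ℕ → T.Boundary → ℝ≥0∞) (M : ℕ) (ξ : T.Boundary) :
    ∫⁻ η, kerTail A M ξ η ∂T.exitMeasure =
      ∑' n, A (n + M) ξ * T.exitMeasure (T.C (n + M) ξ) := by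
  simpa using lintegral_kerTail_mul A M ξ (f := fun _ => 1) measurable_const

variable [hT : T.IsTransient]

/-- The coefficients `A` of a hierarchical kernel, with the total masses `e_M` of its tails: on the
regular points, these depend on the first sites of the geodesic only. -/
structure IsCoeff (A : ℕ → T.Boundary → ℝ≥0∞) (e : ℕ → T.Boundary → ℝ) : Prop where
  measurable : ∀ n, Measurable (A n)
  congr : ∀ ξ ∈ T.regular, ∀ η ∈ T.regular, ∀ n, ξ.at n = η.at n → A n ξ = A n η
  tail : ∀ ξ ∈ T.regular, ∀ M,
    ∑' n, A (n + M) ξ * T.exitMeasure (T.C (n + M) ξ) = ENNReal.ofReal (e M ξ)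
  nonneg : ∀ M ξ, 0 ≤ e M ξ
  tail_congr : ∀ ξ η M, ξ.at M = η.at M → e M ξ = e M η

section IsCoeff

variable {A : ℕ → T.Boundary → ℝ≥0∞} {e : ℕ → T.Boundary → ℝ}

theorem ker_symm (hA : IsCoeff A e) {ξ η : T.Boundary} (hξ : ξ ∈ T.regular) (hη : η ∈ T.regular) :
    ker A ξ η = ker A η ξ := by
  refine tsum_congr fun n => ?_
  by_cases h : ξ.at n = η.at n
  · rw [indicator_of_mem (mem_C_iff.2 h), indicator_of_mem (mem_C_iff.2 h.symm),
      hA.congr ξ hξ η hη n h]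
  · rw [indicator_of_notMem (fun h' => h (mem_C_iff.1 h')),
      indicator_of_notMem (fun h' => h (mem_C_iff.1 h').symm)]

theorem IsCoeff.lintegral_kerTail (hA : IsCoeff A e) {ξ : T.Boundary} (hξ : ξ ∈ T.regular)
    (M : ℕ) : ∫⁻ η, kerTail A M ξ η ∂T.exitMeasure = ENNReal.ofReal (e M ξ) := by
  rw [TreeMatrix.lintegral_kerTail, hA.tail ξ hξ]

theorem IsCoeff.lintegral_ker (hA : IsCoeff A e) {ξ : T.Boundary} (hξ : ξ ∈ T.regular) :
    ∫⁻ η, ker A ξ η ∂T.exitMeasure = ENNReal.ofReal (e 0 ξ) := hA.lintegral_kerTail hξ 0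

theorem IsCoeff.ae_kerTail_lt_top (hA : IsCoeff A e) {ξ : T.Boundary} (hξ : ξ ∈ T.regular)
    (M : ℕ) : ∀ᵐ η ∂T.exitMeasure, kerTail A M ξ η < ∞ :=
  ae_lt_top (measurable_kerTail_right A M ξ)
    (by rw [hA.lintegral_kerTail hξ]; exact ENNReal.ofReal_ne_top)

theorem IsCoeff.integrable_kerTail (hA : IsCoeff A e) {ξ : T.Boundary} (hξ : ξ ∈ T.regular)
    (M : ℕ) : Integrable (fun η => (kerTail A M ξ η).toReal) T.exitMeasure :=
  integrable_toReal_of_lintegral_ne_top (measurable_kerTail_right A M ξ).aemeasurable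
    (by rw [hA.lintegral_kerTail hξ]; exact ENNReal.ofReal_ne_top)

theorem IsCoeff.integral_kerTail (hA : IsCoeff A e) {ξ : T.Boundary} (hξ : ξ ∈ T.regular)
    (M : ℕ) : ∫ η, (kerTail A M ξ η).toReal ∂T.exitMeasure = e M ξ := by
  rw [integral_toReal (measurable_kerTail_right A M ξ).aemeasurable (hA.ae_kerTail_lt_top hξ M),
    hA.lintegral_kerTail hξ, ENNReal.toReal_ofReal (hA.nonneg M ξ)]

theorem IsCoeff.ne_top (hA : IsCoeff A e) {ξ : T.Boundary} (hξ : ξ ∈ T.regular) (n : ℕ) :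
    A n ξ ≠ ∞ := by
  intro h
  have h1 := hA.tail ξ hξ n
  have h2 : A (0 + n) ξ * T.exitMeasure (T.C (0 + n) ξ) ≤ ENNReal.ofReal (e n ξ) :=
    h1 ▸ ENNReal.le_tsum 0
  rw [zero_add, h, ENNReal.top_mul (measure_C_ne_zero hξ n)] at h2
  exact ENNReal.ofReal_ne_top (top_le_iff.1 h2)

/-- The difference of two consecutive tail masses is what makes sums against the coefficients
telescope. -/
theorem IsCoeff.toReal_mul_measureReal (hA : IsCoeff A e) {ξ : T.Boundary} (hξ : ξ ∈ T.regular)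
    (n : ℕ) : (A n ξ).toReal * T.exitMeasure.real (T.C n ξ) = e n ξ - e (n + 1) ξ := by
  have h1 := hA.tail ξ hξ n
  have h2 := hA.tail ξ hξ (n + 1)
  rw [tsum_eq_zero_add' ENNReal.summable, zero_add] at h1
  simp only [show ∀ k, k + 1 + n = k + (n + 1) by intro k; omega] at h1
  rw [h2] at h1
  have h3 := congrArg ENNReal.toReal h1
  rw [ENNReal.toReal_add (ENNReal.mul_ne_top (hA.ne_top hξ n) (measure_ne_top _ _))
    ENNReal.ofReal_ne_top, ENNReal.toReal_mul, ENNReal.toReal_ofReal (hA.nonneg _ _),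
    ENNReal.toReal_ofReal (hA.nonneg _ _)] at h3
  rw [measureReal_def]
  linarith

/-- The levels below M see f only through its integrals over the sets C^n(ξ). The remaining tail is
concentrated on C^M(ξ) and has mass e_M. -/
theorem IsCoeff.integral_ker_mul (hA : IsCoeff A e) {ξ : T.Boundary} (hξ : ξ ∈ T.regular) (M : ℕ)
    {f : T.Boundary → ℝ} (hf : Integrable f T.exitMeasure)
    (htf : Integrable (fun η => (kerTail A M ξ η).toReal * f η) T.exitMeasure) :
    ∫ η, (ker A ξ η).toReal * f η ∂T.exitMeasure =
      ∑ n ∈ Finset.range M, (A n ξ).toReal * ∫ η in T.C n ξ, f η ∂T.exitMeasure +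
        ∫ η, (kerTail A M ξ η).toReal * f η ∂T.exitMeasure := by
  have hint : ∀ n, Integrable ((T.C n ξ).indicator fun η => (A n ξ).toReal * f η)
      T.exitMeasure := fun n => (hf.const_mul _).indicator (T.measurableSet_C n ξ)
  have h : (fun η => (ker A ξ η).toReal * f η) =ᵐ[T.exitMeasure] fun η =>
      ∑ n ∈ Finset.range M, (T.C n ξ).indicator (fun η => (A n ξ).toReal * f η) η +
        (kerTail A M ξ η).toReal * f η := by
    filter_upwards [hA.ae_kerTail_lt_top hξ M] with η hη
    have hfin : ∀ n ∈ Finset.range M, (T.C n ξ).indicator (fun _ => A n ξ) η ≠ ∞ := by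
      intro n _
      rw [indicator]
      split_ifs
      · exact hA.ne_top hξ n
      · simp
    rw [ker_eq_sum_add_kerTail A M, ENNReal.toReal_add (ENNReal.sum_ne_top.2 hfin) hη.ne,
      ENNReal.toReal_sum hfin, add_mul, Finset.sum_mul]
    congr 1
    refine Finset.sum_congr rfl fun n _ => ?_
    by_cases hn : η ∈ T.C n ξ <;> simp [hn]
  rw [integral_congr_ae h, integral_add (integrable_finsetSum _ fun n _ => hint n) htf,
    integral_finsetSum _ fun n _ => hint n]
  congr 1
  refine Finset.sum_congr rfl fun n _ => ?_
  rw [integral_indicator (T.measurableSet_C n ξ), integral_const_mul]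

/-- The value of the kernel on a function which is constant on `C^M(ξ)`. -/
theorem IsCoeff.integral_ker_mul_of_level (hA : IsCoeff A e) {ξ : T.Boundary}
    (hξ : ξ ∈ T.regular) {M : ℕ} {f : T.Boundary → ℝ} (hf : Integrable f T.exitMeasure)
    (hfM : ∀ η ∈ T.C M ξ, f η = f ξ) :
    ∫ η, (ker A ξ η).toReal * f η ∂T.exitMeasure =
      ∑ n ∈ Finset.range M, (A n ξ).toReal * ∫ η in T.C n ξ, f η ∂T.exitMeasure +
        e M ξ * f ξ := by
  have h : (fun η => (kerTail A M ξ η).toReal * f η) =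
      fun η => (kerTail A M ξ η).toReal * f ξ := by
    ext η
    by_cases hη : η ∈ T.C M ξ
    · rw [hfM η hη]
    · have : kerTail A M ξ η = 0 := by
        refine ENNReal.tsum_eq_zero.2 fun n => ?_
        rw [indicator_of_notMem fun h' => hη (C_anti (Nat.le_add_left M n) ξ h')]
      rw [this, ENNReal.toReal_zero, zero_mul, zero_mul]
  have hint := (hA.integrable_kerTail hξ M).mul_const (f ξ)
  rw [hA.integral_ker_mul hξ M hf (by rw [h]; exact hint), h, integral_mul_const,
    hA.integral_kerTail hξ]

end IsCoeff

/-! ### The kernels `p` and `U` on the regular points -/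

theorem expDecay_G {ξ : T.Boundary} (hξ : ξ ∈ T.regular) (t : ℝ) (n : ℕ) :
    expDecay t (T.G n ξ) = Real.exp (-t / T.gReg n ξ) := by
  have hpos := gReg_pos n ξ
  rw [expDecay, if_neg (G_ne_zero (regular_subset_accessible hξ) n), G_eq_gReg hξ,
    ENNReal.toReal_ofReal hpos.le]

theorem exp_gReg_antitone {t : ℝ} (ht : 0 ≤ t) (ξ : T.Boundary) :
    Antitone fun n => Real.exp (-t / T.gReg n ξ) := by
  intro n m h
  refine Real.exp_le_exp.2 ?_
  rw [neg_div, neg_div, neg_le_neg_iff]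
  exact div_le_div_of_nonneg_left ht (gReg_pos m ξ) (gReg_antitone ξ h)

theorem tendsto_exp_gReg {t : ℝ} (ht : 0 < t) {ξ : T.Boundary} (hξ : ξ ∈ T.regular) :
    Tendsto (fun n => Real.exp (-t / T.gReg n ξ)) atTop (𝓝 0) := by
  refine Real.tendsto_exp_atBot.comp ?_
  have h1 : Tendsto (fun n => (T.gReg n ξ)⁻¹) atTop atTop :=
    tendsto_inv_nhdsGT_zero.comp (tendsto_nhdsWithin_iff.2
      ⟨tendsto_gReg hξ, Eventually.of_forall fun n => gReg_pos n ξ⟩)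
  simp only [div_eq_mul_inv]
  exact h1.const_mul_atTop_of_neg (neg_lt_zero.2 ht)

theorem pCoeff_mul_measure (t : ℝ) {ξ : T.Boundary} (hξ : ξ ∈ T.regular) (n : ℕ) :
    pCoeff t n ξ * T.exitMeasure (T.C n ξ) =
      ENNReal.ofReal (Real.exp (-t / T.gReg n ξ) - Real.exp (-t / T.gReg (n + 1) ξ)) := by
  rw [pCoeff, ENNReal.div_mul_cancel (measure_C_ne_zero hξ n) (measure_ne_top _ _),
    expDecay_G hξ, expDecay_G hξ]

/-- The tail masses telescope to e^{-t/G_M}, because e^{-t/G_n} tends to 0. This is where regularity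
and t > 0 are needed. -/
theorem isCoeff_p {t : ℝ} (ht : 0 < t) :
    IsCoeff (T := T) (pCoeff t) fun M ξ => Real.exp (-t / T.gReg M ξ) where
  measurable := measurable_pCoeff t
  congr ξ hξ η hη n h := by
    simp only [pCoeff]
    rw [expDecay_G hξ, expDecay_G hξ, expDecay_G hη, expDecay_G hη, gReg_congr h,
      gReg_succ_congr h, C_eq_C h]
  tail ξ hξ M := by
    simp only [pCoeff_mul_measure t hξ]
    have hnn : ∀ n, 0 ≤ Real.exp (-t / T.gReg (n + M) ξ) -
        Real.exp (-t / T.gReg (n + M + 1) ξ) := fun n =>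
      sub_nonneg.2 (exp_gReg_antitone ht.le ξ (Nat.le_succ _))
    have hs : HasSum (fun n => Real.exp (-t / T.gReg (n + M) ξ) -
        Real.exp (-t / T.gReg (n + M + 1) ξ)) (Real.exp (-t / T.gReg M ξ)) := by
      rw [hasSum_iff_tendsto_nat_of_nonneg hnn]
      have hsum : ∀ N, ∑ n ∈ Finset.range N, (Real.exp (-t / T.gReg (n + M) ξ) -
          Real.exp (-t / T.gReg (n + M + 1) ξ)) =
          Real.exp (-t / T.gReg M ξ) - Real.exp (-t / T.gReg (N + M) ξ) := by
        intro N
        induction N with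
        | zero => simp
        | succ N ih =>
          rw [Finset.sum_range_succ, ih]
          ring_nf
      simp only [hsum]
      have := (tendsto_add_atTop_iff_nat M).2 (tendsto_exp_gReg ht hξ)
      simpa using this.const_sub (Real.exp (-t / T.gReg M ξ))
    rw [← hs.tsum_eq, ENNReal.ofReal_tsum_of_nonneg hnn hs.summable]
  nonneg M ξ := (Real.exp_pos _).le
  tail_congr ξ η M h := by rw [gReg_congr h]

theorem isCoeff_U : IsCoeff (T := T) uCoeff T.gReg where
  measurable n := measurable_const
  congr ξ _ η _ n _ := rfl
  tail ξ hξ M := by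
    rw [← G_eq_gReg hξ, G]
    refine tsum_congr fun n => ?_
    rw [uCoeff, add_comm n M]
  nonneg M ξ := (gReg_pos M ξ).le
  tail_congr ξ η M h := gReg_congr h

theorem p_symm {t : ℝ} (ht : 0 < t) {ξ η : T.Boundary} (hξ : ξ ∈ T.regular)
    (hη : η ∈ T.regular) : T.p t ξ η = T.p t η ξ := by
  rw [p_eq_ker, p_eq_ker, ker_symm (isCoeff_p ht) hξ hη]

theorem lintegral_p {t : ℝ} (ht : 0 < t) {ξ : T.Boundary} (hξ : ξ ∈ T.regular) :
    ∫⁻ η, T.p t ξ η ∂T.exitMeasure = ENNReal.ofReal (Real.exp (-t / T.alpha)) := by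
  simp only [p_eq_ker]
  rw [(isCoeff_p ht).lintegral_ker hξ, gReg_zero]

theorem tsum_ite_le (n : ℕ) (y : ℕ → ℝ≥0∞) :
    ∑' m, (if n ≤ m then y m else 0) = ∑' k, y (k + n) := by
  rw [← ENNReal.summable.sum_add_tsum_nat_add' (k := n), Finset.sum_eq_zero, zero_add]
  · exact tsum_congr fun k => if_pos (Nat.le_add_left n k)
  · intro m hm
    exact if_neg (by simpa using hm)

open scoped Classical in
theorem measure_C_inter {n m : ℕ} (h : n ≤ m) (ξ η : T.Boundary) :
    T.exitMeasure (T.C n ξ ∩ T.C m η) =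
      if η ∈ T.C n ξ then T.exitMeasure (T.C m η) else 0 := by
  split_ifs with hn
  · congr 1
    refine inter_eq_self_of_subset_right fun z hz => ?_
    rw [C_eq_C (mem_C_iff.1 hn)]
    exact C_anti h η hz
  · convert measure_empty (μ := T.exitMeasure) using 2
    rw [eq_empty_iff_forall_notMem]
    rintro z ⟨h1, h2⟩
    have h3 : η.at n = z.at n := C_anti h η h2
    exact hn (mem_C_iff.2 ((mem_C_iff.1 h1).trans h3.symm))

/-- The composition of two hierarchical kernels. -/
theorem lintegral_ker_mul_ker {A B : ℕ → T.Boundary → ℝ≥0∞} {d e : ℕ → T.Boundary → ℝ}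
    (hA : IsCoeff A d) (hB : IsCoeff B e) {ξ η : T.Boundary} (hξ : ξ ∈ T.regular)
    (hη : η ∈ T.regular) :
    ∫⁻ z, ker A ξ z * ker B z η ∂T.exitMeasure =
      ∑' n, (T.C n ξ).indicator (fun _ => A n ξ * ENNReal.ofReal (e n ξ) +
        B n ξ * ENNReal.ofReal (d (n + 1) ξ)) η := by
  classical
  -- By symmetry B is expanded around the fixed point η instead of the integration variable.
  have h1 : ∫⁻ z, ker A ξ z * ker B z η ∂T.exitMeasure =
      ∫⁻ z, ker A ξ z * ker B η z ∂T.exitMeasure := by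
    refine lintegral_congr_ae ?_
    filter_upwards [ae_regular] with z hz
    rw [ker_symm hB hz hη]
  have h2 : ∀ n, ∫⁻ z in T.C n ξ, ker B η z ∂T.exitMeasure =
      ∑' m, B m η * T.exitMeasure (T.C n ξ ∩ T.C m η) := by
    intro n
    have := lintegral_kerTail_mul B 0 η (f := (T.C n ξ).indicator fun _ => 1)
      (measurable_const.indicator (T.measurableSet_C n ξ))
    simp only [add_zero, kerTail_zero] at this
    rw [← lintegral_indicator (T.measurableSet_C n ξ)]
    convert this using 1
    · refine lintegral_congr fun z => ?_
      by_cases hz : z ∈ T.C n ξ <;> simp [hz]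
    · refine tsum_congr fun m => ?_
      rw [lintegral_indicator (T.measurableSet_C n ξ), setLIntegral_const, one_mul,
        Measure.restrict_apply (T.measurableSet_C n ξ)]
  have h3 := lintegral_kerTail_mul A 0 ξ (measurable_ker_right B η)
  simp only [add_zero, kerTail_zero] at h3
  rw [h1, h3]
  simp only [h2, ← ENNReal.tsum_mul_left]
  set x : ℕ → ℕ → ℝ≥0∞ := fun n m => A n ξ * (B m η * T.exitMeasure (T.C n ξ ∩ T.C m η)) with hx
  -- The sets C^n(ξ) and C^m(η) are nested or disjoint. For n ≤ m the sum over m gives the tail mass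
  -- of B from n on; for m < n the sum over n gives that of A from m + 1 on. The diagonal is counted
  -- in the first sum only.
  have hsplit : ∀ n m, x n m = (if n ≤ m then x n m else 0) + (if m + 1 ≤ n then x n m else 0) := by
    intro n m
    by_cases h : n ≤ m
    · rw [if_pos h, if_neg (by omega), add_zero]
    · rw [if_neg h, if_pos (by omega), zero_add]
  have hsum : ∑' n, ∑' m, x n m = ∑' n, ∑' m, (if n ≤ m then x n m else 0) +
      ∑' m, ∑' n, (if m + 1 ≤ n then x n m else 0) := by
    rw [ENNReal.tsum_comm (f := fun m n => if m + 1 ≤ n then x n m else 0), ← ENNReal.tsum_add]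
    refine tsum_congr fun n => ?_
    rw [← ENNReal.tsum_add]
    exact tsum_congr fun m => hsplit n m
  rw [hsum, ← ENNReal.tsum_add]
  refine tsum_congr fun n => ?_
  rw [tsum_ite_le n fun m => x n m, tsum_ite_le (n + 1) fun k => x k n]
  have e1 : ∀ k, x n (k + n) = (T.C n ξ).indicator (fun _ => A n ξ *
      (B (k + n) η * T.exitMeasure (T.C (k + n) η))) η := by
    intro k
    simp only [hx, measure_C_inter (Nat.le_add_left n k) ξ η, indicator]
    split_ifs <;> simp
  have e2 : ∀ k, x (k + (n + 1)) n = (T.C n ξ).indicator (fun _ => B n η *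
      (A (k + (n + 1)) ξ * T.exitMeasure (T.C (k + (n + 1)) ξ))) η := by
    intro k
    simp only [hx]
    rw [inter_comm, measure_C_inter (by omega : n ≤ k + (n + 1)) η ξ, indicator]
    have : ξ ∈ T.C n η ↔ η ∈ T.C n ξ := eq_comm
    simp only [this]
    split_ifs
    · ring
    · simp
  simp only [e1, e2]
  by_cases h : η ∈ T.C n ξ
  · simp only [indicator_of_mem h, ENNReal.tsum_mul_left]
    rw [hB.tail η hη, hA.tail ξ hξ, hB.congr η hη ξ hξ n (mem_C_iff.1 h).symm,
      hB.tail_congr η ξ n (mem_C_iff.1 h).symm]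
  · simp [indicator_of_notMem h]

/-- With a, b and c, d the exponentials at G_n and G_{n+1} for the times s and t, the composed
coefficient is (a - b)c + (c - d)b = ac - bd, divided by μ(C^n). -/
theorem chapman_kolmogorov {s t : ℝ} (hs : 0 < s) (ht : 0 < t) {ξ η : T.Boundary}
    (hξ : ξ ∈ T.regular) (hη : η ∈ T.regular) :
    T.p (s + t) ξ η = ∫⁻ z, T.p s ξ z * T.p t z η ∂T.exitMeasure := by
  simp only [p_eq_ker]
  rw [lintegral_ker_mul_ker (isCoeff_p hs) (isCoeff_p ht) hξ hη, ker]
  refine tsum_congr fun n => ?_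
  congr 1
  ext
  simp only [pCoeff]
  rw [expDecay_G hξ, expDecay_G hξ, expDecay_G hξ, expDecay_G hξ, expDecay_G hξ, expDecay_G hξ,
    ENNReal.div_eq_inv_mul, ENNReal.div_eq_inv_mul, ENNReal.div_eq_inv_mul, mul_assoc, mul_assoc,
    ← mul_add, ← ENNReal.ofReal_mul (sub_nonneg.2 (exp_gReg_antitone hs.le ξ n.le_succ)),
    ← ENNReal.ofReal_mul (sub_nonneg.2 (exp_gReg_antitone ht.le ξ n.le_succ)),
    ← ENNReal.ofReal_add]
  · have hadd : ∀ m, Real.exp (-(s + t) / T.gReg m ξ) =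
        Real.exp (-s / T.gReg m ξ) * Real.exp (-t / T.gReg m ξ) := by
      intro m
      rw [← Real.exp_add]
      ring_nf
    rw [hadd, hadd]
    congr 2
    ring
  · exact mul_nonneg (sub_nonneg.2 (exp_gReg_antitone hs.le ξ n.le_succ)) (Real.exp_pos _).le
  · exact mul_nonneg (sub_nonneg.2 (exp_gReg_antitone ht.le ξ n.le_succ)) (Real.exp_pos _).le

end

section

variable {I : Type*} {T : TreeMatrix I} [Countable I] [hT : T.IsTransient]

/-! ### The Green kernel -/

theorem lintegral_exp_sub {a b : ℝ} (ha : 0 < a) (hab : a ≤ b) :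
    ∫⁻ t in Ioi (0 : ℝ), ENNReal.ofReal (Real.exp (-t / b) - Real.exp (-t / a)) =
      ENNReal.ofReal (b - a) := by
  have hexp : ∀ c : ℝ, 0 < c → IntegrableOn (fun t : ℝ => Real.exp (-t / c)) (Ioi 0) ∧
      ∫ t in Ioi (0 : ℝ), Real.exp (-t / c) = c := by
    intro c hc
    have hc' : -c⁻¹ < 0 := neg_lt_zero.2 (inv_pos.2 hc)
    have he : (fun t : ℝ => Real.exp (-t / c)) = fun t => Real.exp (-c⁻¹ * t) := by
      ext t
      congr 1
      ring
    rw [he]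
    refine ⟨integrableOn_exp_mul_Ioi hc' 0, ?_⟩
    rw [integral_exp_mul_Ioi hc' 0]
    simp
  obtain ⟨ia, va⟩ := hexp a ha
  obtain ⟨ib, vb⟩ := hexp b (ha.trans_le hab)
  have hi : IntegrableOn (fun t : ℝ => Real.exp (-t / b) - Real.exp (-t / a)) (Ioi 0) := ib.sub ia
  rw [← ofReal_integral_eq_lintegral_ofReal hi, integral_sub ib ia, va, vb]
  refine (ae_restrict_iff' measurableSet_Ioi).2 (Eventually.of_forall fun t ht => ?_)
  refine sub_nonneg.2 (Real.exp_le_exp.2 ?_)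
  rw [neg_div, neg_div, neg_le_neg_iff]
  exact div_le_div_of_nonneg_left (le_of_lt ht) ha hab

/-- Only G_n - G_{n+1} = Δ_n μ(C^n) and the positivity of the G_n are used, so accessibility
suffices. -/
theorem lintegral_pCoeff {ξ : T.Boundary} (hξ : ξ ∈ T.accessible) (n : ℕ) :
    ∫⁻ t in Ioi (0 : ℝ), pCoeff t n ξ = uCoeff n ξ := by
  have h0 : T.exitMeasure (T.C n ξ) ≠ 0 := (hξ n).ne'
  have hG := G_eq_add n ξ
  have h1 := ENNReal.toReal_pos (G_ne_zero hξ (n + 1)) (G_ne_top (n + 1) ξ)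
  have hsub : (T.G n ξ).toReal - (T.G (n + 1) ξ).toReal =
      T.incr n * T.exitMeasure.real (T.C n ξ) := by
    rw [hG, ENNReal.toReal_add (ENNReal.mul_ne_top ENNReal.ofReal_ne_top (measure_ne_top _ _))
      (G_ne_top _ _), ENNReal.toReal_mul, ENNReal.toReal_ofReal (T.incr_pos n).le, measureReal_def]
    ring
  have hle : (T.G (n + 1) ξ).toReal ≤ (T.G n ξ).toReal := by
    have := mul_nonneg (T.incr_pos n).le (measureReal_nonneg (μ := T.exitMeasure) (s := T.C n ξ))
    linarith
  simp only [pCoeff, expDecay, if_neg (G_ne_zero hξ _), ENNReal.div_eq_inv_mul]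
  rw [lintegral_const_mul' _ _ (ENNReal.inv_ne_top.2 h0), lintegral_exp_sub h1 hle, hsub,
    ENNReal.ofReal_mul (T.incr_pos n).le, ofReal_measureReal, mul_comm (ENNReal.ofReal _),
    ← mul_assoc, ENNReal.inv_mul_cancel h0 (measure_ne_top _ _), one_mul, uCoeff]

theorem measurable_pCoeff_left (n : ℕ) (ξ : T.Boundary) :
    Measurable fun t : ℝ => pCoeff t n ξ := by
  have h : ∀ m, Measurable fun t : ℝ => expDecay t (T.G m ξ) := fun m => by
    unfold expDecay
    split_ifs
    · exact measurable_const
    · fun_prop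
  exact ((h n).sub (h (n + 1))).ennreal_ofReal.div_const _

theorem lintegral_p_eq_U {ξ : T.Boundary} (hξ : ξ ∈ T.accessible) (η : T.Boundary) :
    ∫⁻ t in Ioi (0 : ℝ), T.p t ξ η = T.U ξ η := by
  rw [U_eq_ker]
  simp only [p_eq_ker, ker]
  rw [lintegral_tsum]
  · refine tsum_congr fun n => ?_
    by_cases h : η ∈ T.C n ξ
    · simp only [indicator_of_mem h]
      exact lintegral_pCoeff hξ n
    · simp [indicator_of_notMem h]
  · intro n
    have hm : Measurable fun t : ℝ => pCoeff t n ξ := measurable_pCoeff_left n ξ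
    by_cases h : η ∈ T.C n ξ
    · simp only [indicator_of_mem h]
      exact hm.aemeasurable
    · simp only [indicator_of_notMem h]
      exact aemeasurable_const

/-! ### The Feller property -/

section Estimates

variable {A : ℕ → T.Boundary → ℝ≥0∞} {e : ℕ → T.Boundary → ℝ} {f : T.Boundary → ℝ} {c : ℝ}

theorem IsCoeff.integrable_kerTail_mul (hA : IsCoeff A e) {ξ : T.Boundary} (hξ : ξ ∈ T.regular)
    (M : ℕ) (hf : AEStronglyMeasurable f T.exitMeasure)
    (hc : ∀ᵐ η ∂T.exitMeasure, |f η| ≤ c) :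
    Integrable (fun η => (kerTail A M ξ η).toReal * f η) T.exitMeasure :=
  (hA.integrable_kerTail hξ M).mul_bdd hf hc

theorem IsCoeff.abs_integral_kerTail_le (hA : IsCoeff A e) {ξ : T.Boundary}
    (hξ : ξ ∈ T.regular) (M : ℕ) (hc : ∀ᵐ η ∂T.exitMeasure, |f η| ≤ c) :
    |∫ η, (kerTail A M ξ η).toReal * f η ∂T.exitMeasure| ≤ c * e M ξ := by
  have := norm_integral_le_of_norm_le ((hA.integrable_kerTail hξ M).const_mul c)
    (f := fun η => (kerTail A M ξ η).toReal * f η) (by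
      filter_upwards [hc] with η hη
      rw [Real.norm_eq_abs, abs_mul, abs_of_nonneg ENNReal.toReal_nonneg, mul_comm]
      exact mul_le_mul_of_nonneg_right hη ENNReal.toReal_nonneg)
  rwa [integral_const_mul, hA.integral_kerTail hξ] at this

theorem kerTail_eq_zero {M : ℕ} {ξ η : T.Boundary} (h : η ∉ T.C M ξ) : kerTail A M ξ η = 0 := by
  refine ENNReal.tsum_eq_zero.2 fun n => ?_
  rw [indicator_of_notMem fun h' => h (C_anti (Nat.le_add_left M n) ξ h')]

theorem IsCoeff.abs_integral_kerTail_sub_le (hA : IsCoeff A e) {ξ : T.Boundary}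
    (hξ : ξ ∈ T.regular) (M : ℕ) (hf : AEStronglyMeasurable f T.exitMeasure)
    (hc : ∀ᵐ η ∂T.exitMeasure, |f η| ≤ c) {ε : ℝ}
    (hε : ∀ᵐ η ∂T.exitMeasure, η ∈ T.C M ξ → |f η - f ξ| ≤ ε) :
    |∫ η, (kerTail A M ξ η).toReal * f η ∂T.exitMeasure - e M ξ * f ξ| ≤ ε * e M ξ := by
  have h1 : ∫ η, (kerTail A M ξ η).toReal * f η ∂T.exitMeasure - e M ξ * f ξ =
      ∫ η, (kerTail A M ξ η).toReal * (f η - f ξ) ∂T.exitMeasure := by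
    simp only [mul_sub]
    rw [integral_sub (hA.integrable_kerTail_mul hξ M hf hc)
      ((hA.integrable_kerTail hξ M).mul_const _), integral_mul_const, hA.integral_kerTail hξ]
  rw [h1]
  have := norm_integral_le_of_norm_le ((hA.integrable_kerTail hξ M).const_mul ε)
    (f := fun η => (kerTail A M ξ η).toReal * (f η - f ξ)) (by
      filter_upwards [hε] with η hη
      by_cases h : η ∈ T.C M ξ
      · rw [Real.norm_eq_abs, abs_mul, abs_of_nonneg ENNReal.toReal_nonneg, mul_comm]
        exact mul_le_mul_of_nonneg_right (hη h) ENNReal.toReal_nonneg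
      · rw [kerTail_eq_zero h]
        simp)
  rwa [integral_const_mul, hA.integral_kerTail hξ] at this

theorem IsCoeff.abs_sum_le (hA : IsCoeff A e) {ξ : T.Boundary} (hξ : ξ ∈ T.regular) (M : ℕ)
    (hc : ∀ᵐ η ∂T.exitMeasure, |f η| ≤ c) :
    |∑ n ∈ Finset.range M, (A n ξ).toReal * ∫ η in T.C n ξ, f η ∂T.exitMeasure| ≤
      c * (e 0 ξ - e M ξ) := by
  refine (Finset.abs_sum_le_sum_abs _ _).trans ?_
  rw [← Finset.sum_range_sub' (fun n => e n ξ), Finset.mul_sum]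
  refine Finset.sum_le_sum fun n _ => ?_
  rw [← hA.toReal_mul_measureReal hξ, abs_mul, abs_of_nonneg ENNReal.toReal_nonneg]
  have := norm_setIntegral_le_of_norm_le_const_ae' (μ := T.exitMeasure) (s := T.C n ξ) (f := f)
    (C := c) (measure_lt_top _ _) (hc.mono fun η h _ => h)
  rw [Real.norm_eq_abs] at this
  calc (A n ξ).toReal * |∫ η in T.C n ξ, f η ∂T.exitMeasure|
      ≤ (A n ξ).toReal * (c * T.exitMeasure.real (T.C n ξ)) :=
        mul_le_mul_of_nonneg_left this ENNReal.toReal_nonneg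
    _ = c * ((A n ξ).toReal * T.exitMeasure.real (T.C n ξ)) := by ring

/-- Values of the kernel at two points with a common beginning of the geodesics. -/
theorem IsCoeff.integral_ker_sub_eq (hA : IsCoeff A e) {ξ ζ : T.Boundary} (hξ : ξ ∈ T.regular)
    (hζ : ζ ∈ T.regular) {M : ℕ} (hM : ξ.at M = ζ.at M)
    (hf : AEStronglyMeasurable f T.exitMeasure) (hc : ∀ᵐ η ∂T.exitMeasure, |f η| ≤ c) :
    ∫ η, (ker A ξ η).toReal * f η ∂T.exitMeasure -
        ∫ η, (ker A ζ η).toReal * f η ∂T.exitMeasure =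
      ∫ η, (kerTail A M ξ η).toReal * f η ∂T.exitMeasure -
        ∫ η, (kerTail A M ζ η).toReal * f η ∂T.exitMeasure := by
  have hi : Integrable f T.exitMeasure := Integrable.of_bound hf c hc
  rw [hA.integral_ker_mul hξ M hi (hA.integrable_kerTail_mul hξ M hf hc),
    hA.integral_ker_mul hζ M hi (hA.integrable_kerTail_mul hζ M hf hc)]
  have : ∀ n ∈ Finset.range M, (A n ξ).toReal * ∫ η in T.C n ξ, f η ∂T.exitMeasure =
      (A n ζ).toReal * ∫ η in T.C n ζ, f η ∂T.exitMeasure := by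
    intro n hn
    have hn' := Boundary.at_eq_of_le (Finset.mem_range.1 hn).le hM
    rw [hA.congr ξ hξ ζ hζ n hn', C_eq_C hn']
  rw [Finset.sum_congr rfl this]
  ring

end Estimates

theorem P_eq (t : ℝ) (f : T.Boundary → ℝ) (ξ : T.Boundary) :
    T.P t f ξ = ∫ η, (ker (pCoeff t) ξ η).toReal * f η ∂T.exitMeasure := by
  simp only [P, p_eq_ker]

theorem exp_gReg_le_one {t : ℝ} (ht : 0 < t) (M : ℕ) (ξ : T.Boundary) :
    Real.exp (-t / T.gReg M ξ) ≤ 1 := by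
  rw [Real.exp_le_one_iff, neg_div, neg_nonpos]
  exact (div_pos ht (gReg_pos M ξ)).le

section Bounded

variable {f : T.Boundary → ℝ} {c : ℝ}

theorem abs_P_le {t : ℝ} (ht : 0 < t) (hc : ∀ᵐ η ∂T.exitMeasure, |f η| ≤ c) (hc0 : 0 ≤ c)
    {ξ : T.Boundary} (hξ : ξ ∈ T.regular) : |T.P t f ξ| ≤ c := by
  rw [P_eq]
  refine ((isCoeff_p ht).abs_integral_kerTail_le hξ 0 hc).trans ?_
  exact mul_le_of_le_one_right hc0 (exp_gReg_le_one ht 0 ξ)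

/-- The levels below M cancel. Both tails have the same mass e^{-t/G_M}, which is small for large M
at a regular point. -/
theorem abs_P_sub_P_le {t : ℝ} (ht : 0 < t) (hf : AEStronglyMeasurable f T.exitMeasure)
    (hc : ∀ᵐ η ∂T.exitMeasure, |f η| ≤ c) {ξ ζ : T.Boundary} (hξ : ξ ∈ T.regular)
    (hζ : ζ ∈ T.regular) {M : ℕ} (hM : ξ.at M = ζ.at M) :
    |T.P t f ξ - T.P t f ζ| ≤ 2 * c * Real.exp (-t / T.gReg M ξ) := by
  rw [P_eq, P_eq, (isCoeff_p ht).integral_ker_sub_eq hξ hζ hM hf hc]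
  have h1 := (isCoeff_p ht).abs_integral_kerTail_le hξ M hc
  have h2 := (isCoeff_p ht).abs_integral_kerTail_le hζ M hc
  beta_reduce at h1 h2
  rw [← gReg_congr hM] at h2
  refine (abs_sub _ _).trans ?_
  linarith

/-- Split at M: the mass outside the tail is at most 1 - e^{-t/G_M}, which vanishes as t decreases
to 0, and the tail sees only the variation of f on C^M(ξ). -/
theorem abs_P_sub_le {t : ℝ} (ht : 0 < t) (hf : AEStronglyMeasurable f T.exitMeasure)
    (hc : ∀ᵐ η ∂T.exitMeasure, |f η| ≤ c) {ξ : T.Boundary} (hξ : ξ ∈ T.regular)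
    (hfξ : |f ξ| ≤ c) {M : ℕ} {ε : ℝ} (hε0 : 0 ≤ ε)
    (hε : ∀ᵐ η ∂T.exitMeasure, η ∈ T.C M ξ → |f η - f ξ| ≤ ε) :
    |T.P t f ξ - f ξ| ≤ 2 * c * (1 - Real.exp (-t / T.gReg M ξ)) + ε := by
  have hA := isCoeff_p (T := T) ht
  have hc0 : 0 ≤ c := (abs_nonneg _).trans hfξ
  rw [P_eq, hA.integral_ker_mul hξ M (Integrable.of_bound hf c hc)
    (hA.integrable_kerTail_mul hξ M hf hc)]
  have h1 := hA.abs_sum_le hξ M hc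
  have h2 := hA.abs_integral_kerTail_sub_le hξ M hf hc hε
  have e0 := exp_gReg_le_one ht 0 ξ
  have eM := exp_gReg_le_one ht M ξ
  beta_reduce at h1 h2
  set a := Real.exp (-t / T.gReg M ξ)
  set x := ∑ n ∈ Finset.range M, (pCoeff t n ξ).toReal * ∫ η in T.C n ξ, f η ∂T.exitMeasure
  set y := ∫ η, (kerTail (pCoeff t) M ξ η).toReal * f η ∂T.exitMeasure
  have h3 : |(1 - a) * f ξ| ≤ (1 - a) * c := by
    rw [abs_mul, abs_of_nonneg (sub_nonneg.2 eM)]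
    exact mul_le_mul_of_nonneg_left hfξ (sub_nonneg.2 eM)
  have h4 : x + y - f ξ = x + (y - a * f ξ) - (1 - a) * f ξ := by ring
  rw [h4]
  have h5 := abs_sub (x + (y - a * f ξ)) ((1 - a) * f ξ)
  have h6 := abs_add_le x (y - a * f ξ)
  have h7 : c * (Real.exp (-t / T.gReg 0 ξ) - a) ≤ c * (1 - a) :=
    mul_le_mul_of_nonneg_left (by linarith) hc0
  have h8 : ε * a ≤ ε := mul_le_of_le_one_right hε0 eM
  linarith

theorem tendsto_one_sub_exp (M : ℕ) (ξ : T.Boundary) (c ε : ℝ) :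
    Tendsto (fun t : ℝ => 2 * c * (1 - Real.exp (-t / T.gReg M ξ)) + ε) (𝓝[>] 0) (𝓝 ε) := by
  have h : Continuous fun t : ℝ => 2 * c * (1 - Real.exp (-t / T.gReg M ξ)) + ε := by fun_prop
  have := (h.tendsto 0).mono_left (nhdsWithin_le_nhds (s := Ioi (0 : ℝ)))
  simpa using this

theorem aestronglyMeasurable_of_continuousOn_regular (hf : ContinuousOn f T.regular) :
    AEStronglyMeasurable f T.exitMeasure := by
  have := hf.aestronglyMeasurable (μ := T.exitMeasure) (T.measurableSet_regular hT.out)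
  rwa [Measure.restrict_eq_self_of_ae_mem ae_regular] at this

theorem ae_of_forall_regular {q : T.Boundary → Prop} (h : ∀ ξ ∈ T.regular, q ξ) :
    ∀ᵐ ξ ∂T.exitMeasure, q ξ := ae_regular.mono h

theorem continuousOn_P {t : ℝ} (ht : 0 < t) (hf : ContinuousOn f T.regular)
    (hc : ∀ ξ ∈ T.regular, |f ξ| ≤ c) : ContinuousOn (T.P t f) T.regular := by
  intro ξ hξ
  rw [ContinuousWithinAt, Metric.tendsto_nhds]
  intro ε hε
  have hlim := (tendsto_exp_gReg ht hξ).const_mul (2 * c)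
  rw [mul_zero] at hlim
  obtain ⟨M, hM⟩ := (hlim.eventually_lt_const hε).exists
  filter_upwards [self_mem_nhdsWithin, mem_nhdsWithin_of_mem_nhds (T.C_mem_nhds M ξ)]
    with ζ hζ hζM
  rw [dist_comm, Real.dist_eq]
  exact (abs_P_sub_P_le ht (aestronglyMeasurable_of_continuousOn_regular hf)
    (ae_of_forall_regular hc) hξ hζ hζM).trans_lt hM

theorem tendsto_P (hf : ContinuousOn f T.regular) (hc : ∀ ξ ∈ T.regular, |f ξ| ≤ c)
    {ξ : T.Boundary} (hξ : ξ ∈ T.regular) :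
    Tendsto (fun t => T.P t f ξ) (𝓝[>] 0) (𝓝 (f ξ)) := by
  rw [Metric.tendsto_nhds]
  intro ε hε
  have h1 := (Metric.tendsto_nhds.1 (hf ξ hξ)) (ε / 2) (half_pos hε)
  rw [eventually_nhdsWithin_iff] at h1
  obtain ⟨M, -, hM⟩ := (T.nhds_basis_C ξ).eventually_iff.1 h1
  filter_upwards [self_mem_nhdsWithin, (tendsto_one_sub_exp M ξ c (ε / 2)).eventually_lt_const
    (half_lt_self hε)] with t ht h2
  refine lt_of_le_of_lt ?_ h2
  exact abs_P_sub_le ht (aestronglyMeasurable_of_continuousOn_regular hf)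
    (ae_of_forall_regular hc) hξ (hc ξ hξ) (half_pos hε).le
    (ae_of_forall_regular fun η hη hηM => (hM hηM hη).le)

end Bounded

section Continuous

/-- At a fixed level `gReg` takes finitely many positive values. This makes the convergence as t
decreases to 0 uniform in ξ. -/
theorem exists_gReg_ge (M : ℕ) : ∃ δ > 0, ∀ ξ : T.Boundary, δ ≤ T.gReg M ξ := by
  have hfin := T.finite_level_le M
  have hne : (hfin.toFinset).Nonempty :=
    ⟨T.root, by simp [T.level_root]⟩
  obtain ⟨i, -, hi⟩ := hfin.toFinset.exists_min_image
    (fun i => T.alpha * T.hit (T.parState i)) hne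
  refine ⟨T.alpha * T.hit (T.parState i), mul_pos alpha_pos (T.hit_pos _), fun ξ => ?_⟩
  exact hi _ (by simp [ξ.level_at])

theorem tendstoUniformlyOn_P (f : C(T.Boundary, ℝ)) :
    TendstoUniformlyOn (fun t => T.P t f) f (𝓝[>] 0) T.regular := by
  obtain ⟨c, hc⟩ : ∃ c, ∀ ξ, |f ξ| ≤ c := ⟨‖f‖, fun ξ => f.norm_coe_le_norm ξ⟩
  rw [Metric.tendstoUniformlyOn_iff]
  intro ε hε
  obtain ⟨M, hM⟩ := T.exists_level_forall_dist_le f (half_pos hε)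
  obtain ⟨δ, hδ, hδM⟩ := exists_gReg_ge (T := T) M
  have h : Continuous fun t : ℝ => 2 * c * (1 - Real.exp (-t / δ)) + ε / 2 := by fun_prop
  have h1 := (h.tendsto 0).mono_left (nhdsWithin_le_nhds (s := Ioi (0 : ℝ)))
  simp only [neg_zero, zero_div, Real.exp_zero, sub_self, mul_zero, zero_add] at h1
  filter_upwards [self_mem_nhdsWithin, h1.eventually_lt_const (half_lt_self hε)] with t ht h2 ξ hξ
  have hc0 : 0 ≤ c := (abs_nonneg _).trans (hc ξ)
  rw [dist_comm, Real.dist_eq]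
  refine lt_of_le_of_lt (abs_P_sub_le ht f.continuous.aestronglyMeasurable
    (Eventually.of_forall hc) hξ (hc ξ) (half_pos hε).le
    (Eventually.of_forall fun η hη => hM η ξ (mem_C_iff.1 hη).symm)) (lt_of_le_of_lt ?_ h2)
  have h3 : Real.exp (-t / δ) ≤ Real.exp (-t / T.gReg M ξ) := by
    refine Real.exp_le_exp.2 ?_
    rw [neg_div, neg_div, neg_le_neg_iff]
    exact div_le_div_of_nonneg_left (le_of_lt ht) hδ (hδM ξ)
  have := mul_le_mul_of_nonneg_left (sub_le_sub_left h3 1) (by positivity : 0 ≤ 2 * c)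
  linarith

/-- The choice of M must be uniform, while e^{-t/G_M} need not be small near points that are not
regular. The uniformly small oscillation of f on the sets C^M is used instead. -/
theorem exists_level_abs_P_sub_le {t : ℝ} (ht : 0 < t) (f : C(T.Boundary, ℝ)) {ε : ℝ}
    (hε : 0 < ε) : ∃ M, ∀ ξ ∈ T.regular, ∀ ζ ∈ T.regular, ξ.at M = ζ.at M →
      |T.P t f ξ - T.P t f ζ| < ε := by
  obtain ⟨M, hM⟩ := T.exists_level_forall_dist_le f (by positivity : 0 < ε / 4)
  obtain ⟨c, hc⟩ : ∃ c, ∀ ξ, |f ξ| ≤ c := ⟨‖f‖, fun ξ => f.norm_coe_le_norm ξ⟩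
  refine ⟨M, fun ξ hξ ζ hζ h => ?_⟩
  have hA := isCoeff_p (T := T) ht
  have hm : AEStronglyMeasurable f T.exitMeasure := f.continuous.aestronglyMeasurable
  rw [P_eq, P_eq, hA.integral_ker_sub_eq hξ hζ h hm (Eventually.of_forall hc)]
  have h1 := hA.abs_integral_kerTail_sub_le hξ M hm (Eventually.of_forall hc)
    (Eventually.of_forall fun η hη => hM η ξ (mem_C_iff.1 hη).symm)
  have h2 := hA.abs_integral_kerTail_sub_le hζ M hm (Eventually.of_forall hc)
    (Eventually.of_forall fun η hη => hM η ζ (mem_C_iff.1 hη).symm)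
  beta_reduce at h1 h2
  rw [← gReg_congr h] at h2
  have eM := exp_gReg_le_one ht M ξ
  have ep := (Real.exp_pos (-t / T.gReg M ξ)).le
  -- The two tail errors and this difference are each at most ε/4.
  have h3 : |Real.exp (-t / T.gReg M ξ) * (f ξ - f ζ)| ≤ ε / 4 := by
    rw [abs_mul, abs_of_nonneg ep]
    exact (mul_le_of_le_one_left (abs_nonneg _) eM).trans (hM ξ ζ h)
  have h4 : ε / 4 * Real.exp (-t / T.gReg M ξ) ≤ ε / 4 :=
    mul_le_of_le_one_right (by positivity) eM
  rw [abs_le] at h1 h2 h3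
  rw [abs_lt]
  constructor <;> nlinarith [h1.1, h1.2, h2.1, h2.2, h3.1, h3.2]

/-- The uniform estimate is a Cauchy criterion at every point of the closure of the regular points.
The limits extend P_t f continuously to the closure, and Tietze's theorem extends it to the
boundary. -/
theorem exists_extension_P {t : ℝ} (ht : 0 < t) (f : C(T.Boundary, ℝ)) :
    ∃ g : C(T.Boundary, ℝ), EqOn g (T.P t f) T.regular := by
  have hlim : ∀ x ∈ closure T.regular, ∃ y, Tendsto (T.P t f) (𝓝[T.regular] x) (𝓝 y) := by
    intro x hx
    have hne : (𝓝[T.regular] x).NeBot := mem_closure_iff_nhdsWithin_neBot.1 hx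
    have hcauchy : Cauchy (map (T.P t f) (𝓝[T.regular] x)) := by
      refine Metric.cauchy_iff.2 ⟨inferInstance, fun ε hε => ?_⟩
      obtain ⟨M, hM⟩ := exists_level_abs_P_sub_le ht f hε
      refine ⟨T.P t f '' (T.C M x ∩ T.regular), image_mem_map (inter_mem
        (mem_nhdsWithin_of_mem_nhds (T.C_mem_nhds M x)) self_mem_nhdsWithin), ?_⟩
      rintro _ ⟨ξ, ⟨h1, h2⟩, rfl⟩ _ ⟨ζ, ⟨h3, h4⟩, rfl⟩
      exact hM ξ h2 ζ h4 ((mem_C_iff.1 h1).symm.trans (mem_C_iff.1 h3))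
    exact CompleteSpace.complete hcauchy
  have hext : ContinuousOn (extendFrom T.regular (T.P t f)) (closure T.regular) :=
    continuousOn_extendFrom Subset.rfl hlim
  obtain ⟨c, hc⟩ : ∃ c, ∀ ξ, |f ξ| ≤ c := ⟨‖f‖, fun ξ => f.norm_coe_le_norm ξ⟩
  have hcont := continuousOn_P ht f.continuous.continuousOn fun ξ _ => hc ξ
  obtain ⟨g, hg⟩ := ContinuousMap.exists_restrict_eq (isClosed_closure (s := T.regular))
    ⟨_, hext.domRestrict⟩
  refine ⟨g, fun ξ hξ => ?_⟩
  have h1 := congrArg (fun φ => φ ⟨ξ, subset_closure hξ⟩) hg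
  have h2 : g ξ = extendFrom T.regular (T.P t f) ξ := h1
  rw [h2]
  exact extendFrom_eq (subset_closure hξ) (hcont ξ hξ)

end Continuous

end

section

variable {E : Type*} [MeasurableSpace E] {μ : Measure E} [IsFiniteMeasure μ]

/-! ### Kernel operators in `L²` -/

/-- A measurable kernel whose marginal masses are bounded by `c`. -/
structure IsSchur (μ : Measure E) (k : E → E → ℝ≥0∞) (c : ℝ) : Prop where
  measurable : Measurable fun q : E × E => k q.1 q.2
  nonneg : 0 ≤ c
  left : ∀ᵐ x ∂μ, ∫⁻ y, k x y ∂μ ≤ ENNReal.ofReal c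
  right : ∀ᵐ y ∂μ, ∫⁻ x, k x y ∂μ ≤ ENNReal.ofReal c

/-- Cauchy–Schwarz for g and the constant 1 with respect to the measure with density κ; this is the
core of the Schur test. -/
theorem lintegral_mul_sq_le {κ g : E → ℝ≥0∞} (hκ : Measurable κ) (hg : AEMeasurable g μ) :
    (∫⁻ y, κ y * g y ∂μ) ^ (2 : ℝ) ≤ (∫⁻ y, κ y ∂μ) * ∫⁻ y, κ y * g y ^ (2 : ℝ) ∂μ := by
  have hac := withDensity_absolutelyContinuous μ κ
  have h := ENNReal.lintegral_mul_le_Lp_mul_Lq (μ.withDensity κ) Real.HolderConjugate.two_two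
    (f := fun _ => 1) aemeasurable_const (hg.mono_ac hac)
  simp only [Pi.mul_apply, one_mul, ENNReal.one_rpow] at h
  rw [lintegral_withDensity_eq_lintegral_mul₀ hκ.aemeasurable hg,
    lintegral_withDensity_eq_lintegral_mul₀ hκ.aemeasurable aemeasurable_const,
    lintegral_withDensity_eq_lintegral_mul₀ hκ.aemeasurable (hg.pow_const _)] at h
  simp only [Pi.mul_apply, mul_one] at h
  refine (ENNReal.rpow_le_rpow h zero_le_two).trans ?_
  rw [ENNReal.mul_rpow_of_nonneg _ _ zero_le_two, ← ENNReal.rpow_mul, ← ENNReal.rpow_mul]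
  norm_num

variable {k : E → E → ℝ≥0∞} {c : ℝ}

theorem IsSchur.measurable_left (h : IsSchur μ k c) (x : E) : Measurable (k x) :=
  h.measurable.comp (measurable_const.prodMk measurable_id)

theorem IsSchur.lintegral_sq_le (h : IsSchur μ k c) {g : E → ℝ≥0∞} (hg : AEMeasurable g μ) :
    ∫⁻ x, (∫⁻ y, k x y * g y ∂μ) ^ (2 : ℝ) ∂μ ≤
      ENNReal.ofReal c ^ (2 : ℝ) * ∫⁻ y, g y ^ (2 : ℝ) ∂μ := by
  have hg2 : AEMeasurable (fun q : E × E => k q.1 q.2 * g q.2 ^ (2 : ℝ)) (μ.prod μ) :=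
    h.measurable.aemeasurable.mul (hg.comp_snd.pow_const _)
  calc ∫⁻ x, (∫⁻ y, k x y * g y ∂μ) ^ (2 : ℝ) ∂μ
      ≤ ∫⁻ x, ENNReal.ofReal c * ∫⁻ y, k x y * g y ^ (2 : ℝ) ∂μ ∂μ := by
        refine lintegral_mono_ae ?_
        filter_upwards [h.left] with x hx
        exact (lintegral_mul_sq_le (h.measurable_left x) hg).trans (mul_le_mul_left hx _)
    _ = ENNReal.ofReal c * ∫⁻ x, ∫⁻ y, k x y * g y ^ (2 : ℝ) ∂μ ∂μ :=
        lintegral_const_mul' _ _ ENNReal.ofReal_ne_top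
    _ = ENNReal.ofReal c * ∫⁻ y, ∫⁻ x, k x y * g y ^ (2 : ℝ) ∂μ ∂μ := by
        rw [lintegral_lintegral_swap hg2]
    _ ≤ ENNReal.ofReal c * ∫⁻ y, ENNReal.ofReal c * g y ^ (2 : ℝ) ∂μ := by
        refine mul_le_mul_right (lintegral_mono_ae ?_) _
        filter_upwards [h.right] with y hy
        have hm : Measurable fun x => k x y :=
          h.measurable.comp (measurable_id.prodMk measurable_const)
        rw [lintegral_mul_const _ hm]
        exact mul_le_mul_left hy _
    _ = ENNReal.ofReal c ^ (2 : ℝ) * ∫⁻ y, g y ^ (2 : ℝ) ∂μ := by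
        rw [lintegral_const_mul' _ _ ENNReal.ofReal_ne_top, ← mul_assoc, ENNReal.rpow_two, sq]

theorem enorm_toReal_mul_le (a : ℝ≥0∞) (b : ℝ) : ‖a.toReal * b‖ₑ ≤ a * ‖b‖ₑ := by
  rw [enorm_mul]
  refine mul_le_mul_left ?_ _
  rw [Real.enorm_of_nonneg ENNReal.toReal_nonneg]
  exact ENNReal.ofReal_toReal_le

section

variable {f : E → ℝ}

theorem lintegral_enorm_sq_lt_top (hf : MemLp f 2 μ) : ∫⁻ y, ‖f y‖ₑ ^ (2 : ℝ) ∂μ < ∞ := by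
  have := lintegral_rpow_enorm_lt_top_of_eLpNorm_lt_top two_ne_zero ENNReal.ofNat_ne_top hf.2
  simpa using this

theorem IsSchur.ae_integrable (h : IsSchur μ k c) (hf : MemLp f 2 μ) :
    ∀ᵐ x ∂μ, Integrable (fun y => (k x y).toReal * f y) μ := by
  have h1 := h.lintegral_sq_le hf.1.enorm
  have h2 : ∫⁻ x, (∫⁻ y, k x y * ‖f y‖ₑ ∂μ) ^ (2 : ℝ) ∂μ ≠ ∞ :=
    (h1.trans_lt (ENNReal.mul_lt_top (by simp) (lintegral_enorm_sq_lt_top hf))).ne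
  have hm : AEMeasurable (fun x => (∫⁻ y, k x y * ‖f y‖ₑ ∂μ) ^ (2 : ℝ)) μ :=
    ((h.measurable.aemeasurable.mul hf.1.enorm.comp_snd).lintegral_prod_right').pow_const _
  filter_upwards [ae_lt_top' hm h2] with x hx
  refine ⟨(h.measurable_left x).ennreal_toReal.aestronglyMeasurable.mul hf.1, ?_⟩
  refine lt_of_le_of_lt (lintegral_mono fun y => enorm_toReal_mul_le _ _) ?_
  by_contra hcon
  rw [not_lt, top_le_iff] at hcon
  rw [hcon] at hx
  simp at hx

theorem IsSchur.aestronglyMeasurable_integral (h : IsSchur μ k c) (hf : MemLp f 2 μ) :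
    AEStronglyMeasurable (fun x => ∫ y, (k x y).toReal * f y ∂μ) μ :=
  (h.measurable.ennreal_toReal.aestronglyMeasurable.mul hf.1.comp_snd).integral_prod_right'

theorem IsSchur.eLpNorm_integral_le (h : IsSchur μ k c) (hf : MemLp f 2 μ) :
    eLpNorm (fun x => ∫ y, (k x y).toReal * f y ∂μ) 2 μ ≤ ENNReal.ofReal c * eLpNorm f 2 μ := by
  rw [eLpNorm_eq_lintegral_rpow_enorm_toReal two_ne_zero ENNReal.ofNat_ne_top,
    eLpNorm_eq_lintegral_rpow_enorm_toReal two_ne_zero ENNReal.ofNat_ne_top]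
  have h1 : ∫⁻ x, ‖∫ y, (k x y).toReal * f y ∂μ‖ₑ ^ (2 : ℝ) ∂μ ≤
      ENNReal.ofReal c ^ (2 : ℝ) * ∫⁻ y, ‖f y‖ₑ ^ (2 : ℝ) ∂μ := by
    refine le_trans (lintegral_mono fun x => ENNReal.rpow_le_rpow ?_ zero_le_two)
      (h.lintegral_sq_le hf.1.enorm)
    exact (enorm_integral_le_lintegral_enorm _).trans
      (lintegral_mono fun y => enorm_toReal_mul_le _ _)
  have h2 := ENNReal.rpow_le_rpow h1 (by norm_num : (0 : ℝ) ≤ 1 / 2)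
  rw [ENNReal.mul_rpow_of_nonneg _ _ (by norm_num), ← ENNReal.rpow_mul] at h2
  norm_num at h2 ⊢
  exact h2

theorem IsSchur.memLp_integral (h : IsSchur μ k c) (hf : MemLp f 2 μ) :
    MemLp (fun x => ∫ y, (k x y).toReal * f y ∂μ) 2 μ :=
  ⟨h.aestronglyMeasurable_integral hf,
    (h.eLpNorm_integral_le hf).trans_lt (ENNReal.mul_lt_top ENNReal.ofReal_lt_top hf.2)⟩

end

/-- The operator in `L²` with a given kernel. -/
def IsSchur.op (h : IsSchur μ k c) : Lp ℝ 2 μ →L[ℝ] Lp ℝ 2 μ :=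
  LinearMap.mkContinuous
    { toFun := fun f => (h.memLp_integral (Lp.memLp f)).toLp _
      map_add' := fun f g => by
        rw [← MemLp.toLp_add]
        refine (MemLp.toLp_eq_toLp_iff _ _).2 ?_
        filter_upwards [h.ae_integrable (Lp.memLp f), h.ae_integrable (Lp.memLp g)] with x hf hg
        rw [Pi.add_apply, ← integral_add hf hg]
        refine integral_congr_ae ?_
        filter_upwards [Lp.coeFn_add f g] with y hy
        rw [hy, Pi.add_apply, mul_add]
      map_smul' := fun r f => by
        rw [RingHom.id_apply, ← MemLp.toLp_const_smul]
        refine (MemLp.toLp_eq_toLp_iff _ _).2 (Eventually.of_forall fun x => ?_)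
        rw [Pi.smul_apply, smul_eq_mul, ← integral_const_mul]
        refine integral_congr_ae ?_
        filter_upwards [Lp.coeFn_smul r f] with y hy
        rw [hy, Pi.smul_apply, smul_eq_mul]
        ring }
    c fun f => by
      simp only [LinearMap.coe_mk, AddHom.coe_mk]
      rw [Lp.norm_toLp, Lp.norm_def, ← ENNReal.toReal_ofReal h.nonneg, ← ENNReal.toReal_mul]
      exact ENNReal.toReal_mono (ENNReal.mul_ne_top ENNReal.ofReal_ne_top (Lp.memLp f).2.ne)
        (by simpa [ENNReal.toReal_ofReal h.nonneg] using h.eLpNorm_integral_le (Lp.memLp f))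

theorem IsSchur.norm_op_le (h : IsSchur μ k c) : ‖h.op‖ ≤ c :=
  LinearMap.mkContinuous_norm_le _ h.nonneg _

theorem IsSchur.op_ae_eq (h : IsSchur μ k c) (f : Lp ℝ 2 μ) :
    h.op f =ᵐ[μ] fun x => ∫ y, (k x y).toReal * f y ∂μ :=
  (h.memLp_integral (Lp.memLp f)).coeFn_toLp

theorem IsSchur.ae_ae_ne_top (h : IsSchur μ k c) : ∀ᵐ x ∂μ, ∀ᵐ y ∂μ, k x y ≠ ∞ := by
  filter_upwards [h.left] with x hx
  filter_upwards [ae_lt_top (h.measurable_left x) (hx.trans_lt ENNReal.ofReal_lt_top).ne] with y hy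
  exact hy.ne

theorem IsSchur.ofReal_op_ae_eq (h : IsSchur μ k c) {f : Lp ℝ 2 μ} (hf : 0 ≤ f) :
    (fun x => ENNReal.ofReal (h.op f x)) =ᵐ[μ]
      fun x => ∫⁻ y, k x y * ENNReal.ofReal (f y) ∂μ := by
  filter_upwards [h.op_ae_eq f, h.ae_integrable (Lp.memLp f), h.ae_ae_ne_top] with x hx hi hk
  have hnn : 0 ≤ᵐ[μ] fun y => (k x y).toReal * f y := by
    filter_upwards [(Lp.coeFn_nonneg f).2 hf] with y hy
    exact mul_nonneg ENNReal.toReal_nonneg hy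
  rw [hx, ofReal_integral_eq_lintegral_ofReal hi hnn]
  refine lintegral_congr_ae ?_
  filter_upwards [hk] with y hy
  rw [ENNReal.ofReal_mul ENNReal.toReal_nonneg, ENNReal.ofReal_toReal hy]

theorem IsSchur.op_nonneg (h : IsSchur μ k c) {f : Lp ℝ 2 μ} (hf : 0 ≤ f) : 0 ≤ h.op f := by
  rw [← Lp.coeFn_nonneg]
  filter_upwards [h.op_ae_eq f] with x hx
  rw [Pi.zero_apply, hx]
  refine integral_nonneg_of_ae ?_
  filter_upwards [(Lp.coeFn_nonneg f).2 hf] with y hy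
  exact mul_nonneg ENNReal.toReal_nonneg hy

/-- Operator identities are checked on nonnegative functions, where Tonelli holds without
integrability conditions. -/
theorem eq_of_eq_on_nonneg {F : Type*} [NormedAddCommGroup F] [NormedSpace ℝ F]
    {K L : Lp ℝ 2 μ →L[ℝ] F} (h : ∀ f, 0 ≤ f → K f = L f) : K = L := by
  ext f
  rw [← posPart_sub_negPart f, map_sub, map_sub, h _ (posPart_nonneg f), h _ (negPart_nonneg f)]

theorem eq_of_inner_eq_on_nonneg {f g : Lp ℝ 2 μ}
    (h : ∀ u : Lp ℝ 2 μ, 0 ≤ u → inner ℝ f u = inner ℝ g u) : f = g := by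
  have := eq_of_eq_on_nonneg (K := innerSL ℝ f) (L := innerSL ℝ g) (by simpa using h)
  exact ext_inner_right ℝ fun u => by simpa using congrArg (fun K => K u) this

theorem IsSchur.op_comp_op {k₁ k₂ k₃ : E → E → ℝ≥0∞} {c₁ c₂ c₃ : ℝ} (h₁ : IsSchur μ k₁ c₁)
    (h₂ : IsSchur μ k₂ c₂) (h₃ : IsSchur μ k₃ c₃)
    (h : ∀ᵐ x ∂μ, ∀ᵐ y ∂μ, k₃ x y = ∫⁻ z, k₁ x z * k₂ z y ∂μ) :
    h₃.op = h₁.op.comp h₂.op := by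
  refine eq_of_eq_on_nonneg fun f hf => Lp.ext ?_
  have hf2 := h₂.op_nonneg hf
  rw [ContinuousLinearMap.comp_apply]
  filter_upwards [h₃.ofReal_op_ae_eq hf, h₁.ofReal_op_ae_eq hf2, h,
    (Lp.coeFn_nonneg _).2 (h₃.op_nonneg hf), (Lp.coeFn_nonneg _).2 (h₁.op_nonneg hf2)]
    with x e₃ e₁ hx n₃ n₁
  rw [Pi.zero_apply] at n₃ n₁
  rw [← ENNReal.toReal_ofReal n₃, ← ENNReal.toReal_ofReal n₁, e₃, e₁]
  congr 1
  have hfm : AEMeasurable (fun y => ENNReal.ofReal (f y)) μ :=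
    (Lp.aestronglyMeasurable f).aemeasurable.ennreal_ofReal
  have hm : AEMeasurable (fun q : E × E => k₁ x q.2 * (k₂ q.2 q.1 * ENNReal.ofReal (f q.1)))
      (μ.prod μ) :=
    ((h₁.measurable_left x).comp measurable_snd).aemeasurable.mul
      ((h₂.measurable.comp measurable_swap).aemeasurable.mul hfm.comp_fst)
  calc ∫⁻ y, k₃ x y * ENNReal.ofReal (f y) ∂μ
      = ∫⁻ y, ∫⁻ z, k₁ x z * (k₂ z y * ENNReal.ofReal (f y)) ∂μ ∂μ := by
        refine lintegral_congr_ae ?_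
        filter_upwards [hx] with y hy
        rw [hy, ← lintegral_mul_const' _ _ ENNReal.ofReal_ne_top]
        simp only [mul_assoc]
    _ = ∫⁻ z, ∫⁻ y, k₁ x z * (k₂ z y * ENNReal.ofReal (f y)) ∂μ ∂μ :=
        lintegral_lintegral_swap hm
    _ = ∫⁻ z, k₁ x z * ENNReal.ofReal (h₂.op f z) ∂μ := by
        refine lintegral_congr_ae ?_
        filter_upwards [h₂.ofReal_op_ae_eq hf] with z hz
        rw [hz]
        exact lintegral_const_mul'' _ ((h₂.measurable_left z).aemeasurable.mul hfm)

/-- The quadratic form of a kernel operator. -/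
theorem IsSchur.ofReal_inner_op (h : IsSchur μ k c) {f g : Lp ℝ 2 μ} (hf : 0 ≤ f) (hg : 0 ≤ g) :
    ENNReal.ofReal (inner ℝ (h.op f) g) =
      ∫⁻ q : E × E, k q.1 q.2 * (ENNReal.ofReal (f q.2) * ENNReal.ofReal (g q.1)) ∂μ.prod μ := by
  have hfm : AEMeasurable (fun y => ENNReal.ofReal (f y)) μ :=
    (Lp.aestronglyMeasurable f).aemeasurable.ennreal_ofReal
  have hgm : AEMeasurable (fun y => ENNReal.ofReal (g y)) μ :=
    (Lp.aestronglyMeasurable g).aemeasurable.ennreal_ofReal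
  have hm : AEMeasurable (fun q : E × E =>
      k q.1 q.2 * (ENNReal.ofReal (f q.2) * ENNReal.ofReal (g q.1))) (μ.prod μ) :=
    h.measurable.aemeasurable.mul (hfm.comp_snd.mul hgm.comp_fst)
  rw [L2.inner_def, ofReal_integral_eq_lintegral_ofReal (L2.integrable_inner _ _),
    lintegral_prod _ hm]
  · refine lintegral_congr_ae ?_
    filter_upwards [h.ofReal_op_ae_eq hf, (Lp.coeFn_nonneg _).2 (h.op_nonneg hf)] with x hx hn
    have : inner ℝ (h.op f x) (g x) = h.op f x * g x := by
      simp [mul_comm]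
    rw [this, ENNReal.ofReal_mul hn, hx, ← lintegral_mul_const' _ _ ENNReal.ofReal_ne_top]
    simp only [mul_assoc]
  · filter_upwards [(Lp.coeFn_nonneg _).2 (h.op_nonneg hf), (Lp.coeFn_nonneg _).2 hg] with x h1 h2
    have : inner ℝ (h.op f x) (g x) = h.op f x * g x := by
      simp [mul_comm]
    rw [Pi.zero_apply, this]
    exact mul_nonneg h1 h2

/-! ### Contraction semigroups -/

section Semigroup

variable {H : Type*} [NormedAddCommGroup H] [NormedSpace ℝ H] {S : ℝ → H →L[ℝ] H}

/-- For contractions ‖S_t f - S_s f‖ ≤ ‖S_{|t-s|} f - f‖, so right continuity at 0 gives continuity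
from both sides everywhere. -/
theorem continuousOn_of_semigroup (h0 : S 0 = ContinuousLinearMap.id ℝ H)
    (hadd : ∀ s t, 0 ≤ s → 0 ≤ t → S (s + t) = (S s).comp (S t))
    (hnorm : ∀ t, 0 ≤ t → ‖S t‖ ≤ 1) {f : H} (hf : Tendsto (fun t => S t f) (𝓝[>] 0) (𝓝 f)) :
    ContinuousOn (fun t => S t f) (Ici 0) := by
  have hle : ∀ s t, 0 ≤ s → 0 ≤ t → ‖S t f - S s f‖ ≤ ‖S |t - s| f - f‖ := by
    have key : ∀ s t, 0 ≤ s → s ≤ t → ‖S t f - S s f‖ ≤ ‖S |t - s| f - f‖ := by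
      intro s t hs hst
      have h1 : S t f - S s f = S s (S |t - s| f - f) := by
        have := hadd s (t - s) hs (sub_nonneg.2 hst)
        rw [add_sub_cancel] at this
        rw [abs_of_nonneg (sub_nonneg.2 hst), map_sub, this, ContinuousLinearMap.comp_apply]
      rw [h1]
      exact (ContinuousLinearMap.le_of_opNorm_le _ (hnorm s hs) _).trans_eq (one_mul _)
    intro s t hs ht
    rcases le_total s t with h | h
    · exact key s t hs h
    · rw [norm_sub_rev, abs_sub_comm]
      exact key t s ht h
  have hf' : Tendsto (fun t => S t f) (𝓝[≥] 0) (𝓝 f) := by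
    rw [← Ioi_insert, nhdsWithin_insert, tendsto_sup]
    refine ⟨?_, hf⟩
    rw [tendsto_pure_left]
    intro s hs
    rw [h0]
    exact mem_of_mem_nhds hs
  intro s hs
  rw [ContinuousWithinAt, tendsto_iff_norm_sub_tendsto_zero]
  have habs : Tendsto (fun t : ℝ => |t - s|) (𝓝[Ici 0] s) (𝓝[≥] 0) := by
    refine tendsto_nhdsWithin_iff.2 ⟨?_, Eventually.of_forall fun t => mem_Ici.2 (abs_nonneg _)⟩
    have : Continuous fun t : ℝ => |t - s| := by fun_prop
    have := this.tendsto s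
    rw [sub_self, abs_zero] at this
    exact this.mono_left nhdsWithin_le_nhds
  have h1 := (tendsto_iff_norm_sub_tendsto_zero.1 hf').comp habs
  refine squeeze_zero' (Eventually.of_forall fun t => norm_nonneg _) ?_ h1
  filter_upwards [self_mem_nhdsWithin] with t ht
  exact hle s t hs ht

/-- The potential `∫_0^∞ S_s g ds` belongs to the domain of the generator, which maps it to
`-g`. -/
theorem tendsto_generator_potential [CompleteSpace H] (h0 : S 0 = ContinuousLinearMap.id ℝ H)
    (hadd : ∀ s t, 0 ≤ s → 0 ≤ t → S (s + t) = (S s).comp (S t)) {g : H}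
    (hcont : ContinuousOn (fun t => S t g) (Ici 0))
    (hint : IntegrableOn (fun t => S t g) (Ioi 0)) :
    Tendsto (fun t : ℝ => t⁻¹ • (S t (∫ s in Ioi (0 : ℝ), S s g) - ∫ s in Ioi (0 : ℝ), S s g))
      (𝓝[>] 0) (𝓝 (-g)) := by
  -- Applying S_t shifts the potential to the integral over (t,∞), so the difference is minus the
  -- integral over (0,t), whose right derivative at 0 is S_0 g = g.
  have h1 : ∀ t : ℝ, 0 < t → S t (∫ s in Ioi (0 : ℝ), S s g) - ∫ s in Ioi (0 : ℝ), S s g =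
      -∫ s in (0 : ℝ)..t, S s g := by
    intro t ht
    have h2 : S t (∫ s in Ioi (0 : ℝ), S s g) = ∫ s in Ioi t, S s g := by
      rw [← ContinuousLinearMap.integral_comp_comm _ hint]
      have h3 := (measurePreserving_add_right volume t).setIntegral_preimage_emb
        (measurableEmbedding_addRight t) (fun s => S s g) (Ioi t)
      rw [preimage_add_const_Ioi, sub_self] at h3
      rw [← h3]
      refine setIntegral_congr_fun measurableSet_Ioi fun s hs => ?_
      change S t (S s g) = S (s + t) g
      rw [add_comm, hadd t s ht.le (le_of_lt hs), ContinuousLinearMap.comp_apply]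
    rw [h2, ← intervalIntegral.integral_interval_add_Ioi hint (hint.mono_set (Ioi_subset_Ioi ht.le))]
    abel
  have h2 : HasDerivWithinAt (fun t => ∫ s in (0 : ℝ)..t, S s g) (S 0 g) (Ici 0) 0 := by
    refine intervalIntegral.integral_hasDerivWithinAt_right (t := Ioi 0) (by simp) ?_
      ((hcont 0 self_mem_Ici).mono Ioi_subset_Ici_self)
    exact ⟨Ioi 0, self_mem_nhdsWithin, hint.1⟩
  rw [h0] at h2
  have h3 := ((hasDerivWithinAt_iff_tendsto_slope' (by simp)).1 (h2.mono Ioi_subset_Ici_self)).neg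
  refine h3.congr' ?_
  filter_upwards [self_mem_nhdsWithin] with t ht
  rw [h1 t ht, slope_def_module]
  simp

end Semigroup

theorem tendsto_of_dense {H ι : Type*} [NormedAddCommGroup H] [NormedSpace ℝ H] {l : Filter ι}
    {K : ι → H →L[ℝ] H} {D : Set H} (hD : Dense D) (hK : ∀ᶠ i in l, ‖K i‖ ≤ 1)
    (h : ∀ φ ∈ D, Tendsto (fun i => K i φ) l (𝓝 φ)) (f : H) :
    Tendsto (fun i => K i f) l (𝓝 f) := by
  rw [Metric.tendsto_nhds]
  intro ε hε
  obtain ⟨φ, hφ, hfφ⟩ := hD.exists_dist_lt f (by positivity : 0 < ε / 3)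
  filter_upwards [hK, Metric.tendsto_nhds.1 (h φ hφ) (ε / 3) (by positivity)] with i h1 h2
  have h3 : dist (K i f) (K i φ) ≤ dist f φ := by
    rw [dist_eq_norm, dist_eq_norm, ← map_sub]
    exact (ContinuousLinearMap.le_of_opNorm_le _ h1 _).trans_eq (one_mul _)
  have h4 := dist_triangle4 (K i f) (K i φ) φ f
  rw [dist_comm φ f] at h4
  linarith

end

section

variable {I : Type*} {T : TreeMatrix I} [Countable I] [hT : T.IsTransient]

/-! ### The semigroup and the potential operator in `L²` -/

/-- One marginal is the total mass e_0; the other equals it by symmetry on the regular points. -/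
theorem IsCoeff.isSchur {A : ℕ → T.Boundary → ℝ≥0∞} {e : ℕ → T.Boundary → ℝ} (hA : IsCoeff A e)
    {c : ℝ} (hc : 0 ≤ c) (he : ∀ ξ, e 0 ξ = c) : IsSchur T.exitMeasure (ker A) c where
  measurable := measurable_ker hA.measurable
  nonneg := hc
  left := ae_regular.mono fun ξ hξ => (he ξ ▸ hA.lintegral_ker hξ).le
  right := by
    filter_upwards [ae_regular] with η hη
    rw [← he η, ← hA.lintegral_ker hη]
    refine (lintegral_congr_ae ?_).le
    filter_upwards [ae_regular] with ξ hξ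
    rw [ker_symm hA hξ hη]

theorem isSchur_p {t : ℝ} (ht : 0 < t) :
    IsSchur T.exitMeasure (T.p t) (Real.exp (-t / T.alpha)) := by
  have h : T.p t = ker (pCoeff t) := by
    ext ξ η
    exact p_eq_ker t ξ η
  rw [h]
  exact (isCoeff_p ht).isSchur (Real.exp_pos _).le fun ξ => by rw [gReg_zero]

theorem isSchur_U : IsSchur T.exitMeasure T.U T.alpha := by
  have h : T.U = ker uCoeff := by
    ext ξ η
    exact U_eq_ker ξ η
  rw [h]
  exact isCoeff_U.isSchur alpha_pos.le fun ξ => gReg_zero ξ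

variable (T) in
/-- The semigroup with the kernel `p`. -/
def semigroup (t : ℝ) : Lp ℝ 2 T.exitMeasure →L[ℝ] Lp ℝ 2 T.exitMeasure :=
  if ht : 0 < t then (isSchur_p ht).op else ContinuousLinearMap.id ℝ _

variable (T) in
/-- The operator with the kernel `U`. -/
def potential : Lp ℝ 2 T.exitMeasure →L[ℝ] Lp ℝ 2 T.exitMeasure := (isSchur_U (T := T)).op

theorem semigroup_of_pos {t : ℝ} (ht : 0 < t) : T.semigroup t = (isSchur_p ht).op := dif_pos ht

theorem semigroup_zero : T.semigroup 0 = ContinuousLinearMap.id ℝ _ := dif_neg (lt_irrefl 0)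

theorem norm_semigroup_le {t : ℝ} (ht : 0 < t) : ‖T.semigroup t‖ ≤ Real.exp (-t / T.alpha) := by
  rw [semigroup_of_pos ht]
  exact (isSchur_p ht).norm_op_le

theorem exp_alpha_le_one {t : ℝ} (ht : 0 < t) : Real.exp (-t / T.alpha) ≤ 1 := by
  rw [Real.exp_le_one_iff, neg_div, neg_nonpos]
  exact (div_pos ht alpha_pos).le

theorem norm_semigroup_le_one {t : ℝ} (ht : 0 ≤ t) : ‖T.semigroup t‖ ≤ 1 := by
  rcases ht.eq_or_lt with rfl | ht
  · rw [semigroup_zero]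
    exact ContinuousLinearMap.norm_id_le
  · exact (norm_semigroup_le ht).trans (exp_alpha_le_one ht)

theorem semigroup_add (s t : ℝ) (hs : 0 ≤ s) (ht : 0 ≤ t) :
    T.semigroup (s + t) = (T.semigroup s).comp (T.semigroup t) := by
  rcases hs.eq_or_lt with rfl | hs
  · rw [zero_add, semigroup_zero, ContinuousLinearMap.id_comp]
  rcases ht.eq_or_lt with rfl | ht
  · rw [add_zero, semigroup_zero, ContinuousLinearMap.comp_id]
  rw [semigroup_of_pos hs, semigroup_of_pos ht, semigroup_of_pos (add_pos hs ht)]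
  refine IsSchur.op_comp_op _ _ _ ?_
  filter_upwards [ae_regular] with ξ hξ
  filter_upwards [ae_regular] with η hη
  exact chapman_kolmogorov hs ht hξ hη

theorem semigroup_ae_eq {t : ℝ} (ht : 0 < t) (f : Lp ℝ 2 T.exitMeasure) :
    T.semigroup t f =ᵐ[T.exitMeasure] T.P t f := by
  rw [semigroup_of_pos ht]
  exact (isSchur_p ht).op_ae_eq f

theorem potential_ae_eq (f : Lp ℝ 2 T.exitMeasure) :
    T.potential f =ᵐ[T.exitMeasure] T.W f := isSchur_U.op_ae_eq f

theorem dense_continuous :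
    Dense (range (ContinuousMap.toLp (E := ℝ) 2 T.exitMeasure ℝ)) :=
  ContinuousMap.toLp_denseRange ℝ T.exitMeasure ℝ ENNReal.ofNat_ne_top

theorem norm_le_of_ae_abs_le {f : Lp ℝ 2 T.exitMeasure} {ε : ℝ} (hε : 0 ≤ ε)
    (h : ∀ᵐ ξ ∂T.exitMeasure, |f ξ| ≤ ε) : ‖f‖ ≤ ε := by
  have := Lp.norm_le_of_ae_bound (f := f) hε h
  simpa [measureUnivNNReal] using this

theorem P_congr {t : ℝ} {f g : T.Boundary → ℝ} (h : f =ᵐ[T.exitMeasure] g) :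
    T.P t f = T.P t g := by
  ext ξ
  exact integral_congr_ae (h.mono fun η hη => by simp only [hη])

/-- Continuous functions are dense, on them the convergence is uniform on the regular points, and
the operators are contractions. -/
theorem tendsto_semigroup (f : Lp ℝ 2 T.exitMeasure) :
    Tendsto (fun t => T.semigroup t f) (𝓝[>] 0) (𝓝 f) := by
  refine tendsto_of_dense dense_continuous
    (eventually_mem_nhdsWithin.mono fun t ht => norm_semigroup_le_one (le_of_lt ht)) ?_ f
  rintro _ ⟨φ, rfl⟩
  have hφ := ContinuousMap.coeFn_toLp (p := 2) (𝕜 := ℝ) T.exitMeasure φ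
  rw [Metric.tendsto_nhds]
  intro ε hε
  filter_upwards [Metric.tendstoUniformlyOn_iff.1 (tendstoUniformlyOn_P φ) (ε / 2) (half_pos hε),
    self_mem_nhdsWithin] with t h1 ht
  rw [dist_eq_norm]
  refine lt_of_le_of_lt (norm_le_of_ae_abs_le (half_pos hε).le ?_) (half_lt_self hε)
  filter_upwards [Lp.coeFn_sub (T.semigroup t (ContinuousMap.toLp 2 T.exitMeasure ℝ φ))
    (ContinuousMap.toLp 2 T.exitMeasure ℝ φ), semigroup_ae_eq ht _, hφ, ae_regular]
    with ξ e1 e2 e3 hξ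
  rw [e1, Pi.sub_apply, e2, e3, P_congr hφ, ← Real.dist_eq, dist_comm]
  exact (h1 ξ hξ).le

theorem continuousOn_semigroup (f : Lp ℝ 2 T.exitMeasure) :
    ContinuousOn (fun t => T.semigroup t f) (Ici 0) :=
  continuousOn_of_semigroup semigroup_zero semigroup_add (fun _ => norm_semigroup_le_one)
    (tendsto_semigroup f)

theorem isSubMarkovSemigroup_semigroup : IsSubMarkovSemigroup T.exitMeasure T.semigroup where
  zero := semigroup_zero
  add := semigroup_add
  continuousOn := continuousOn_semigroup
  subMarkov t ht f hf := by
    rcases ht.eq_or_lt with rfl | ht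
    · rw [semigroup_zero]
      exact hf
    have hf0 : 0 ≤ f := (Lp.coeFn_nonneg f).1 (hf.mono fun ξ h => h.1)
    have h := isSchur_p (T := T) ht
    rw [semigroup_of_pos ht]
    filter_upwards [(Lp.coeFn_nonneg _).2 (h.op_nonneg hf0), h.ofReal_op_ae_eq hf0, h.left]
      with ξ h1 h2 h3
    refine ⟨h1, ?_⟩
    rw [← ENNReal.ofReal_le_one, h2]
    calc ∫⁻ η, T.p t ξ η * ENNReal.ofReal (f η) ∂T.exitMeasure
        ≤ ∫⁻ η, T.p t ξ η ∂T.exitMeasure := by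
          refine lintegral_mono_ae (hf.mono fun η hη => ?_)
          exact mul_le_of_le_one_right' (ENNReal.ofReal_le_one.2 hη.2)
      _ ≤ 1 := h3.trans (ENNReal.ofReal_le_one.2 (exp_alpha_le_one ht))

/-- The sub-Markov loss of mass gives the exponential decay e^{-t/α} of the norm, so the potential
converges as a Bochner integral. -/
theorem integrableOn_semigroup (f : Lp ℝ 2 T.exitMeasure) :
    IntegrableOn (fun t => T.semigroup t f) (Ioi 0) := by
  have hα : -(T.alpha)⁻¹ < 0 := neg_lt_zero.2 (inv_pos.2 alpha_pos)
  refine ((integrableOn_exp_mul_Ioi hα 0).mul_const ‖f‖).mono'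
    (((continuousOn_semigroup f).mono Ioi_subset_Ici_self).aestronglyMeasurable
      measurableSet_Ioi) ?_
  refine (ae_restrict_iff' measurableSet_Ioi).2 (Eventually.of_forall fun t ht => ?_)
  refine (ContinuousLinearMap.le_of_opNorm_le _ (norm_semigroup_le ht) f).trans_eq ?_
  congr 2
  ring

theorem integral_semigroup_of_nonneg {f : Lp ℝ 2 T.exitMeasure} (hf : 0 ≤ f) :
    ∫ t in Ioi (0 : ℝ), T.semigroup t f = T.potential f := by
  -- Tested against u ≥ 0, both sides become integrals of nonnegative kernels, and Tonelli reduces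
  -- the claim to the Green kernel identity at pairs of points.
  refine eq_of_inner_eq_on_nonneg fun u hu => ?_
  have hint := integrableOn_semigroup f
  have hnn : ∀ g : Lp ℝ 2 T.exitMeasure, 0 ≤ g → 0 ≤ inner ℝ g u := by
    intro g hg
    rw [L2.inner_def]
    refine integral_nonneg_of_ae ?_
    filter_upwards [(Lp.coeFn_nonneg _).2 hg, (Lp.coeFn_nonneg _).2 hu] with ξ h1 h2
    simpa using mul_nonneg h2 h1
  have hnt : ∀ t ∈ Ioi (0 : ℝ), 0 ≤ inner ℝ (T.semigroup t f) u := fun t ht => by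
    rw [semigroup_of_pos ht]
    exact hnn _ ((isSchur_p ht).op_nonneg hf)
  have h1 : inner ℝ (∫ t in Ioi (0 : ℝ), T.semigroup t f) u =
      ∫ t in Ioi (0 : ℝ), inner ℝ (T.semigroup t f) u := by
    rw [real_inner_comm, ← integral_inner hint]
    simp only [real_inner_comm]
  have hint' : IntegrableOn (fun t => inner ℝ (T.semigroup t f) u) (Ioi 0) :=
    hint.inner_const u
  rw [h1, potential, ← ENNReal.toReal_ofReal (setIntegral_nonneg measurableSet_Ioi hnt),
    ← ENNReal.toReal_ofReal (hnn _ (isSchur_U.op_nonneg hf)),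
    isSchur_U.ofReal_inner_op hf hu, ofReal_integral_eq_lintegral_ofReal hint'
      ((ae_restrict_iff' measurableSet_Ioi).2 (Eventually.of_forall hnt))]
  congr 1
  have hfm : AEMeasurable (fun y => ENNReal.ofReal (f y)) T.exitMeasure :=
    (Lp.aestronglyMeasurable f).aemeasurable.ennreal_ofReal
  have hum : AEMeasurable (fun y => ENNReal.ofReal (u y)) T.exitMeasure :=
    (Lp.aestronglyMeasurable u).aemeasurable.ennreal_ofReal
  have hfu : AEMeasurable (fun q : T.Boundary × T.Boundary =>
      ENNReal.ofReal (f q.2) * ENNReal.ofReal (u q.1)) (T.exitMeasure.prod T.exitMeasure) :=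
    hfm.comp_snd.mul hum.comp_fst
  have hm : AEMeasurable (fun r : ℝ × (T.Boundary × T.Boundary) => T.p r.1 r.2.1 r.2.2 *
      (ENNReal.ofReal (f r.2.2) * ENNReal.ofReal (u r.2.1)))
      ((volume.restrict (Ioi 0)).prod (T.exitMeasure.prod T.exitMeasure)) :=
    measurable_p_param.aemeasurable.mul hfu.comp_snd
  calc ∫⁻ t in Ioi (0 : ℝ), ENNReal.ofReal (inner ℝ (T.semigroup t f) u)
      = ∫⁻ t in Ioi (0 : ℝ), ∫⁻ q : T.Boundary × T.Boundary, T.p t q.1 q.2 *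
          (ENNReal.ofReal (f q.2) * ENNReal.ofReal (u q.1))
          ∂T.exitMeasure.prod T.exitMeasure := by
        refine setLIntegral_congr_fun measurableSet_Ioi fun t ht => ?_
        simp only [semigroup_of_pos ht]
        exact (isSchur_p ht).ofReal_inner_op hf hu
    _ = ∫⁻ q : T.Boundary × T.Boundary, (∫⁻ t in Ioi (0 : ℝ), T.p t q.1 q.2 *
          (ENNReal.ofReal (f q.2) * ENNReal.ofReal (u q.1)))
          ∂T.exitMeasure.prod T.exitMeasure := lintegral_lintegral_swap hm
    _ = _ := by
        refine lintegral_congr_ae ?_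
        filter_upwards [Measure.quasiMeasurePreserving_fst.ae ae_regular] with q hq
        rw [lintegral_mul_const' _ _ (ENNReal.mul_ne_top ENNReal.ofReal_ne_top
          ENNReal.ofReal_ne_top), lintegral_p_eq_U (regular_subset_accessible hq)]

theorem integral_semigroup (f : Lp ℝ 2 T.exitMeasure) :
    ∫ t in Ioi (0 : ℝ), T.semigroup t f = T.potential f := by
  rw [← posPart_sub_negPart f]
  simp only [map_sub]
  rw [integral_sub (integrableOn_semigroup _) (integrableOn_semigroup _),
    integral_semigroup_of_nonneg (posPart_nonneg f),
    integral_semigroup_of_nonneg (negPart_nonneg f)]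

theorem isGeneratorAt_potential (g : Lp ℝ 2 T.exitMeasure) :
    IsGeneratorAt T.semigroup (T.potential g) (-g) := by
  have := tendsto_generator_potential semigroup_zero semigroup_add (continuousOn_semigroup g)
    (integrableOn_semigroup g)
  rwa [integral_semigroup] at this

/-- If Wg = 0, then the difference quotients of the generator at Wg vanish, while their limit is -g.
-/
theorem injective_potential : Function.Injective T.potential := by
  rw [injective_iff_map_eq_zero]
  intro g hg
  have h := isGeneratorAt_potential g
  rw [IsGeneratorAt, hg] at h
  simp only [map_zero, sub_self, smul_zero] at h
  exact neg_eq_zero.1 (tendsto_nhds_unique h tendsto_const_nhds)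

/-! ### The martingale expansion -/

theorem measurableSet_F_C (n : ℕ) (ξ : T.Boundary) : MeasurableSet[T.F n] (T.C n ξ) :=
  MeasurableSpace.measurableSet_generateFrom (mem_range_self ξ)

theorem F_le (n : ℕ) : T.F n ≤ borel T.Boundary := by
  refine MeasurableSpace.generateFrom_le ?_
  rintro _ ⟨ξ, rfl⟩
  exact T.measurableSet_C n ξ

/-- With `measurable_F_of_congr` this identifies measurability for F_n with dependence on ξ(n) only,
for real functions. -/
theorem mem_iff_of_measurableSet_F {n : ℕ} {s : Set T.Boundary} (hs : MeasurableSet[T.F n] s)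
    {ξ η : T.Boundary} (h : ξ.at n = η.at n) : ξ ∈ s ↔ η ∈ s := by
  induction s, hs using MeasurableSpace.generateFrom_induction with
  | hC s hs _ =>
    obtain ⟨ζ, rfl⟩ := hs
    rw [mem_C_iff, mem_C_iff, h]
  | empty => simp
  | compl s _ ih => simp [ih]
  | iUnion s _ ih => simp [ih]

theorem measurable_F_of_congr {n : ℕ} {h : T.Boundary → ℝ}
    (hh : ∀ ξ η, ξ.at n = η.at n → h ξ = h η) : Measurable[T.F n] h := by
  let _ : MeasurableSpace I := ⊤
  have hat : Measurable[T.F n] fun ξ : T.Boundary => ξ.at n := by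
    refine @measurable_to_countable' _ _ _ _ (T.F n) _ fun i => ?_
    by_cases hi : ∃ ξ : T.Boundary, ξ.at n = i
    · obtain ⟨ξ, rfl⟩ := hi
      convert measurableSet_F_C n ξ using 1
      ext η
      rw [mem_C_iff, eq_comm]
      rfl
    · convert @MeasurableSet.empty _ (T.F n)
      ext η
      simpa using fun h' => hi ⟨η, h'⟩
  intro s _
  have : h ⁻¹' s = (fun ξ : T.Boundary => ξ.at n) ⁻¹'
      ((fun ξ : T.Boundary => ξ.at n) '' (h ⁻¹' s)) := by
    refine (subset_preimage_image _ _).antisymm ?_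
    rintro ξ ⟨η, hη, he⟩
    rw [mem_preimage, ← hh η ξ he]
    exact hη
  rw [this]
  exact hat trivial

section CondExp

variable {f : T.Boundary → ℝ}

/-- This holds everywhere and not only almost surely, because the chosen version is itself
measurable for F_n. -/
theorem condExp_congr_at (n : ℕ) {ξ η : T.Boundary} (h : ξ.at n = η.at n) :
    T.exitMeasure[f | T.F n] ξ = T.exitMeasure[f | T.F n] η := by
  have hm : Measurable[T.F n] (T.exitMeasure[f | T.F n]) := stronglyMeasurable_condExp.measurable
  have := (mem_iff_of_measurableSet_F
    (hm (measurableSet_singleton (T.exitMeasure[f | T.F n] ξ))) h).1 rfl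
  exact (mem_singleton_iff.1 this).symm

theorem setIntegral_condExp_C (hf : Integrable f T.exitMeasure) {n M : ℕ} (h : n ≤ M)
    (ξ : T.Boundary) : ∫ η in T.C n ξ, (T.exitMeasure[f | T.F M]) η ∂T.exitMeasure =
      ∫ η in T.C n ξ, f η ∂T.exitMeasure := by
  classical
  refine setIntegral_condExp (F_le M) hf ?_
  have hm : Measurable[T.F M] ((T.C n ξ).indicator fun _ => (1 : ℝ)) := by
    refine measurable_F_of_congr fun η ζ he => ?_
    have : η ∈ T.C n ξ ↔ ζ ∈ T.C n ξ := by
      rw [mem_C_iff, mem_C_iff, Boundary.at_eq_of_le h he]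
    simp only [indicator, this]
  have := hm (measurableSet_singleton 1)
  convert this using 1
  ext η
  simp [indicator_apply]

theorem measureReal_mul_condExp (hf : Integrable f T.exitMeasure) (n : ℕ) (ξ : T.Boundary) :
    T.exitMeasure.real (T.C n ξ) * (T.exitMeasure[f | T.F n]) ξ =
      ∫ η in T.C n ξ, f η ∂T.exitMeasure := by
  rw [← setIntegral_condExp_C hf le_rfl ξ, setIntegral_congr_fun (T.measurableSet_C n ξ)
    (g := fun _ => (T.exitMeasure[f | T.F n]) ξ)
    fun η hη => (condExp_congr_at n (mem_C_iff.1 hη)).symm, setIntegral_const, smul_eq_mul]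

/-- Summation by parts. -/
theorem sum_mul_mgDiff (e : ℕ → ℝ) (M : ℕ) (ξ : T.Boundary) :
    ∑ n ∈ Finset.range (M + 1), e n * T.mgDiff f n ξ =
      ∑ n ∈ Finset.range M, (e n - e (n + 1)) * (T.exitMeasure[f | T.F n]) ξ +
        e M * (T.exitMeasure[f | T.F M]) ξ := by
  induction M with
  | zero => simp [mgDiff]
  | succ M ih =>
    rw [Finset.sum_range_succ, ih, Finset.sum_range_succ, mgDiff, Pi.sub_apply]
    ring

/-- Below M the kernel averages over C^n(ξ) with weight e_n - e_{n+1}, and the tail multiplies by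
e_M. Summation by parts moves the differences from e to the conditional expectations. -/
theorem IsCoeff.integral_ker_mul_condExp {A : ℕ → T.Boundary → ℝ≥0∞} {e : ℕ → T.Boundary → ℝ}
    (hA : IsCoeff A e) (hf : Integrable f T.exitMeasure) (M : ℕ) {ξ : T.Boundary}
    (hξ : ξ ∈ T.regular) :
    ∫ η, (ker A ξ η).toReal * (T.exitMeasure[f | T.F M]) η ∂T.exitMeasure =
      ∑ n ∈ Finset.range (M + 1), e n ξ * T.mgDiff f n ξ := by
  rw [hA.integral_ker_mul_of_level hξ (M := M) integrable_condExp
    fun η hη => (condExp_congr_at M (mem_C_iff.1 hη)).symm, sum_mul_mgDiff fun n => e n ξ]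
  congr 1
  refine Finset.sum_congr rfl fun n hn => ?_
  rw [setIntegral_condExp_C hf (Finset.mem_range.1 hn).le, ← measureReal_mul_condExp hf,
    ← mul_assoc, hA.toReal_mul_measureReal hξ]

theorem abs_condExp_sub_le (hf : Integrable f T.exitMeasure) {M : ℕ} {ξ : T.Boundary}
    (hξ : ξ ∈ T.regular) {ε : ℝ} (hε : ∀ η ∈ T.C M ξ, |f η - f ξ| ≤ ε) :
    |(T.exitMeasure[f | T.F M]) ξ - f ξ| ≤ ε := by
  have hpos := measureReal_C_pos hξ M
  have h1 : T.exitMeasure.real (T.C M ξ) * ((T.exitMeasure[f | T.F M]) ξ - f ξ) =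
      ∫ η in T.C M ξ, (f η - f ξ) ∂T.exitMeasure := by
    rw [mul_sub, measureReal_mul_condExp hf, integral_sub hf.integrableOn (integrable_const _),
      setIntegral_const, smul_eq_mul]
  have h2 := norm_setIntegral_le_of_norm_le_const (μ := T.exitMeasure) (s := T.C M ξ)
    (f := fun η => f η - f ξ) (C := ε) (measure_lt_top _ _) hε
  rw [← h1, Real.norm_eq_abs, abs_mul, abs_of_pos hpos, mul_comm ε] at h2
  exact le_of_mul_le_mul_left h2 hpos

end CondExp

variable (T) in
/-- The projection `E_μ(· | F_M)` in `L²`. -/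
def levelProj (M : ℕ) : Lp ℝ 2 T.exitMeasure →L[ℝ] Lp ℝ 2 T.exitMeasure :=
  (lpMeas ℝ ℝ (T.F M) 2 T.exitMeasure).subtypeL.comp (condExpL2 ℝ ℝ (F_le M))

theorem levelProj_ae_eq (M : ℕ) (f : Lp ℝ 2 T.exitMeasure) :
    T.levelProj M f =ᵐ[T.exitMeasure] T.exitMeasure[f | T.F M] := by
  have := (Lp.memLp f).condExpL2_ae_eq_condExp (𝕜 := ℝ) (F_le M)
  rwa [Lp.toLp_coeFn] at this

theorem norm_levelProj_le (M : ℕ) : ‖T.levelProj M‖ ≤ 1 :=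
  ContinuousLinearMap.opNorm_le_bound _ zero_le_one fun f =>
    (norm_condExpL2_coe_le (F_le M) f).trans_eq (one_mul _).symm

theorem integrable_of_Lp (f : Lp ℝ 2 T.exitMeasure) : Integrable f T.exitMeasure :=
  (Lp.memLp f).integrable one_le_two

/-- By contraction it suffices to consider continuous functions, for which averages over C^N(ξ) are
uniformly close to the value at ξ. -/
theorem tendsto_levelProj (f : Lp ℝ 2 T.exitMeasure) :
    Tendsto (fun M => T.levelProj M f) atTop (𝓝 f) := by
  refine tendsto_of_dense dense_continuous (Eventually.of_forall norm_levelProj_le) ?_ f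
  rintro _ ⟨φ, rfl⟩
  have hφ := ContinuousMap.coeFn_toLp (p := 2) (𝕜 := ℝ) T.exitMeasure φ
  have hi : Integrable φ T.exitMeasure := (integrable_of_Lp _).congr hφ
  rw [Metric.tendsto_atTop]
  intro ε hε
  obtain ⟨M, hM⟩ := T.exists_level_forall_dist_le φ (half_pos hε)
  refine ⟨M, fun N hN => ?_⟩
  rw [dist_eq_norm]
  refine lt_of_le_of_lt (norm_le_of_ae_abs_le (half_pos hε).le ?_) (half_lt_self hε)
  filter_upwards [Lp.coeFn_sub (T.levelProj N (ContinuousMap.toLp 2 T.exitMeasure ℝ φ))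
    (ContinuousMap.toLp 2 T.exitMeasure ℝ φ), levelProj_ae_eq N _, hφ, ae_regular,
    condExp_congr_ae (m := T.F N) hφ] with ξ e1 e2 e3 hξ e4
  rw [e1, Pi.sub_apply, e2, e3, e4]
  refine abs_condExp_sub_le hi hξ fun η hη => hM η ξ ?_
  exact (Boundary.at_eq_of_le hN (mem_C_iff.1 hη)).symm

theorem semigroup_levelProj_ae_eq {t : ℝ} (ht : 0 < t) (M : ℕ) (f : Lp ℝ 2 T.exitMeasure) :
    T.semigroup t (T.levelProj M f) =ᵐ[T.exitMeasure] fun ξ =>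
      ∑ n ∈ Finset.range (M + 1), expDecay t (T.G n ξ) * T.mgDiff f n ξ := by
  filter_upwards [semigroup_ae_eq ht (T.levelProj M f), ae_regular] with ξ h1 hξ
  rw [h1, P_congr (levelProj_ae_eq M f), P_eq,
    (isCoeff_p ht).integral_ker_mul_condExp (integrable_of_Lp f) M hξ]
  exact Finset.sum_congr rfl fun n _ => by rw [expDecay_G hξ]

theorem memLp_mgDiff (f : Lp ℝ 2 T.exitMeasure) (n : ℕ) :
    MemLp (T.mgDiff f n) 2 T.exitMeasure := by
  have h : ∀ m, MemLp (T.exitMeasure[f | T.F m]) 2 T.exitMeasure := fun m =>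
    (Lp.memLp f).condExp one_le_two
  cases n with
  | zero => exact h 0
  | succ n => exact (h (n + 1)).sub (h n)

theorem memLp_expDecay_mul_mgDiff {t : ℝ} (ht : 0 < t) (f : Lp ℝ 2 T.exitMeasure) (n : ℕ) :
    MemLp (fun ξ => expDecay t (T.G n ξ) * T.mgDiff f n ξ) 2 T.exitMeasure := by
  have hm : Measurable fun ξ : T.Boundary => expDecay t (T.G n ξ) :=
    measurable_expDecay.comp (measurable_const.prodMk (measurable_G n))
  refine (memLp_mgDiff f n).mono (hm.aestronglyMeasurable.mul (memLp_mgDiff f n).1) ?_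
  filter_upwards [ae_regular] with ξ hξ
  rw [norm_mul, expDecay_G hξ, Real.norm_of_nonneg (Real.exp_pos _).le]
  exact mul_le_of_le_one_left (norm_nonneg _) (exp_gReg_le_one ht n ξ)

theorem tendsto_expansion {t : ℝ} (ht : 0 < t) (f : Lp ℝ 2 T.exitMeasure) :
    Tendsto (fun N : ℕ => eLpNorm (fun ξ => T.semigroup t f ξ -
      ∑ n ∈ Finset.range N, expDecay t (T.G n ξ) * T.mgDiff f n ξ) 2 T.exitMeasure)
      atTop (𝓝 0) := by
  -- The partial sum with M + 1 terms is S_t applied to E_μ(f|F_M), so the expansion converges by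
  -- continuity of S_t.
  rw [← tendsto_add_atTop_iff_nat 1]
  have h1 : Tendsto (fun M => T.semigroup t f - T.semigroup t (T.levelProj M f)) atTop (𝓝 0) := by
    have := ((T.semigroup t).continuous.tendsto f).comp (tendsto_levelProj f)
    simpa using this.const_sub (T.semigroup t f)
  have h2 := ENNReal.tendsto_ofReal h1.norm
  rw [norm_zero, ENNReal.ofReal_zero] at h2
  refine h2.congr fun M => ?_
  rw [Lp.norm_def, ENNReal.ofReal_toReal (Lp.memLp _).2.ne]
  refine eLpNorm_congr_ae ?_
  filter_upwards [Lp.coeFn_sub (T.semigroup t f) (T.semigroup t (T.levelProj M f)),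
    semigroup_levelProj_ae_eq ht M f] with ξ e1 e2
  rw [e1, Pi.sub_apply, e2]

/-! ### The image of the potential operator -/

/-- A function measurable for F_N is determined almost everywhere by its integrals over the shadows
of level N. Indexing by all levels up to N is harmless, since these are finitely many. -/
theorem finiteDimensional_lpMeas (N : ℕ) :
    FiniteDimensional ℝ (lpMeas ℝ ℝ (T.F N) 2 T.exitMeasure) := by
  have hfin : Finite {i | T.level i ≤ N} := T.finite_level_le N
  let L : lpMeas ℝ ℝ (T.F N) 2 T.exitMeasure →ₗ[ℝ] ({i | T.level i ≤ N} → ℝ) :=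
    { toFun := fun f i => ∫ η in T.shadow i, (f : Lp ℝ 2 T.exitMeasure) η ∂T.exitMeasure
      map_add' := fun f g => by
        ext i
        rw [Pi.add_apply, ← integral_add (integrable_of_Lp _).integrableOn
          (integrable_of_Lp _).integrableOn]
        exact integral_congr_ae (ae_restrict_of_ae (Lp.coeFn_add _ _))
      map_smul' := fun r f => by
        ext i
        rw [RingHom.id_apply, Pi.smul_apply, smul_eq_mul, ← integral_const_mul]
        exact integral_congr_ae (ae_restrict_of_ae (Lp.coeFn_smul _ _)) }
  refine Module.Finite.of_injective L ?_
  rw [← LinearMap.ker_eq_bot, LinearMap.ker_eq_bot']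
  intro f hf
  refine Subtype.ext (Lp.ext ?_)
  have hfm : AEStronglyMeasurable[T.F N] (f : Lp ℝ 2 T.exitMeasure) T.exitMeasure :=
    mem_lpMeas_iff_aestronglyMeasurable.1 f.2
  filter_upwards [condExp_of_aestronglyMeasurable' (F_le N) hfm (integrable_of_Lp _),
    Lp.coeFn_zero ℝ 2 T.exitMeasure, ae_regular] with ξ h1 h2 hξ
  have h3 := congrFun hf ⟨ξ.at N, (ξ.level_at N).le⟩
  have h4 := measureReal_mul_condExp (integrable_of_Lp (f : Lp ℝ 2 T.exitMeasure)) N ξ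
  rw [C_eq_shadow] at h4
  have h5 : ∫ η in T.shadow (ξ.at N), (f : Lp ℝ 2 T.exitMeasure) η ∂T.exitMeasure = 0 := h3
  rw [h5, ← C_eq_shadow, mul_eq_zero, or_iff_right (measureReal_C_pos hξ N).ne', h1] at h4
  rw [h4]
  exact h2.symm

/-- For f constant on the sets C^N, splitting the kernel U at level N expresses Wf by integrals over
C^n(ξ) with n < N and by G_N f, all functions of ξ(N). -/
theorem potential_mem_lpMeas {N : ℕ} {f : Lp ℝ 2 T.exitMeasure}
    (hf : f ∈ lpMeas ℝ ℝ (T.F N) 2 T.exitMeasure) :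
    T.potential f ∈ lpMeas ℝ ℝ (T.F N) 2 T.exitMeasure := by
  rw [mem_lpMeas_iff_aestronglyMeasurable] at hf ⊢
  have hfe := condExp_of_aestronglyMeasurable' (F_le N) hf (integrable_of_Lp _)
  have hm : Measurable[T.F N] fun ξ : T.Boundary => ∑ n ∈ Finset.range N,
      T.incr n * ∫ η in T.C n ξ, f η ∂T.exitMeasure +
        T.gReg N ξ * (T.exitMeasure[f | T.F N]) ξ := by
    refine measurable_F_of_congr fun ξ η h => ?_
    rw [gReg_congr h, condExp_congr_at N h]
    congr 1
    refine Finset.sum_congr rfl fun n hn => ?_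
    rw [C_eq_C (Boundary.at_eq_of_le (Finset.mem_range.1 hn).le h)]
  refine ⟨_, hm.stronglyMeasurable, ?_⟩
  filter_upwards [potential_ae_eq f, ae_regular] with ξ h1 hξ
  have h2 : T.W f ξ = ∫ η, (ker uCoeff ξ η).toReal * (T.exitMeasure[f | T.F N]) η
      ∂T.exitMeasure := by
    simp only [W, U_eq_ker]
    exact integral_congr_ae (hfe.mono fun η hη => by simp only [hη])
  rw [h1, h2, isCoeff_U.integral_ker_mul_of_level hξ (M := N) integrable_condExp
    fun η hη => (condExp_congr_at N (mem_C_iff.1 hη)).symm]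
  congr 1
  refine Finset.sum_congr rfl fun n hn => ?_
  rw [setIntegral_condExp_C (integrable_of_Lp f) (Finset.mem_range.1 hn).le, uCoeff,
    ENNReal.toReal_ofReal (T.incr_pos n).le]

/-- W restricts to an injective endomorphism of the finite-dimensional space L²(F_N), which is
therefore onto. -/
theorem mem_range_potential {f : Lp ℝ 2 T.exitMeasure} (hf : f ∈ T.simple) :
    f ∈ range T.potential := by
  obtain ⟨N, hN⟩ := hf
  have := finiteDimensional_lpMeas (T := T) N
  let K := (T.potential : Lp ℝ 2 T.exitMeasure →ₗ[ℝ] Lp ℝ 2 T.exitMeasure).restrict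
    (fun _ h => potential_mem_lpMeas (N := N) h)
  have hinj : Function.Injective K := fun a b h =>
    Subtype.ext (injective_potential (congrArg Subtype.val h))
  obtain ⟨g, hg⟩ := LinearMap.injective_iff_surjective.1 hinj
    ⟨f, mem_lpMeas_iff_aestronglyMeasurable.2 hN⟩
  exact ⟨g, congrArg Subtype.val hg⟩

end

end TreeMatrix

end

theorem mainTheorem5 {I : Type*} [Countable I] (T : TreeMatrix I) (hT : T.Transient) :
    -- `p` is a symmetric measurable kernel that satisfies the Chapman-Kolmogorov equations
    (∀ t > 0, Measurable fun q : T.Boundary × T.Boundary => T.p t q.1 q.2) ∧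
    (∀ t > 0, ∀ ξ ∈ T.regular, ∀ η ∈ T.regular, T.p t ξ η = T.p t η ξ) ∧
    (∀ s > 0, ∀ t > 0, ∀ ξ ∈ T.regular, ∀ η ∈ T.regular,
      T.p (s + t) ξ η = ∫⁻ z, T.p s ξ z * T.p t z η ∂T.exitMeasure) ∧
    -- on the regular points `G_0` is a constant `α > 0`, and the total mass is `e^{-t/α}`
    (∃ α : ℝ, 0 < α ∧ (∀ ξ ∈ T.regular, T.G 0 ξ = ENNReal.ofReal α) ∧
      ∀ t > 0, ∀ ξ ∈ T.regular,
        ∫⁻ η, T.p t ξ η ∂T.exitMeasure = ENNReal.ofReal (Real.exp (-t / α))) ∧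
    -- the Feller property on the bounded continuous functions on the set of regular points
    (∀ f : T.Boundary → ℝ, ContinuousOn f T.regular → ∀ c, (∀ ξ ∈ T.regular, |f ξ| ≤ c) →
      (∀ t > 0, ContinuousOn (T.P t f) T.regular ∧ ∀ ξ ∈ T.regular, |T.P t f ξ| ≤ c) ∧
      ∀ ξ ∈ T.regular, Tendsto (fun t => T.P t f ξ) (𝓝[>] 0) (𝓝 (f ξ))) ∧
    -- the Feller property, with uniform convergence, on the restrictions to the set of regular
    -- points of the continuous functions on the (compact) boundary
    (∀ f : C(T.Boundary, ℝ),
      (∀ t > 0, ∃ g : C(T.Boundary, ℝ), EqOn g (T.P t f) T.regular) ∧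
      TendstoUniformlyOn (fun t => T.P t f) f (𝓝[>] 0) T.regular) ∧
    -- the semigroup `S` that `p` induces in `L²(μ)`, and the operator `W` in `L²(μ)`
    (∃ (S : ℝ → Lp ℝ 2 T.exitMeasure →L[ℝ] Lp ℝ 2 T.exitMeasure)
        (Wop : Lp ℝ 2 T.exitMeasure →L[ℝ] Lp ℝ 2 T.exitMeasure),
      IsSubMarkovSemigroup T.exitMeasure S ∧
      (∀ t > 0, ∀ f : Lp ℝ 2 T.exitMeasure,
        (∀ᵐ ξ ∂T.exitMeasure,
          Integrable (fun η => (T.p t ξ η).toReal * f η) T.exitMeasure) ∧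
        S t f =ᵐ[T.exitMeasure] T.P t f) ∧
      (∀ f : Lp ℝ 2 T.exitMeasure,
        (∀ᵐ ξ ∂T.exitMeasure,
          Integrable (fun η => (T.U ξ η).toReal * f η) T.exitMeasure) ∧
        Wop f =ᵐ[T.exitMeasure] T.W f) ∧
      -- the martingale expansion of the semigroup, convergent in `L²(μ)`
      (∀ t > 0, ∀ f : Lp ℝ 2 T.exitMeasure,
        (∀ n, MemLp (fun ξ => expDecay t (T.G n ξ) * T.mgDiff f n ξ) 2 T.exitMeasure) ∧
        Tendsto (fun N : ℕ => eLpNorm (fun ξ => S t f ξ -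
            ∑ n ∈ Finset.range N, expDecay t (T.G n ξ) * T.mgDiff f n ξ) 2 T.exitMeasure)
          atTop (𝓝 0)) ∧
      -- `W` is invertible on its image, which contains the simple functions, and the generator
      -- extends `-W⁻¹`
      Function.Injective Wop ∧
      (∀ f ∈ T.simple, f ∈ range Wop) ∧
      (∀ g : Lp ℝ 2 T.exitMeasure, IsGeneratorAt S (Wop g) (-g)) ∧
      -- the potential of the semigroup is `W`
      (∀ f : Lp ℝ 2 T.exitMeasure, IntegrableOn (fun t => S t f) (Ioi 0) ∧
        ∫ t in Ioi (0 : ℝ), S t f = Wop f)) ∧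
    -- the Green kernel is `U`, on the regular points and more generally wherever the formula for
    -- `p` makes sense
    (∀ ξ ∈ T.regular, ∀ η ∈ T.regular, ∫⁻ t in Ioi (0 : ℝ), T.p t ξ η = T.U ξ η) ∧
    (∀ ξ ∈ T.accessible, ∀ η, ∫⁻ t in Ioi (0 : ℝ), T.p t ξ η = T.U ξ η) := by
  have : T.IsTransient := ⟨hT⟩
  refine ⟨fun t _ => TreeMatrix.measurable_p t, fun t ht ξ hξ η hη => TreeMatrix.p_symm ht hξ hη,
    fun s hs t ht ξ hξ η hη => TreeMatrix.chapman_kolmogorov hs ht hξ hη,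
    ⟨T.alpha, TreeMatrix.alpha_pos, fun ξ hξ => ?_, fun t ht ξ hξ => TreeMatrix.lintegral_p ht hξ⟩,
    fun f hf c hc => ⟨fun t ht => ⟨TreeMatrix.continuousOn_P ht hf hc, fun ξ hξ => TreeMatrix.abs_P_le ht
      (TreeMatrix.ae_of_forall_regular hc) ((abs_nonneg _).trans (hc ξ hξ)) hξ⟩,
      fun ξ hξ => TreeMatrix.tendsto_P hf hc hξ⟩,
    fun f => ⟨fun t ht => TreeMatrix.exists_extension_P ht f, TreeMatrix.tendstoUniformlyOn_P f⟩,
    ⟨T.semigroup, T.potential, TreeMatrix.isSubMarkovSemigroup_semigroup,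
      fun t ht f => ⟨(TreeMatrix.isSchur_p ht).ae_integrable (Lp.memLp f), TreeMatrix.semigroup_ae_eq ht f⟩,
      fun f => ⟨TreeMatrix.isSchur_U.ae_integrable (Lp.memLp f), TreeMatrix.potential_ae_eq f⟩,
      fun t ht f => ⟨TreeMatrix.memLp_expDecay_mul_mgDiff ht f, TreeMatrix.tendsto_expansion ht f⟩,
      TreeMatrix.injective_potential, fun f hf => TreeMatrix.mem_range_potential hf, TreeMatrix.isGeneratorAt_potential,
      fun f => ⟨TreeMatrix.integrableOn_semigroup f, TreeMatrix.integral_semigroup f⟩⟩,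
    fun ξ hξ η _ => TreeMatrix.lintegral_p_eq_U (TreeMatrix.regular_subset_accessible hξ) η,
    fun ξ hξ η => TreeMatrix.lintegral_p_eq_U hξ η⟩
  rw [TreeMatrix.G_eq_gReg hξ, TreeMatrix.gReg_zero]
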